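/- Let $\mathcal H$ be a complex separable Hilbert space with an orthogonal decomposition $\mathcal H=\mathcal H_+\oplus\mathcal H_-$ into two infinite-dimensional closed subspaces, with orthogonal projections $\mathrm{pr}_\pm$, and let $d=i(\mathrm{pr}_+-\mathrm{pr}_-)$. For $\rho\in\mathcal B(\mathcal H)$ let $\rho_{++},\rho_{+-},\rho_{-+},\rho_{--}$ denote its blocks. Let $1\le p\le 2$ and $\frac1p+\frac1q=1$ (so $q=\infty$ if $p=1$). Let $L_r$ denote the Schatten class with norm $\|A\|_r=(\mathrm{Tr}\,(A^*A)^{r/2})^{1/r}$ for $r<\infty$, and let $L_\infty$ denote the compact operators with the operator norm. Put $$L_{\mathrm{res},p}=\{A\in\mathcal B(\mathcal H)\mid [d,A]\in L_p(\mathcal H)\},\qquad \|A\|_{\mathrm{res},p}=\|A\|+\|[d,A]\|_p,$$ $$\mathrm U_{\mathrm{res},p}=\mathrm U(\mathcal H)\cap L_{\mathrm{res},p},\qquad \mathfrak u_{\mathrm{res},p}=\{A\in L_{\mathrm{res},p}\mid A^*=-A\},$$ $$\mathfrak u_{1,q}=\{\rho\in\mathcal B(\mathcal H)\mid \rho^*=-\rho,\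 [d,\rho]\in L_q(\mathcal H),\ \rho_{++}\in L_1(\mathcal H_+),\ \rho_{--}\in L_1(\mathcal H_-)\},$$ with $\|\rho\|_{1,q}=\|\rho_{++}\|_1+\|\rho_{--}\|_1+\|\rho_{+-}\|_q+\|\rho_{-+}\|_q$, and $\mathrm{Tr_{res}}(\rho)=\mathrm{Tr}(\rho_{++})+\mathrm{Tr}(\rho_{--})$. The group $\mathrm U_{\mathrm{res},p}$ carries the topology of $L_{\mathrm{res},p}$; it is a Banach Lie group modelled on $\mathfrak u_{\mathrm{res},p}$ for which the inclusion into $L_{\mathrm{res},p}$ is a smooth embedding. Then: 1. For $g\in\mathrm U_{\mathrm{res},p}$ the operator $\sigma(g)=gdg^{-1}-d$ belongs to $\mathfrak u_{1,q}$. The map $\mathrm{Ad}^*_{g^{-1}}\colon\mu\mapsto g\mu g^{-1}$ is a bounded linear automorphism of $\mathfrak u_{1,q}$, multiplicative in $g$. It is the coadjoint action: for $\mu,\nu\in\mathfrak u_{1,q}$ one has $\nu=g\mu g^{-1}$ if and only if $\mathrm{Tr_{res}}(\nu A)=\mathrm{Tr_{res}}(\mu\, g^{-1}Ag)$ for all $A\in\mathfrak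 u_{\mathrm{res},p}$. 2. The formula $$g\cdot(\mu,\gamma)=\bigl(g\mu g^{-1}-\gamma\,\sigma(g),\ \gamma\bigr),\qquad \mu\in\mathfrak u_{1,q},\ \gamma\in\mathbb R,$$ defines an action of the group $\mathrm U_{\mathrm{res},p}$ on $\mathfrak u_{1,q}\oplus\mathbb R$. It maps each slice $\mathfrak u_{1,q}\oplus\{\gamma\}$ to itself, and acts on it by bicontinuous affine bijections. 3. For every $\gamma\ne0$, the isotropy group of $(0,\gamma)$ is $\mathrm U(\mathcal H_+)\times\mathrm U(\mathcal H_-)$, embedded injectively in $\mathrm U_{\mathrm{res},p}$ by $(u,v)\mapsto u\oplus v$. It is a Banach Lie subgroup of $\mathrm U_{\mathrm{res},p}$: with the subspace topology it is a Banach Lie group, and its inclusion is a smooth embedding (locally, in charts, the inclusion of a complemented closed subspace). -/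

import Mathlib

set_option linter.unusedSectionVars false
open scoped ENNReal InnerProductSpace

namespace RestrictedGrassmannian

universe u v w

section Schatten

variable {E : Type u} [NormedAddCommGroup E] [InnerProductSpace ℂ E] [CompleteSpace E]
  {F : Type v} [NormedAddCommGroup F] [InnerProductSpace ℂ F] [CompleteSpace F]
  {G : Type w} [NormedAddCommGroup G] [InnerProductSpace ℂ G] [CompleteSpace G]

/-- The index set of a chosen orthonormal (Hilbert) basis of `E`. -/
def basisSet (E : Type u) [NormedAddCommGroup E] [InnerProductSpace ℂ E] [CompleteSpace E] :
    Set E :=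
  (exists_hilbertBasis ℂ E).choose

/-- A chosen orthonormal (Hilbert) basis of `E`. -/
noncomputable def basis (E : Type u) [NormedAddCommGroup E] [InnerProductSpace ℂ E]
    [CompleteSpace E] : HilbertBasis (basisSet E) ℂ E :=
  (exists_hilbertBasis ℂ E).choose_spec.choose

/-- The trace `∑ ⟪e, T e⟫ ∈ [0, ∞]` of a positive operator `T` (independent of the basis). -/
noncomputable def positiveTrace (T : E →L[ℂ] E) : ℝ≥0∞ :=
  ∑' i, ENNReal.ofReal (⟪basis E i, T (basis E i)⟫_ℂ).re

/-- The trace `∑ ⟪e, T e⟫` of a trace class operator `T`. -/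
noncomputable def operatorTrace (T : E →L[ℂ] E) : ℂ :=
  ∑' i, ⟪basis E i, T (basis E i)⟫_ℂ

/-- `Tr ((A* A)^(p/2)) ∈ [0, ∞]`, for a bounded operator `A` and a real exponent `p`. -/
noncomputable def schattenTrace (p : ℝ) (A : E →L[ℂ] F) : ℝ≥0∞ :=
  positiveTrace ((ContinuousLinearMap.adjoint A ∘L A) ^ (p / 2))

/-- `A ∈ L_p(E, F)`: for `p < ∞` this means `Tr ((A* A)^(p/2)) < ∞`, and `L_∞` consists of the
compact operators. -/
def MemSchatten (p : ℝ≥0∞) (A : E →L[ℂ] F) : Prop :=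
  if p = ∞ then IsCompactOperator A else schattenTrace p.toReal A < ∞

/-- The norm of `L_p(E, F)`: `‖A‖_p = (Tr ((A* A)^(p/2)))^(1/p)` for `p < ∞`, and the operator norm
for `p = ∞`. -/
noncomputable def schattenNorm (p : ℝ≥0∞) (A : E →L[ℂ] F) : ℝ :=
  if p = ∞ then ‖A‖ else (schattenTrace p.toReal A).toReal ^ (1 / p.toReal)

open ContinuousLinearMap (adjoint)

/-- The positive operator `A* A`. -/
noncomputable abbrev sqAbs (A : E →L[ℂ] F) : E →L[ℂ] E := adjoint A ∘L A

theorem sqAbs_nonneg (A : E →L[ℂ] F) : 0 ≤ sqAbs A := by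
  rw [ContinuousLinearMap.nonneg_iff_isPositive]
  exact ContinuousLinearMap.isPositive_adjoint_comp_self A

theorem sqAbs_sa (A : E →L[ℂ] F) : IsSelfAdjoint (sqAbs A) :=
  (sqAbs_nonneg A).isSelfAdjoint

/-- The operator `f(A* A)`, by continuous functional calculus. -/
noncomputable abbrev fc (A : E →L[ℂ] F) (f : ℝ → ℝ) : E →L[ℂ] E := cfc f (sqAbs A)

theorem fc_adj (A : E →L[ℂ] F) (f : ℝ → ℝ) : adjoint (fc A f) = fc A f :=
  (cfc_predicate f (sqAbs A) : IsSelfAdjoint _)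

theorem spec_nonneg (A : E →L[ℂ] F) {x : ℝ} (hx : x ∈ spectrum ℝ (sqAbs A)) : 0 ≤ x :=
  spectrum_nonneg_of_nonneg (sqAbs_nonneg A) hx

theorem fc_mul (A : E →L[ℂ] F) {f g : ℝ → ℝ} (hf : Continuous f) (hg : Continuous g) :
    fc A f ∘L fc A g = fc A (fun x => f x * g x) :=
  (cfc_mul f g (sqAbs A) hf.continuousOn hg.continuousOn).symm

theorem fc_congr (A : E →L[ℂ] F) {f g : ℝ → ℝ} (h : ∀ x, 0 ≤ x → f x = g x) :
    fc A f = fc A g :=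
  cfc_congr fun _ hx => h _ (spec_nonneg A hx)

theorem inner_fc_sq (A : E →L[ℂ] F) {f : ℝ → ℝ} (hf : Continuous f) (x : E) :
    ⟪x, fc A (fun t => f t * f t) x⟫_ℂ = (‖fc A f x‖ ^ 2 : ℝ) := by
  rw [← fc_mul A hf hf, ContinuousLinearMap.comp_apply,
    ← ContinuousLinearMap.adjoint_inner_left, fc_adj, inner_self_eq_norm_sq_to_K]
  norm_cast

theorem norm_fc_sqrt (A : E →L[ℂ] F) (x : E) : ‖fc A Real.sqrt x‖ = ‖A x‖ := by
  have h := inner_fc_sq A Real.continuous_sqrt x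
  rw [fc_congr A (g := fun x => x) (fun x hx => Real.mul_self_sqrt hx)] at h
  rw [fc, cfc_id' ℝ (sqAbs A) (sqAbs_sa A)] at h
  simp only [ContinuousLinearMap.comp_apply, ContinuousLinearMap.adjoint_inner_right] at h
  rw [inner_self_eq_norm_sq_to_K] at h
  have h2 : ‖A x‖ ^ 2 = ‖fc A Real.sqrt x‖ ^ 2 := by
    have := congrArg Complex.re h
    norm_cast at this
  exact (pow_left_inj₀ (norm_nonneg _) (norm_nonneg _) two_ne_zero).1 h2.symm

/-- Factorization through a contraction. -/
theorem exists_contraction (X : E →L[ℂ] F) (Y : E →L[ℂ] G) (h : ∀ x, ‖X x‖ ≤ ‖Y x‖) :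
    ∃ W : G →L[ℂ] F, ‖W‖ ≤ 1 ∧ ∀ x, W (Y x) = X x := by
  let R : Submodule ℂ G := (LinearMap.range (Y : E →ₗ[ℂ] G)).topologicalClosure
  have : CompleteSpace R := Submodule.topologicalClosure.completeSpace _
  let e : E →ₗ[ℂ] R := (Y : E →ₗ[ℂ] G).codRestrict R
    (fun x => Submodule.le_topologicalClosure _ ⟨x, rfl⟩)
  have hd : DenseRange e := by
    rw [DenseRange, Subtype.dense_iff]
    intro y hy
    have : (Subtype.val '' Set.range e) = (LinearMap.range (Y : E →ₗ[ℂ] G) : Set G) := by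
      ext z; simp [e]
    have hy' : y ∈ closure (LinearMap.range (Y : E →ₗ[ℂ] G) : Set G) := hy
    rw [← this] at hy'
    exact hy'
  have hn : ∃ C, ∀ x, ‖(X : E →ₗ[ℂ] F) x‖ ≤ C * ‖e x‖ := ⟨1, fun x => by simpa [e] using h x⟩
  let W0 : R →L[ℂ] F := (X : E →ₗ[ℂ] F).extendOfNorm e
  refine ⟨W0 ∘L R.orthogonalProjectionOnto, ?_, fun x => ?_⟩
  · have h1 : ‖W0‖ ≤ 1 := LinearMap.opNorm_extendOfNorm_le hd zero_le_one
      (fun x => by simpa [e] using h x)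
    calc _ ≤ ‖W0‖ * ‖R.orthogonalProjectionOnto‖ := ContinuousLinearMap.opNorm_comp_le _ _
      _ ≤ 1 * 1 := by gcongr; exact Submodule.orthogonalProjectionOnto_norm_le R
      _ = 1 := one_mul 1
  · have : R.orthogonalProjectionOnto (Y x) = e x :=
      Submodule.orthogonalProjectionOnto_mem_subspace_eq_self (e x)
    rw [ContinuousLinearMap.comp_apply, this]
    exact LinearMap.extendOfNorm_eq hd hn x

theorem schattenTrace_eq {p : ℝ} (hp : 0 < p) (A : E →L[ℂ] F) :
    schattenTrace p A = ∑' i, ‖fc A (fun x => x ^ (p / 4)) (basis E i)‖ₑ ^ 2 := by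
  rw [schattenTrace, positiveTrace]
  refine tsum_congr fun i => ?_
  have h1 : (sqAbs A) ^ (p / 2) = fc A (fun x => x ^ (p / 4) * x ^ (p / 4)) := by
    rw [CFC.rpow_eq_cfc_real (sqAbs_nonneg A)]
    refine fc_congr A fun x hx => ?_
    rw [← Real.rpow_add_of_nonneg hx (by positivity) (by positivity)]
    ring_nf
  rw [h1, inner_fc_sq A (Real.continuous_rpow_const (by positivity))]
  rw [Complex.ofReal_re, ENNReal.ofReal_pow (norm_nonneg _), ofReal_norm]

theorem enorm_sq_eq_tsum {ι : Type*} (b : HilbertBasis ι ℂ E) (x : E) :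
    ‖x‖ₑ ^ 2 = ∑' i, ‖⟪b i, x⟫_ℂ‖ₑ ^ 2 := by
  have h := b.hasSum_inner_mul_inner x x
  have h2 : HasSum (fun i => ‖⟪b i, x⟫_ℂ‖ ^ 2) (‖x‖ ^ 2) := by
    have h3 := Complex.hasSum_re h
    rw [inner_self_eq_norm_sq_to_K] at h3
    convert! h3 using 1
    · ext i
      rw [← inner_conj_symm x (b i), ← Complex.normSq_eq_conj_mul_self, Complex.ofReal_re,
        Complex.normSq_eq_norm_sq]
    · norm_cast
  have h4 := ENNReal.ofReal_tsum_of_nonneg (fun i => by positivity) h2.summable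
  rw [h2.tsum_eq, ENNReal.ofReal_pow (norm_nonneg _), ofReal_norm] at h4
  rw [h4]
  refine tsum_congr fun i => ?_
  rw [ENNReal.ofReal_pow (norm_nonneg _), ofReal_norm]

theorem hs_adjoint {ι κ : Type*} (b : HilbertBasis ι ℂ E) (c : HilbertBasis κ ℂ F)
    (X : E →L[ℂ] F) : ∑' i, ‖X (b i)‖ₑ ^ 2 = ∑' j, ‖adjoint X (c j)‖ₑ ^ 2 := by
  simp_rw [enorm_sq_eq_tsum c (X _), enorm_sq_eq_tsum b (adjoint X _),
    ContinuousLinearMap.adjoint_inner_right]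
  rw [ENNReal.tsum_comm]
  refine tsum_congr fun j => tsum_congr fun i => ?_
  rw [← inner_conj_symm, ← ofReal_norm, RCLike.norm_conj, ofReal_norm]

theorem hs_contraction {ι κ : Type*} (b : HilbertBasis ι ℂ E) (c : HilbertBasis κ ℂ F)
    (S : E →L[ℂ] E) (hS : adjoint S = S) (X : F →L[ℂ] E) (hX : ‖X‖ ≤ 1) :
    ∑' j, ‖S (X (c j))‖ₑ ^ 2 ≤ ∑' i, ‖S (b i)‖ₑ ^ 2 := by
  have h1 := hs_adjoint c b (S ∘L X)
  simp only [ContinuousLinearMap.comp_apply, ContinuousLinearMap.adjoint_comp, hS] at h1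
  rw [h1]
  refine ENNReal.tsum_le_tsum fun i => ?_
  gcongr
  rw [← ofReal_norm, ← ofReal_norm]
  apply ENNReal.ofReal_le_ofReal
  refine (ContinuousLinearMap.le_opNorm _ _).trans ?_
  rw [LinearIsometryEquiv.norm_map]
  exact mul_le_of_le_one_left (norm_nonneg _) hX


theorem quad_nonneg (A : E →L[ℂ] F) {g : ℝ → ℝ} (hg : ∀ x ∈ spectrum ℝ (sqAbs A), 0 ≤ g x)
    (x : E) : 0 ≤ (⟪x, fc A g x⟫_ℂ).re := by
  have h : 0 ≤ fc A g := cfc_nonneg hg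
  rw [ContinuousLinearMap.nonneg_iff_isPositive] at h
  exact h.re_inner_nonneg_right x

theorem fc_affine (A : E →L[ℂ] F) {g h : ℝ → ℝ} (hg : Continuous g) (hh : Continuous h)
    (c d : ℝ) (x : E) :
    (⟪x, fc A (fun t => g t + (c * h t + d)) x⟫_ℂ).re =
      (⟪x, fc A g x⟫_ℂ).re + (c * (⟪x, fc A h x⟫_ℂ).re + d * ‖x‖ ^ 2) := by
  have h0 := sqAbs_sa A
  have h1 : fc A (fun t => g t + (c * h t + d)) = fc A g + (c • fc A h + d • 1) := by
    rw [fc, cfc_add (sqAbs A) g (fun t => c * h t + d) hg.continuousOn (by fun_prop),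
      cfc_add (sqAbs A) (fun t => c * h t) (fun _ => d) (by fun_prop) (by fun_prop),
      cfc_const_mul c h (sqAbs A) hh.continuousOn, cfc_const d (sqAbs A) h0,
      Algebra.algebraMap_eq_smul_one]
  rw [h1]
  simp only [add_apply, smul_apply,
    one_apply_eq_self, inner_add_right, Complex.add_re]
  have h2 : ∀ (r : ℝ) (y : E), (⟪x, r • y⟫_ℂ).re = r * (⟪x, y⟫_ℂ).re := by
    intro r y
    rw [← Complex.coe_smul, inner_smul_right, Complex.re_ofReal_mul]
  rw [h2, h2]
  congr 3
  rw [inner_self_eq_norm_sq_to_K]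
  norm_cast

theorem jensen (A : E →L[ℂ] F) {p : ℝ} (hp : 1 ≤ p) (w : E) (hw : ‖w‖ ≤ 1) :
    (‖fc A (fun x => x ^ (1 / 4 : ℝ)) w‖ ^ 2) ^ p ≤ ‖fc A (fun x => x ^ (p / 4)) w‖ ^ 2 := by
  have hp0 : 0 < p := by linarith
  set t := ‖fc A (fun x => x ^ (1 / 4 : ℝ)) w‖ ^ 2 with ht
  have ht0 : 0 ≤ t := by positivity
  have hc1 : Continuous fun x : ℝ => x ^ (1 / 4 : ℝ) :=
    Real.continuous_rpow_const (by positivity)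
  have hc2 : Continuous fun x : ℝ => x ^ (p / 4) := Real.continuous_rpow_const (by positivity)
  have hpos := quad_nonneg A (g := fun x => x ^ (p / 4) * x ^ (p / 4) +
    ((-(p * t ^ (p - 1))) * (x ^ (1 / 4 : ℝ) * x ^ (1 / 4 : ℝ)) + (p - 1) * t ^ p)) (by
      intro x hx
      have hx0 := spec_nonneg A hx
      have e1 : x ^ (p / 4) * x ^ (p / 4) = (x ^ (1 / 2 : ℝ)) ^ p := by
        rw [← Real.rpow_add_of_nonneg hx0 (by positivity) (by positivity), ← Real.rpow_mul hx0]
        ring_nf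
      have e2 : x ^ (1 / 4 : ℝ) * x ^ (1 / 4 : ℝ) = x ^ (1 / 2 : ℝ) := by
        rw [← Real.rpow_add_of_nonneg hx0 (by positivity) (by positivity)]
        norm_num
      simp only [e1, e2]
      set y := x ^ (1 / 2 : ℝ)
      have hy : 0 ≤ y := by positivity
      have key := Real.geom_mean_le_arith_mean2_weighted (w₁ := 1 / p) (w₂ := 1 - 1 / p)
        (p₁ := y ^ p) (p₂ := t ^ p) (by positivity)
        (by rw [sub_nonneg, div_le_one hp0]; exact hp) (by positivity) (by positivity) (by ring)
      rw [← Real.rpow_mul hy, ← Real.rpow_mul ht0] at key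
      have e3 : p * (1 / p) = 1 := by field_simp
      have e4 : p * (1 - 1 / p) = p - 1 := by field_simp
      rw [e3, e4, Real.rpow_one] at key
      have key2 := mul_le_mul_of_nonneg_left key hp0.le
      have e5 : p * (1 / p * y ^ p + (1 - 1 / p) * t ^ p) = y ^ p + (p - 1) * t ^ p := by
        field_simp
      rw [e5] at key2
      linarith) w
  rw [fc_affine A (g := fun x => x ^ (p / 4) * x ^ (p / 4)) (hc2.mul hc2)
    (h := fun x => x ^ (1 / 4 : ℝ) * x ^ (1 / 4 : ℝ)) (hc1.mul hc1), inner_fc_sq A hc2, inner_fc_sq A hc1,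
    Complex.ofReal_re, Complex.ofReal_re, ← ht] at hpos
  have e6 : t ^ (p - 1) * t = t ^ p := by
    rcases eq_or_lt_of_le ht0 with h | h
    · rw [← h, mul_zero, Real.zero_rpow hp0.ne']
    · rw [← Real.rpow_add_one h.ne', sub_add_cancel]
  have e7 : (p - 1) * t ^ p * ‖w‖ ^ 2 ≤ (p - 1) * t ^ p :=
    mul_le_of_le_one_right (mul_nonneg (by linarith) (by positivity))
      (pow_le_one₀ (norm_nonneg _) hw)
  have e8 : -(p * t ^ (p - 1)) * t = - (p * t ^ p) := by rw [← e6]; ring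
  rw [e8] at hpos
  linarith

theorem norm_adj_le_one {X : E →L[ℂ] F} (hX : ‖X‖ ≤ 1) : ‖adjoint X‖ ≤ 1 := by
  rwa [LinearIsometryEquiv.norm_map]

theorem norm_comp_le_one {X : E →L[ℂ] F} {Y : F →L[ℂ] G} (hX : ‖X‖ ≤ 1) (hY : ‖Y‖ ≤ 1) :
    ‖Y ∘L X‖ ≤ 1 :=
  (ContinuousLinearMap.opNorm_comp_le _ _).trans (mul_le_one₀ hY (norm_nonneg _) hX)

theorem sum_inner_le (A : E →L[ℂ] F) {p : ℝ} (hp : 1 ≤ p) {ι : Type*} (e : HilbertBasis ι ℂ G)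
    (X : G →L[ℂ] E) (Y : G →L[ℂ] F) (hX : ‖X‖ ≤ 1) (hY : ‖Y‖ ≤ 1) :
    ∑' i, ‖⟪Y (e i), A (X (e i))⟫_ℂ‖ₑ ^ p ≤ schattenTrace p A := by
  have hp0 : 0 < p := by linarith
  obtain ⟨U, hU, hUA⟩ := exists_contraction A (fc A Real.sqrt) (fun x => (norm_fc_sqrt A x).ge)
  set R := fc A (fun x => x ^ (1 / 4 : ℝ)) with hR
  set S := fc A (fun x => x ^ (p / 4)) with hS
  have hRR : ∀ x, fc A Real.sqrt x = R (R x) := by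
    intro x
    rw [← ContinuousLinearMap.comp_apply, hR, fc_mul A
      (Real.continuous_rpow_const (by positivity)) (Real.continuous_rpow_const (by positivity)),
      fc_congr A fun y hy => ?_]
    rw [← Real.rpow_add_of_nonneg hy (by positivity) (by positivity), Real.sqrt_eq_rpow]
    norm_num
  have hW : ‖adjoint U ∘L Y‖ ≤ 1 := norm_comp_le_one hY (norm_adj_le_one hU)
  set W := adjoint U ∘L Y with hWdef
  have hpt : ∀ i, ‖⟪Y (e i), A (X (e i))⟫_ℂ‖ₑ ^ p ≤
      2⁻¹ * (‖S (W (e i))‖ₑ ^ 2 + ‖S (X (e i))‖ₑ ^ 2) := by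
    intro i
    have h1 : ⟪Y (e i), A (X (e i))⟫_ℂ = ⟪R (W (e i)), R (X (e i))⟫_ℂ := by
      rw [← hUA, hRR, ← ContinuousLinearMap.adjoint_inner_left,
        ← ContinuousLinearMap.adjoint_inner_left, hR, fc_adj]
      rfl
    have hnorm : ∀ (Z : G →L[ℂ] E), ‖Z‖ ≤ 1 → ‖Z (e i)‖ ≤ 1 := by
      intro Z hZ
      refine (Z.le_opNorm _).trans ?_
      rw [e.orthonormal.1 i, mul_one]; exact hZ
    have hw := jensen A hp (W (e i)) (hnorm W hW)
    have hx := jensen A hp (X (e i)) (hnorm X hX)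
    rw [← hR, ← hS] at hw hx
    set a := ‖R (W (e i))‖
    set b := ‖R (X (e i))‖
    have ha : 0 ≤ a := norm_nonneg _
    have hb : 0 ≤ b := norm_nonneg _
    have h2 : ‖⟪Y (e i), A (X (e i))⟫_ℂ‖ ≤ a * b := by
      rw [h1]; exact norm_inner_le_norm _ _
    have h3 : ‖⟪Y (e i), A (X (e i))⟫_ℂ‖ ^ p ≤
        2⁻¹ * (‖S (W (e i))‖ ^ 2 + ‖S (X (e i))‖ ^ 2) := by
      calc _ ≤ (a * b) ^ p := Real.rpow_le_rpow (norm_nonneg _) h2 hp0.le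
        _ = a ^ p * b ^ p := Real.mul_rpow ha hb
        _ ≤ 2⁻¹ * ((a ^ 2) ^ p + (b ^ 2) ^ p) := by
          have ea : (a ^ 2) ^ p = (a ^ p) ^ 2 := by
            rw [← Real.rpow_natCast, ← Real.rpow_natCast, ← Real.rpow_mul ha,
              ← Real.rpow_mul ha, mul_comm]
          have eb : (b ^ 2) ^ p = (b ^ p) ^ 2 := by
            rw [← Real.rpow_natCast, ← Real.rpow_natCast, ← Real.rpow_mul hb,
              ← Real.rpow_mul hb, mul_comm]
          rw [ea, eb]
          nlinarith [sq_nonneg (a ^ p - b ^ p)]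
        _ ≤ _ := by gcongr
    have h4 := ENNReal.ofReal_le_ofReal h3
    rw [← ENNReal.ofReal_rpow_of_nonneg (norm_nonneg _) hp0.le, ENNReal.ofReal_mul (by norm_num),
      ENNReal.ofReal_add (by positivity) (by positivity), ENNReal.ofReal_pow (norm_nonneg _),
      ENNReal.ofReal_pow (norm_nonneg _), ofReal_norm, ofReal_norm, ofReal_norm,
      ENNReal.ofReal_inv_of_pos (by norm_num)] at h4
    simpa using h4
  have hSadj : adjoint S = S := fc_adj A _
  calc _ ≤ ∑' i, 2⁻¹ * (‖S (W (e i))‖ₑ ^ 2 + ‖S (X (e i))‖ₑ ^ 2) := ENNReal.tsum_le_tsum hpt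
    _ = 2⁻¹ * (∑' i, ‖S (W (e i))‖ₑ ^ 2 + ∑' i, ‖S (X (e i))‖ₑ ^ 2) := by
      rw [ENNReal.tsum_mul_left, ENNReal.tsum_add]
    _ ≤ 2⁻¹ * (schattenTrace p A + schattenTrace p A) := by
      rw [schattenTrace_eq hp0]
      gcongr
      · exact hs_contraction (basis E) e S hSadj W hW
      · exact hs_contraction (basis E) e S hSadj X hX
    _ = schattenTrace p A := by
      rw [← two_mul, ← mul_assoc, ENNReal.inv_mul_cancel (by norm_num) (by norm_num), one_mul]

theorem fc_eigen (A : E →L[ℂ] F) {g : ℝ → ℝ} (hg : Continuous g) {s : ℝ} {f : E}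
    (h : sqAbs A f = (s : ℂ) • f) : fc A g f = (g s : ℂ) • f := by
  have h0 := sqAbs_sa A
  have hlin : ∀ (k : ℝ → ℝ), Continuous k → ∀ c : ℝ,
      fc A (fun x => k x - c) f = fc A k f - (c : ℂ) • f := by
    intro k hk c
    rw [fc, cfc_sub (a := sqAbs A) k (fun _ => c) hk.continuousOn (by fun_prop),
      cfc_const c (sqAbs A) h0, Algebra.algebraMap_eq_smul_one]
    simp
  have hbd : ∀ ε > 0, ‖fc A (fun x => g x - g s) f‖ ^ 2 ≤ ε * ‖f‖ ^ 2 := by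
    intro ε hε
    obtain ⟨δ, hδ, hgδ⟩ := Metric.continuousAt_iff.1 hg.continuousAt (Real.sqrt ε)
      (Real.sqrt_pos.2 hε)
    have hcomp : IsCompact (spectrum ℝ (sqAbs A)) :=
      ContinuousFunctionalCalculus.isCompact_spectrum _
    obtain ⟨M, hM⟩ := hcomp.exists_bound_of_continuousOn
      (f := fun x => (g x - g s) ^ 2) (by fun_prop)
    have hpos := quad_nonneg A (g := fun x => (M / δ ^ 2) * ((x - s) * (x - s)) +
      ((-1) * ((g x - g s) * (g x - g s)) + ε)) (by
        intro x hx
        have hMx := hM x hx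
        rw [Real.norm_eq_abs, abs_of_nonneg (sq_nonneg _)] at hMx
        have hM0 : 0 ≤ M := (sq_nonneg _).trans hMx
        by_cases hd : dist x s < δ
        · have h1 := hgδ hd
          rw [Real.dist_eq] at h1
          have h2 : (g x - g s) ^ 2 ≤ ε := by
            rw [← sq_abs]
            calc _ ≤ (Real.sqrt ε) ^ 2 := by gcongr
              _ = ε := Real.sq_sqrt hε.le
          have : 0 ≤ (M / δ ^ 2) * ((x - s) * (x - s)) :=
            mul_nonneg (by positivity) (mul_self_nonneg _)
          nlinarith
        · push Not at hd
          rw [Real.dist_eq] at hd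
          have h1 : δ ^ 2 ≤ (x - s) ^ 2 := by
            rw [← sq_abs (x - s)]; gcongr
          have h2 : M ≤ (M / δ ^ 2) * ((x - s) * (x - s)) := by
            rw [div_mul_eq_mul_div, le_div_iff₀ (by positivity)]
            nlinarith
          nlinarith) f
    rw [fc_affine A (g := fun x => (M / δ ^ 2) * ((x - s) * (x - s))) (by fun_prop)
      (h := fun x => (g x - g s) * (g x - g s)) (by fun_prop),
      inner_fc_sq A (f := fun x => g x - g s) (by fun_prop), Complex.ofReal_re] at hpos
    have hz : fc A (fun x => (M / δ ^ 2) * ((x - s) * (x - s))) f = 0 := by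
      have e : fc A (fun x => (M / δ ^ 2) * ((x - s) * (x - s))) =
          fc A (fun x => (M / δ ^ 2) * (x - s)) ∘L fc A (fun x => x - s) := by
        rw [fc_mul A (by fun_prop) (by fun_prop)]
        exact fc_congr A fun x _ => by ring
      rw [e, ContinuousLinearMap.comp_apply, hlin (fun x => x) continuous_id s,
        show fc A (fun x => x) = sqAbs A from cfc_id' ℝ (sqAbs A) h0, h, sub_self, map_zero]
    rw [hz, inner_zero_right, Complex.zero_re] at hpos
    linarith
  have hz : ‖fc A (fun x => g x - g s) f‖ ^ 2 ≤ 0 := by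
    refine le_of_forall_pos_le_add fun ε hε => ?_
    have h1 := hbd (ε / (‖f‖ ^ 2 + 1)) (by positivity)
    refine h1.trans ?_
    rw [zero_add, div_mul_eq_mul_div, div_le_iff₀ (by positivity)]
    nlinarith
  have hz2 : fc A (fun x => g x - g s) f = 0 := by
    rw [← norm_eq_zero]
    exact pow_eq_zero_iff two_ne_zero |>.1 (le_antisymm hz (by positivity))
  rw [hlin g hg] at hz2
  exact sub_eq_zero.1 hz2

theorem exists_eigenbasis (A : E →L[ℂ] F) (hA : IsCompactOperator A) :
    ∃ (ι : Type u) (f : HilbertBasis ι ℂ E) (s : ι → ℝ),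
      ∀ i, sqAbs A (f i) = (s i : ℂ) • f i := by
  have hT : IsCompactOperator (sqAbs A) := hA.clm_comp (adjoint A)
  have hs : (sqAbs A).IsSymmetric := (sqAbs_sa A).isSymmetric
  let V : ℂ → Submodule ℂ E := fun μ => Module.End.eigenspace (sqAbs A : Module.End ℂ E) μ
  have hV : ∀ μ, CompleteSpace (V μ) := by
    intro μ
    have hc : IsClosed (V μ : Set E) := by
      have : (V μ : Set E) = {x | sqAbs A x = μ • x} := by
        ext x; exact Module.End.mem_eigenspace_iff
      rw [this]
      exact isClosed_eq (sqAbs A).continuous (continuous_const_smul μ)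
    exact hc.completeSpace_coe
  have hfam : OrthogonalFamily ℂ (fun μ => V μ) fun μ => (V μ).subtypeₗᵢ :=
    LinearMap.IsSymmetric.orthogonalFamily_eigenspaces hs
  have ho := hfam.orthonormal_sigma_orthonormal (fun μ => (basis (V μ)).orthonormal)
  have hbot : (Submodule.span ℂ (Set.range fun a : Σ μ, basisSet (V μ) =>
      (V a.1).subtypeₗᵢ (basis (V a.1) a.2)))ᗮ = ⊥ := by
    rw [eq_bot_iff, ← ContinuousLinearMap.orthogonalComplement_iSup_eigenspaces_eq_bot hT hs]
    intro x hx
    rw [Submodule.mem_orthogonal] at hx ⊢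
    have hx' : (⨆ μ, V μ) ≤ (ℂ ∙ x)ᗮ := by
      refine iSup_le fun μ y hy => ?_
      rw [Submodule.mem_orthogonal_singleton_iff_inner_left]
      have hz : ∀ i, ⟪basis (V μ) i, (V μ).orthogonalProjectionOnto x⟫_ℂ = 0 := by
        intro i
        rw [Submodule.inner_orthogonalProjectionOnto_eq_of_mem_left]
        exact hx _ (Submodule.subset_span ⟨⟨μ, i⟩, rfl⟩)
      have h2 : (V μ).orthogonalProjectionOnto x = 0 := by
        have := enorm_sq_eq_tsum (basis (V μ)) ((V μ).orthogonalProjectionOnto x)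
        simp only [hz] at this
        have h0 : ‖(V μ).orthogonalProjectionOnto x‖ₑ ^ 2 = 0 := by rw [this]; simp
        exact enorm_eq_zero.1 (pow_eq_zero_iff two_ne_zero |>.1 h0)
      have h3 := Submodule.inner_orthogonalProjectionOnto_eq_of_mem_left (⟨y, hy⟩ : V μ) x
      rw [h2, inner_zero_right] at h3
      exact h3.symm
    intro y hy
    exact (Submodule.mem_orthogonal_singleton_iff_inner_left).1 (hx' hy)
  let f := HilbertBasis.mkOfOrthogonalEqBot ho hbot
  have hf : ∀ a, f a = (V a.1).subtypeₗᵢ (basis (V a.1) a.2) := fun a => by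
    simp only [f, HilbertBasis.coe_mkOfOrthogonalEqBot]
  refine ⟨_, f, fun a => a.1.re, fun a => ?_⟩
  have h1 : sqAbs A (f a) = a.1 • f a := by
    rw [hf]
    exact Module.End.mem_eigenspace_iff.1 (basis (V a.1) a.2).2
  have h2 : (starRingEnd ℂ) a.1 = a.1 := by
    have hne : f a ≠ 0 := f.orthonormal.ne_zero a
    refine LinearMap.IsSymmetric.conj_eigenvalue_eq_self hs (μ := a.1) ?_
    exact Module.End.hasEigenvalue_of_hasEigenvector
      ⟨Module.End.mem_eigenspace_iff.2 h1, hne⟩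
  rw [h1]
  exact congrArg (· • f a) (Complex.conj_eq_iff_re.1 h2).symm

/-- The Schatten trace of a compact operator as a sum along an orthonormal basis. -/
theorem exists_trace_eq (A : E →L[ℂ] F) (hA : IsCompactOperator A) {p : ℝ} (hp : 0 < p) :
    ∃ (ι : Type u) (f : HilbertBasis ι ℂ E) (Y : E →L[ℂ] F), ‖Y‖ ≤ 1 ∧
      schattenTrace p A = ∑' i, ‖⟪Y (f i), A (f i)⟫_ℂ‖ₑ ^ p := by
  obtain ⟨ι, f, s, hs⟩ := exists_eigenbasis A hA
  obtain ⟨U, hU, hUA⟩ := exists_contraction (fc A Real.sqrt) A (fun x => (norm_fc_sqrt A x).le)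
  refine ⟨ι, f, adjoint U, norm_adj_le_one hU, ?_⟩
  have hc : Continuous fun x : ℝ => x ^ (p / 4) := Real.continuous_rpow_const (by positivity)
  have h1 : schattenTrace p A = ∑' i, ‖fc A (fun x => x ^ (p / 4)) (f i)‖ₑ ^ 2 := by
    rw [schattenTrace_eq hp]
    have hS := fc_adj A (fun x => x ^ (p / 4))
    refine le_antisymm ?_ ?_
    · simpa using hs_contraction f (basis E) _ hS (ContinuousLinearMap.id ℂ E)
        ContinuousLinearMap.norm_id_le
    · simpa using hs_contraction (basis E) f _ hS (ContinuousLinearMap.id ℂ E)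
        ContinuousLinearMap.norm_id_le
  rw [h1]
  refine tsum_congr fun i => ?_
  have hs0 : 0 ≤ s i := by
    have h2 : ⟪f i, sqAbs A (f i)⟫_ℂ = (s i : ℂ) := by
      rw [hs, inner_smul_right, inner_self_eq_norm_sq_to_K, f.orthonormal.1 i]
      simp
    have h3 := (ContinuousLinearMap.nonneg_iff_isPositive _).1 (sqAbs_nonneg A)
    have h4 := h3.re_inner_nonneg_right (f i)
    rw [h2] at h4
    simpa using h4
  rw [ContinuousLinearMap.adjoint_inner_left, hUA, fc_eigen A Real.continuous_sqrt (hs i),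
    fc_eigen A hc (hs i), inner_smul_right, inner_self_eq_norm_sq_to_K, f.orthonormal.1 i,
    enorm_smul, ← ofReal_norm (f i), f.orthonormal.1 i, ← ofReal_norm, ← ofReal_norm]
  simp only [Complex.norm_real, one_pow, mul_one, ENNReal.ofReal_one,
    Real.norm_eq_abs, RCLike.ofReal_one]
  rw [abs_of_nonneg (by positivity), abs_of_nonneg (by positivity),
    ENNReal.ofReal_rpow_of_nonneg (by positivity) hp.le, ← ENNReal.ofReal_pow (by positivity),
    Real.sqrt_eq_rpow, ← Real.rpow_mul hs0, ← Real.rpow_natCast, ← Real.rpow_mul hs0]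
  congr 2
  push_cast
  ring

theorem compact_of_approx (X : E →L[ℂ] F)
    (h : ∀ ε > 0, ∃ Z : E →L[ℂ] F, IsCompactOperator Z ∧ dist X Z < ε) : IsCompactOperator X := by
  have hcl := isClosed_setOfPred_isCompactOperator (σ₁₂ := RingHom.id ℂ) (M₁ := E) (M₂ := F)
  refine hcl.closure_subset (Metric.mem_closure_iff.2 fun ε hε => ?_)
  obtain ⟨Z, hZ, hd⟩ := h ε hε
  exact ⟨Z, hZ, hd⟩

theorem compact_of_hs {ι : Type*} (b : HilbertBasis ι ℂ E) (X : E →L[ℂ] F)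
    (h : ∑' i, ‖X (b i)‖ₑ ^ 2 ≠ ∞) : IsCompactOperator X := by
  classical
  have hop : ∀ Y : E →L[ℂ] F, ‖Y‖ₑ ^ 2 ≤ ∑' i, ‖Y (b i)‖ₑ ^ 2 := by
    intro Y
    by_cases htop : ∑' i, ‖Y (b i)‖ₑ ^ 2 = ∞
    · rw [htop]; exact le_top
    have hx : ∀ x, ‖Y x‖ₑ ^ 2 ≤ (∑' i, ‖Y (b i)‖ₑ ^ 2) * ‖x‖ₑ ^ 2 := by
      intro x
      rw [enorm_sq_eq_tsum (basis F) (Y x), hs_adjoint b (basis F), ← ENNReal.tsum_mul_right]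
      refine ENNReal.tsum_le_tsum fun j => ?_
      rw [← ContinuousLinearMap.adjoint_inner_left, ← mul_pow]
      gcongr
      rw [← ofReal_norm, ← ofReal_norm, ← ofReal_norm, ← ENNReal.ofReal_mul (norm_nonneg _)]
      exact ENNReal.ofReal_le_ofReal (norm_inner_le_norm _ _)
    set K := ∑' i, ‖Y (b i)‖ₑ ^ 2 with hK
    have hle : ‖Y‖ ≤ Real.sqrt K.toReal := by
      refine Y.opNorm_le_bound (Real.sqrt_nonneg _) fun x => ?_
      have h1 := ENNReal.toReal_mono (ENNReal.mul_ne_top htop (by finiteness)) (hx x)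
      simp only [ENNReal.toReal_mul, ENNReal.toReal_pow, toReal_enorm] at h1
      refine (pow_le_pow_iff_left₀ (norm_nonneg _) (by positivity) two_ne_zero).1 ?_
      rw [mul_pow, Real.sq_sqrt ENNReal.toReal_nonneg]
      exact h1
    have h2 : ‖Y‖ ^ 2 ≤ K.toReal := by
      rw [← Real.sq_sqrt (ENNReal.toReal_nonneg (a := K))]
      gcongr
    rw [← ofReal_norm, ← ENNReal.ofReal_pow (norm_nonneg _)]
    exact ENNReal.ofReal_le_of_le_toReal h2
  have hrank : ∀ s : Finset ι, IsCompactOperator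
      (∑ i ∈ s, (innerSL ℂ (b i)).smulRight (X (b i)) : E →L[ℂ] F) := by
    intro s
    have : (∑ i ∈ s, (innerSL ℂ (b i)).smulRight (X (b i)) : E →L[ℂ] F) ∈
        compactOperator (RingHom.id ℂ) E F := by
      refine Submodule.sum_mem _ fun i _ => ?_
      have h1 : IsCompactOperator (innerSL ℂ (b i)) :=
        isCompactOperator_of_locallyCompactSpace_dom _
      exact h1.clm_comp (ContinuousLinearMap.toSpanSingleton ℂ (X (b i)))
    exact this
  refine compact_of_approx X fun ε hε => ?_
  have htend := ENNReal.tendsto_tsum_compl_atTop_zero h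
  have hε2 : (0 : ℝ≥0∞) < ENNReal.ofReal (ε ^ 2) := ENNReal.ofReal_pos.2 (by positivity)
  obtain ⟨s, hs⟩ := (htend.eventually_lt_const hε2).exists
  refine ⟨_, hrank s, ?_⟩
  set Z : E →L[ℂ] F := ∑ i ∈ s, (innerSL ℂ (b i)).smulRight (X (b i)) with hZ
  have hZb : ∀ i, Z (b i) = if i ∈ s then X (b i) else 0 := by
    intro i
    simp only [hZ, sum_apply, ContinuousLinearMap.smulRight_apply,
      innerSL_apply_apply, orthonormal_iff_ite.1 b.orthonormal, ite_smul, one_smul, zero_smul]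
    simp
  have h3 : ‖X - Z‖ₑ ^ 2 < ENNReal.ofReal (ε ^ 2) := by
    refine (hop (X - Z)).trans_lt (lt_of_le_of_lt (le_of_eq ?_) hs)
    refine Eq.trans ?_ (tsum_subtype {i | i ∉ s} (fun i => ‖X (b i)‖ₑ ^ 2)).symm
    refine tsum_congr fun i => ?_
    by_cases hi : i ∈ s <;> simp [hZb, hi, Set.indicator]
  rw [dist_eq_norm]
  rw [← ofReal_norm, ← ENNReal.ofReal_pow (norm_nonneg _),
    ENNReal.ofReal_lt_ofReal_iff (by positivity)] at h3
  exact lt_of_pow_lt_pow_left₀ 2 hε.le h3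

theorem compact_of_trace (A : E →L[ℂ] F) {p : ℝ} (hp : 0 < p) (h : schattenTrace p A ≠ ∞) :
    IsCompactOperator A := by
  have hc : Continuous fun x : ℝ => x ^ (p / 4) := Real.continuous_rpow_const (by positivity)
  have hS : IsCompactOperator (fc A fun x => x ^ (p / 4)) :=
    compact_of_hs (basis E) _ (by rwa [schattenTrace_eq hp] at h)
  have habs : IsCompactOperator (fc A Real.sqrt) := by
    refine compact_of_approx _ fun ε hε => ?_
    set δ : ℝ := (ε / 2) ^ 2 with hδ
    have hδ0 : 0 < δ := by positivity
    have hm : Continuous fun x : ℝ => (max x δ) ^ (1 / 2 - p / 4) := by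
      refine Continuous.rpow_const (by fun_prop) fun x => Or.inl ?_
      exact (lt_max_of_lt_right hδ0).ne'
    refine ⟨(fc A fun x => x ^ (p / 4)) ∘L (fc A fun x => (max x δ) ^ (1 / 2 - p / 4)),
      hS.comp_clm (fc A fun x => (max x δ) ^ (1 / 2 - p / 4)), ?_⟩
    have hcomp : (fc A fun x => x ^ (p / 4)) ∘L (fc A fun x => (max x δ) ^ (1 / 2 - p / 4)) =
        fc A (fun x => x ^ (p / 4) * (max x δ) ^ (1 / 2 - p / 4)) := fc_mul A hc hm
    change dist (fc A Real.sqrt)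
      ((fc A fun x => x ^ (p / 4)) ∘L (fc A fun x => (max x δ) ^ (1 / 2 - p / 4))) < ε
    rw [hcomp, dist_eq_norm, fc, fc,
      ← cfc_sub (a := sqAbs A) Real.sqrt (fun x => x ^ (p / 4) * (max x δ) ^ (1 / 2 - p / 4))
        Real.continuous_sqrt.continuousOn (hc.mul hm).continuousOn]
    refine lt_of_le_of_lt (norm_cfc_le (c := ε / 2) (by positivity) fun x hx => ?_) (by linarith)
    have hx0 := spec_nonneg A hx
    rw [Real.norm_eq_abs]
    have hsq : Real.sqrt δ = ε / 2 := Real.sqrt_sq (by positivity)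
    by_cases hxδ : δ ≤ x
    · rw [max_eq_left hxδ, ← Real.rpow_add (hδ0.trans_le hxδ), Real.sqrt_eq_rpow]
      ring_nf
      simp [hε.le]
    · push Not at hxδ
      rw [max_eq_right hxδ.le]
      have h1 : x ^ (p / 4) * δ ^ (1 / 2 - p / 4) ≤ ε / 2 := by
        calc _ ≤ δ ^ (p / 4) * δ ^ (1 / 2 - p / 4) := by gcongr
          _ = ε / 2 := by
            rw [← Real.rpow_add hδ0, ← hsq, Real.sqrt_eq_rpow]; ring_nf
      have h2 : Real.sqrt x ≤ ε / 2 := by rw [← hsq]; exact Real.sqrt_le_sqrt hxδ.le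
      have h3 : 0 ≤ x ^ (p / 4) * δ ^ (1 / 2 - p / 4) := by positivity
      have h4 := Real.sqrt_nonneg x
      rw [abs_le]
      constructor <;> linarith
  obtain ⟨U, -, hUA⟩ := exists_contraction A (fc A Real.sqrt) (fun x => (norm_fc_sqrt A x).ge)
  have hfin := habs.clm_comp U
  have : (⇑U ∘ ⇑(fc A Real.sqrt)) = A := funext hUA
  rwa [this] at hfin

theorem sum_inner_le' (A : E →L[ℂ] F) {p : ℝ} (hp : 1 ≤ p) {ι : Type*}
    (e : HilbertBasis ι ℂ G) (X : G →L[ℂ] E) (Y : G →L[ℂ] F) :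
    ∑' i, ‖⟪Y (e i), A (X (e i))⟫_ℂ‖ₑ ^ p ≤ (‖X‖ₑ * ‖Y‖ₑ) ^ p * schattenTrace p A := by
  have hp0 : 0 < p := by linarith
  by_cases hX : X = 0
  · simp [hX, hp0]
  by_cases hY : Y = 0
  · simp [hY, hp0]
  have hX0 : ‖X‖ ≠ 0 := norm_ne_zero_iff.2 hX
  have hY0 : ‖Y‖ ≠ 0 := norm_ne_zero_iff.2 hY
  have h := sum_inner_le A hp e (((‖X‖⁻¹ : ℝ) : ℂ) • X) (((‖Y‖⁻¹ : ℝ) : ℂ) • Y)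
    (by rw [norm_smul, Complex.norm_real, norm_inv, norm_norm, inv_mul_cancel₀ hX0])
    (by rw [norm_smul, Complex.norm_real, norm_inv, norm_norm, inv_mul_cancel₀ hY0])
  refine le_trans (le_of_eq ?_) (mul_le_mul_right h ((‖X‖ₑ * ‖Y‖ₑ) ^ p))
  rw [← ENNReal.tsum_mul_left]
  refine tsum_congr fun i => ?_
  rw [← ENNReal.mul_rpow_of_nonneg _ _ hp0.le]
  congr 1
  simp only [smul_apply, map_smul, inner_smul_left, inner_smul_right, Complex.conj_ofReal]
  rw [← ofReal_norm, ← ofReal_norm, ← ofReal_norm, ← ofReal_norm,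
    ← ENNReal.ofReal_mul (norm_nonneg _), ← ENNReal.ofReal_mul (by positivity)]
  congr 1
  simp only [norm_mul, Complex.norm_real, norm_inv, norm_norm]
  field_simp

theorem schattenTrace_comp_le (A : E →L[ℂ] F) {p : ℝ} (hp : 1 ≤ p)
    {E' : Type*} [NormedAddCommGroup E'] [InnerProductSpace ℂ E'] [CompleteSpace E']
    (B : F →L[ℂ] G) (C : E' →L[ℂ] E) (h : schattenTrace p A ≠ ∞) :
    schattenTrace p (B ∘L A ∘L C) ≤ (‖B‖ₑ * ‖C‖ₑ) ^ p * schattenTrace p A := by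
  have hp0 : 0 < p := by linarith
  have hcp : IsCompactOperator (B ∘L A ∘L C) :=
    ((compact_of_trace A hp0 h).comp_clm C).clm_comp B
  obtain ⟨ι, f, Y, hY, he⟩ := exists_trace_eq _ hcp hp0
  rw [he]
  refine le_trans (le_of_eq (tsum_congr fun i => ?_))
    ((sum_inner_le' A hp f C (adjoint B ∘L Y)).trans ?_)
  · simp only [ContinuousLinearMap.comp_apply, ContinuousLinearMap.adjoint_inner_left]
  · have h1 : ‖adjoint B ∘L Y‖ₑ ≤ ‖B‖ₑ := by
      rw [← ofReal_norm, ← ofReal_norm]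
      refine ENNReal.ofReal_le_ofReal ((ContinuousLinearMap.opNorm_comp_le _ _).trans ?_)
      rw [LinearIsometryEquiv.norm_map]
      exact mul_le_of_le_one_right (norm_nonneg _) hY
    rw [mul_comm ‖C‖ₑ]
    gcongr

theorem compact_adjoint (A : E →L[ℂ] F) (h : IsCompactOperator A) :
    IsCompactOperator (adjoint A) := by
  obtain ⟨U, -, hU⟩ := exists_contraction A (fc A Real.sqrt) (fun x => (norm_fc_sqrt A x).ge)
  obtain ⟨V, -, hV⟩ := exists_contraction (fc A Real.sqrt) A (fun x => (norm_fc_sqrt A x).le)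
  have h1 : adjoint A = fc A Real.sqrt ∘L adjoint U := by
    have : A = U ∘L fc A Real.sqrt := by ext x; exact (hU x).symm
    conv_lhs => rw [this]
    rw [ContinuousLinearMap.adjoint_comp, fc_adj]
  have h2 : IsCompactOperator (fc A Real.sqrt) := by
    have : (⇑V ∘ ⇑A) = fc A Real.sqrt := funext hV
    rw [← this]
    exact h.clm_comp V
  rw [h1]
  exact h2.comp_clm (adjoint U)

theorem schattenTrace_adjoint_le (A : E →L[ℂ] F) {p : ℝ} (hp : 1 ≤ p)
    (h : schattenTrace p A ≠ ∞) : schattenTrace p (adjoint A) ≤ schattenTrace p A := by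
  have hp0 : 0 < p := by linarith
  obtain ⟨ι, f, Y, hY, he⟩ := exists_trace_eq _
    (compact_adjoint A (compact_of_trace A hp0 h)) hp0
  rw [he]
  refine le_trans (le_of_eq (tsum_congr fun i => ?_))
    (sum_inner_le A hp f Y (ContinuousLinearMap.id ℂ F) hY ContinuousLinearMap.norm_id_le)
  rw [ContinuousLinearMap.adjoint_inner_right, ← inner_conj_symm, ← ofReal_norm,
    RCLike.norm_conj, ofReal_norm]
  rfl

theorem schattenTrace_add_le (A B : E →L[ℂ] F) {p : ℝ} (hp : 1 ≤ p)
    (hA : schattenTrace p A ≠ ∞) (hB : schattenTrace p B ≠ ∞) :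
    schattenTrace p (A + B) ^ (1 / p) ≤
      schattenTrace p A ^ (1 / p) + schattenTrace p B ^ (1 / p) := by
  have hp0 : 0 < p := by linarith
  obtain ⟨ι, f, Y, hY, he⟩ := exists_trace_eq (A + B)
    ((compact_of_trace A hp0 hA).add (compact_of_trace B hp0 hB)) hp0
  have hid : ‖ContinuousLinearMap.id ℂ E‖ ≤ 1 := ContinuousLinearMap.norm_id_le
  have h1 := sum_inner_le A hp f (ContinuousLinearMap.id ℂ E) Y hid hY
  have h2 := sum_inner_le B hp f (ContinuousLinearMap.id ℂ E) Y hid hY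
  rw [he, one_div, ENNReal.rpow_inv_le_iff hp0, ENNReal.tsum_eq_iSup_sum]
  refine iSup_le fun s => ?_
  rw [← ENNReal.rpow_inv_le_iff hp0, ← one_div]
  calc (∑ i ∈ s, ‖⟪Y (f i), (A + B) (f i)⟫_ℂ‖ₑ ^ p) ^ (1 / p)
      ≤ (∑ i ∈ s, (‖⟪Y (f i), A (f i)⟫_ℂ‖ₑ + ‖⟪Y (f i), B (f i)⟫_ℂ‖ₑ) ^ p) ^ (1 / p) := by
        gcongr with i _
        rw [add_apply, inner_add_right]
        exact enorm_add_le _ _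
    _ ≤ _ := ENNReal.Lp_add_le s _ _ hp
    _ ≤ _ := by
        gcongr
        · exact (ENNReal.sum_le_tsum s).trans h1
        · exact (ENNReal.sum_le_tsum s).trans h2

/-! ### The Schatten classes are operator ideals with a norm -/

theorem MemSchatten.compact {p : ℝ≥0∞} {A : E →L[ℂ] F} (hp : 1 ≤ p) (h : MemSchatten p A) :
    IsCompactOperator A := by
  unfold MemSchatten at h
  split_ifs at h with ht
  · exact h
  · exact compact_of_trace A (ENNReal.toReal_pos (zero_lt_one.trans_le hp).ne' ht) h.ne

theorem one_le_toReal {p : ℝ≥0∞} (hp : 1 ≤ p) (ht : p ≠ ∞) : 1 ≤ p.toReal := by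
  simpa using ENNReal.toReal_mono ht hp

theorem MemSchatten.comp {p : ℝ≥0∞} (hp : 1 ≤ p) {E' : Type*} [NormedAddCommGroup E']
    [InnerProductSpace ℂ E'] [CompleteSpace E'] {A : E →L[ℂ] F} (h : MemSchatten p A)
    (B : F →L[ℂ] G) (C : E' →L[ℂ] E) : MemSchatten p (B ∘L A ∘L C) := by
  unfold MemSchatten at h ⊢
  split_ifs at h ⊢ with ht
  · exact (h.comp_clm C).clm_comp B
  · refine (schattenTrace_comp_le A (one_le_toReal hp ht) B C h.ne).trans_lt ?_
    exact ENNReal.mul_lt_top (ENNReal.rpow_lt_top_of_nonneg (by positivity) (by finiteness)) h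

theorem schattenNorm_comp_le {p : ℝ≥0∞} (hp : 1 ≤ p) {E' : Type*} [NormedAddCommGroup E']
    [InnerProductSpace ℂ E'] [CompleteSpace E'] {A : E →L[ℂ] F} (h : MemSchatten p A)
    (B : F →L[ℂ] G) (C : E' →L[ℂ] E) :
    schattenNorm p (B ∘L A ∘L C) ≤ ‖B‖ * schattenNorm p A * ‖C‖ := by
  unfold MemSchatten at h
  unfold schattenNorm
  split_ifs at h ⊢ with ht
  · refine (ContinuousLinearMap.opNorm_comp_le _ _).trans ?_
    rw [mul_assoc]
    gcongr
    exact ContinuousLinearMap.opNorm_comp_le _ _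
  · have h1 := one_le_toReal hp ht
    set r := p.toReal
    have hr : 0 < r := by linarith
    have h2 := ENNReal.toReal_mono
      (ENNReal.mul_lt_top (ENNReal.rpow_lt_top_of_nonneg (by positivity) (by finiteness)) h).ne
      (schattenTrace_comp_le A h1 B C h.ne)
    rw [ENNReal.toReal_mul, ← ENNReal.toReal_rpow, ENNReal.toReal_mul, toReal_enorm,
      toReal_enorm] at h2
    calc _ ≤ ((‖B‖ * ‖C‖) ^ r * (schattenTrace r A).toReal) ^ (1 / r) := by gcongr
      _ = ‖B‖ * ‖C‖ * (schattenTrace r A).toReal ^ (1 / r) := by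
        rw [Real.mul_rpow (by positivity) ENNReal.toReal_nonneg, ← Real.rpow_mul (by positivity)]
        rw [mul_one_div_cancel hr.ne', Real.rpow_one]
      _ = _ := by ring

theorem MemSchatten.memAdjoint {p : ℝ≥0∞} (hp : 1 ≤ p) {A : E →L[ℂ] F} (h : MemSchatten p A) :
    MemSchatten p (adjoint A) := by
  unfold MemSchatten at h ⊢
  split_ifs at h ⊢ with ht
  · exact compact_adjoint A h
  · exact (schattenTrace_adjoint_le A (one_le_toReal hp ht) h.ne).trans_lt h

theorem schattenNorm_adjoint_le {p : ℝ≥0∞} (hp : 1 ≤ p) {A : E →L[ℂ] F} (h : MemSchatten p A) :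
    schattenNorm p (adjoint A) ≤ schattenNorm p A := by
  unfold MemSchatten at h
  unfold schattenNorm
  split_ifs at h ⊢ with ht
  · rw [LinearIsometryEquiv.norm_map]
  · have h2 := ENNReal.toReal_mono h.ne (schattenTrace_adjoint_le A (one_le_toReal hp ht) h.ne)
    gcongr

theorem MemSchatten.add {p : ℝ≥0∞} (hp : 1 ≤ p) {A B : E →L[ℂ] F} (hA : MemSchatten p A)
    (hB : MemSchatten p B) : MemSchatten p (A + B) := by
  unfold MemSchatten at hA hB ⊢
  split_ifs at hA hB ⊢ with ht
  · exact hA.add hB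
  · have h1 := one_le_toReal hp ht
    have hr : 0 < p.toReal := by linarith
    have h := schattenTrace_add_le A B h1 hA.ne hB.ne
    by_contra hcon
    rw [not_lt, top_le_iff] at hcon
    rw [hcon, ENNReal.top_rpow_of_pos (by positivity), top_le_iff] at h
    refine (ENNReal.add_lt_top.2 ⟨?_, ?_⟩).ne h
    · exact ENNReal.rpow_lt_top_of_nonneg (by positivity) hA.ne
    · exact ENNReal.rpow_lt_top_of_nonneg (by positivity) hB.ne

theorem schattenNorm_add_le {p : ℝ≥0∞} (hp : 1 ≤ p) {A B : E →L[ℂ] F} (hA : MemSchatten p A)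
    (hB : MemSchatten p B) : schattenNorm p (A + B) ≤ schattenNorm p A + schattenNorm p B := by
  unfold MemSchatten at hA hB
  unfold schattenNorm
  split_ifs at hA hB ⊢ with ht
  · exact norm_add_le _ _
  · have h1 := one_le_toReal hp ht
    have fA : schattenTrace p.toReal A ^ (1 / p.toReal) ≠ ∞ :=
      (ENNReal.rpow_lt_top_of_nonneg (by positivity) hA.ne).ne
    have fB : schattenTrace p.toReal B ^ (1 / p.toReal) ≠ ∞ :=
      (ENNReal.rpow_lt_top_of_nonneg (by positivity) hB.ne).ne
    have h := ENNReal.toReal_mono (ENNReal.add_ne_top.2 ⟨fA, fB⟩)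
      (schattenTrace_add_le A B h1 hA.ne hB.ne)
    rw [ENNReal.toReal_add fA fB] at h
    simpa only [ENNReal.toReal_rpow] using h

theorem MemSchatten.zero {p : ℝ≥0∞} (hp : 1 ≤ p) : MemSchatten p (0 : E →L[ℂ] F) := by
  unfold MemSchatten
  split_ifs with ht
  · exact isCompactOperator_zero
  · have hr : 0 < p.toReal := by linarith [one_le_toReal hp ht]
    have h := sum_inner_le' (0 : E →L[ℂ] F) (one_le_toReal hp ht) (basis E)
      (0 : E →L[ℂ] E) (0 : E →L[ℂ] F)
    obtain ⟨ι, f, Y, -, he⟩ := exists_trace_eq (0 : E →L[ℂ] F) isCompactOperator_zero hr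
    rw [he]
    simp [hr]

theorem MemSchatten.smul {p : ℝ≥0∞} (hp : 1 ≤ p) {A : E →L[ℂ] F} (h : MemSchatten p A) (c : ℂ) :
    MemSchatten p (c • A) := by
  have := h.comp hp (c • ContinuousLinearMap.id ℂ F) (ContinuousLinearMap.id ℂ E)
  simpa using this

theorem schattenNorm_nonneg (p : ℝ≥0∞) (A : E →L[ℂ] F) : 0 ≤ schattenNorm p A := by
  unfold schattenNorm
  split_ifs <;> positivity

theorem schattenNorm_smul_le {p : ℝ≥0∞} (hp : 1 ≤ p) {A : E →L[ℂ] F} (h : MemSchatten p A)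
    (c : ℂ) : schattenNorm p (c • A) ≤ ‖c‖ * schattenNorm p A := by
  have h1 := schattenNorm_comp_le hp h (c • ContinuousLinearMap.id ℂ F)
    (ContinuousLinearMap.id ℂ E)
  have h2 : (c • ContinuousLinearMap.id ℂ F) ∘L A ∘L (ContinuousLinearMap.id ℂ E) = c • A := by
    ext x; simp
  rw [h2] at h1
  refine h1.trans ?_
  have h3 : ‖c • ContinuousLinearMap.id ℂ F‖ ≤ ‖c‖ := by
    rw [norm_smul]
    exact mul_le_of_le_one_right (norm_nonneg _) ContinuousLinearMap.norm_id_le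
  have h4 := schattenNorm_nonneg p A
  calc _ ≤ ‖c‖ * schattenNorm p A * 1 := by
        gcongr
        exact ContinuousLinearMap.norm_id_le
    _ = _ := mul_one _

theorem schattenNorm_zero {p : ℝ≥0∞} (hp : 1 ≤ p) : schattenNorm p (0 : E →L[ℂ] F) = 0 := by
  have h := schattenNorm_smul_le hp (MemSchatten.zero (E := E) (F := F) hp) 0
  rw [zero_smul, norm_zero, zero_mul] at h
  exact le_antisymm h (schattenNorm_nonneg _ _)

theorem schattenNorm_eq_zero {p : ℝ≥0∞} (hp : 1 ≤ p) {A : E →L[ℂ] F} (h : MemSchatten p A)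
    (h0 : schattenNorm p A = 0) : A = 0 := by
  unfold MemSchatten at h
  unfold schattenNorm at h0
  split_ifs at h h0 with ht
  · exact norm_eq_zero.1 h0
  · have h1 := one_le_toReal hp ht
    have hr : 0 < p.toReal := by linarith
    rw [Real.rpow_eq_zero ENNReal.toReal_nonneg (by positivity), ENNReal.toReal_eq_zero_iff] at h0
    have h2 := h0.resolve_right h.ne
    have h3 := sum_inner_le' A h1 (basis E) (ContinuousLinearMap.id ℂ E) A
    rw [h2, mul_zero, nonpos_iff_eq_zero, ENNReal.tsum_eq_zero] at h3
    have h4 : ∀ i, A (basis E i) = 0 := by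
      intro i
      have h5 := h3 i
      rw [ENNReal.rpow_eq_zero_iff_of_pos hr] at h5
      exact inner_self_eq_zero.1 (enorm_eq_zero.1 h5)
    have h6 := hs_adjoint (basis E) (basis F) A
    have h7 : ∀ x, A x = 0 := by
      intro x
      have h8 := ((basis E).hasSum_repr x).mapL A
      simp only [map_smul, h4, smul_zero] at h8
      exact h8.unique hasSum_zero
    ext x
    exact h7 x

end Schatten

section Restricted

variable {H : Type u} [NormedAddCommGroup H] [InnerProductSpace ℂ H] [CompleteSpace H]

/-- The skew-Hermitian operator `d = i (pr₊ - pr₋)` of the polarization `H = K ⊕ Kᗮ`. -/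
noncomputable def polarization (K : Submodule ℂ H) [CompleteSpace K] : H →L[ℂ] H :=
  Complex.I • (K.starProjection - Kᗮ.starProjection)

/-- The commutator `[d, A]`. -/
noncomputable def dComm (K : Submodule ℂ H) [CompleteSpace K] (A : H →L[ℂ] H) : H →L[ℂ] H :=
  polarization K * A - A * polarization K

/-- The block `pr_M ∘ A|_L : L → M` of an operator `A` on `H`. -/
noncomputable def block (L M : Submodule ℂ H) [CompleteSpace M] (A : H →L[ℂ] H) : L →L[ℂ] M :=
  M.orthogonalProjectionOnto ∘L A ∘L L.subtypeL

variable (K : Submodule ℂ H) [CompleteSpace K]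

theorem polarization_star : star (polarization K) = -polarization K := by
  have h1 : star K.starProjection = K.starProjection :=
    isSelfAdjoint_starProjection K
  have h2 : star Kᗮ.starProjection = Kᗮ.starProjection :=
    isSelfAdjoint_starProjection Kᗮ
  rw [polarization, star_smul, star_sub, h1, h2, Complex.star_def, Complex.conj_I, neg_smul]

theorem dComm_add (A B : H →L[ℂ] H) : dComm K (A + B) = dComm K A + dComm K B := by
  simp only [dComm]; noncomm_ring

theorem dComm_mul (A B : H →L[ℂ] H) : dComm K (A * B) = dComm K A * B + A * dComm K B := by
  simp only [dComm]; noncomm_ring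

theorem dComm_smul (c : ℂ) (A : H →L[ℂ] H) : dComm K (c • A) = c • dComm K A := by
  simp only [dComm, mul_smul_comm, smul_mul_assoc, smul_sub]

theorem dComm_star (A : H →L[ℂ] H) : dComm K (star A) = star (dComm K A) := by
  simp only [dComm, star_sub, star_mul, polarization_star]
  noncomm_ring

theorem dComm_algebraMap (c : ℂ) : dComm K (algebraMap ℂ (H →L[ℂ] H) c) = 0 := by
  rw [dComm, Algebra.commutes, sub_self]

theorem MemSchatten.mul_right {p : ℝ≥0∞} (hp : 1 ≤ p) {A : H →L[ℂ] H} (h : MemSchatten p A)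
    (B : H →L[ℂ] H) : MemSchatten p (A * B) :=
  h.comp hp (ContinuousLinearMap.id ℂ H) B

theorem MemSchatten.mul_left {p : ℝ≥0∞} (hp : 1 ≤ p) {A : H →L[ℂ] H} (h : MemSchatten p A)
    (B : H →L[ℂ] H) : MemSchatten p (B * A) :=
  h.comp hp B (ContinuousLinearMap.id ℂ H)

theorem schattenNorm_mul_right {p : ℝ≥0∞} (hp : 1 ≤ p) {A : H →L[ℂ] H} (h : MemSchatten p A)
    (B : H →L[ℂ] H) : schattenNorm p (A * B) ≤ schattenNorm p A * ‖B‖ := by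
  have h1 := schattenNorm_comp_le hp h (ContinuousLinearMap.id ℂ H) B
  have h2 := schattenNorm_nonneg p A
  calc _ ≤ ‖ContinuousLinearMap.id ℂ H‖ * schattenNorm p A * ‖B‖ := h1
    _ ≤ 1 * schattenNorm p A * ‖B‖ := by
      gcongr
      exact ContinuousLinearMap.norm_id_le
    _ = _ := by rw [one_mul]

theorem schattenNorm_mul_left {p : ℝ≥0∞} (hp : 1 ≤ p) {A : H →L[ℂ] H} (h : MemSchatten p A)
    (B : H →L[ℂ] H) : schattenNorm p (B * A) ≤ ‖B‖ * schattenNorm p A := by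
  have h1 := schattenNorm_comp_le hp h B (ContinuousLinearMap.id ℂ H)
  have h2 := schattenNorm_nonneg p A
  calc _ ≤ ‖B‖ * schattenNorm p A * ‖ContinuousLinearMap.id ℂ H‖ := h1
    _ ≤ ‖B‖ * schattenNorm p A * 1 := by
      gcongr
      exact ContinuousLinearMap.norm_id_le
    _ = _ := by rw [mul_one]

variable (p : ℝ≥0∞) [hp : Fact (1 ≤ p)]

/-- The set `{A ∈ B(H) | [d, A] ∈ L_p(H)}`, a `*`-subalgebra of `B(H)`. -/
def restrictedSubalgebra : StarSubalgebra ℂ (H →L[ℂ] H) where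
  carrier := {A | MemSchatten p (dComm K A)}
  mul_mem' {A B} hA hB := by
    change MemSchatten p _
    rw [dComm_mul]
    exact (hA.mul_right hp.out B).add hp.out (hB.mul_left hp.out A)
  add_mem' {A B} hA hB := by
    change MemSchatten p _
    rw [dComm_add]
    exact hA.add hp.out hB
  algebraMap_mem' c := by
    change MemSchatten p _
    rw [dComm_algebraMap]
    exact MemSchatten.zero hp.out
  star_mem' {A} hA := by
    change MemSchatten p _
    rw [dComm_star]
    exact hA.memAdjoint hp.out

/-- The restricted Banach algebra `L_{res,p}(H) = {A ∈ B(H) | [d, A] ∈ L_p(H)}`. It carries the norm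
`‖A‖ + ‖[d, A]‖_p` given below, not the operator norm. -/
def RestrictedAlgebra : Type u := restrictedSubalgebra K p

namespace RestrictedAlgebra

noncomputable instance : Ring (RestrictedAlgebra K p) :=
  inferInstanceAs (Ring (restrictedSubalgebra K p))

noncomputable instance : StarRing (RestrictedAlgebra K p) :=
  inferInstanceAs (StarRing (restrictedSubalgebra K p))

noncomputable instance : Algebra ℂ (RestrictedAlgebra K p) :=
  inferInstanceAs (Algebra ℂ (restrictedSubalgebra K p))

instance : StarModule ℂ (RestrictedAlgebra K p) :=
  inferInstanceAs (StarModule ℂ (restrictedSubalgebra K p))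

variable {K p}

/-- The operator on `H` underlying an element of `L_{res,p}(H)`. -/
def toOp (A : RestrictedAlgebra K p) : H →L[ℂ] H := A.1

theorem mem (A : RestrictedAlgebra K p) : MemSchatten p (dComm K A.toOp) := A.2

theorem toOp_injective : Function.Injective (toOp : RestrictedAlgebra K p → _) :=
  Subtype.val_injective

variable (K p)

/-- The norm `‖A‖_{res,p} = ‖A‖ + ‖[d, A]‖_p`. -/
noncomputable def addGroupNorm : AddGroupNorm (RestrictedAlgebra K p) where
  toFun A := ‖A.toOp‖ + schattenNorm p (dComm K A.toOp)
  map_zero' := by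
    change ‖(0 : H →L[ℂ] H)‖ + schattenNorm p (dComm K 0) = 0
    simp [dComm, schattenNorm_zero hp.out]
  add_le' A B := by
    change ‖A.toOp + B.toOp‖ + schattenNorm p (dComm K (A.toOp + B.toOp)) ≤ _
    rw [dComm_add]
    linarith [norm_add_le A.toOp B.toOp, schattenNorm_add_le hp.out A.mem B.mem]
  neg' A := by
    have h : ∀ B : RestrictedAlgebra K p, schattenNorm p (dComm K (-B).toOp) ≤
        schattenNorm p (dComm K B.toOp) := by
      intro B
      have h1 : dComm K (-B).toOp = (-1 : ℂ) • dComm K B.toOp := by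
        rw [← dComm_smul, neg_one_smul]; rfl
      rw [h1]
      simpa using schattenNorm_smul_le hp.out B.mem (-1)
    have h2 := h (-A)
    rw [neg_neg] at h2
    rw [le_antisymm (h A) h2]
    change ‖-A.toOp‖ + _ = _
    rw [norm_neg]
  eq_zero_of_map_eq_zero' A h := by
    have h1 := schattenNorm_nonneg p (dComm K A.toOp)
    have h2 := norm_nonneg A.toOp
    have h3 : ‖A.toOp‖ = 0 := by
      change ‖A.toOp‖ + schattenNorm p (dComm K A.toOp) = 0 at h
      linarith
    exact toOp_injective (norm_eq_zero.1 h3)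

noncomputable instance : NormedRing (RestrictedAlgebra K p) :=
  { (inferInstance : Ring (RestrictedAlgebra K p)),
    (addGroupNorm K p).toNormedAddCommGroup with
    norm_mul_le := fun A B => by
      change ‖A.toOp * B.toOp‖ + schattenNorm p (dComm K (A.toOp * B.toOp)) ≤
        (‖A.toOp‖ + schattenNorm p (dComm K A.toOp)) *
          (‖B.toOp‖ + schattenNorm p (dComm K B.toOp))
      rw [dComm_mul]
      have h1 := schattenNorm_add_le hp.out (A.mem.mul_right hp.out B.toOp)
        (B.mem.mul_left hp.out A.toOp)
      have h2 := schattenNorm_mul_right hp.out A.mem B.toOp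
      have h3 := schattenNorm_mul_left hp.out B.mem A.toOp
      have h4 := norm_mul_le A.toOp B.toOp
      have h5 := mul_nonneg (schattenNorm_nonneg p (dComm K A.toOp))
        (schattenNorm_nonneg p (dComm K B.toOp))
      linarith }

theorem norm_def (A : RestrictedAlgebra K p) :
    ‖A‖ = ‖A.toOp‖ + schattenNorm p (dComm K A.toOp) := rfl

noncomputable instance : NormedAlgebra ℂ (RestrictedAlgebra K p) where
  norm_smul_le c A := by
    rw [norm_def, norm_def]
    change ‖c • A.toOp‖ + schattenNorm p (dComm K (c • A.toOp)) ≤ _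
    rw [dComm_smul, norm_smul, mul_add]
    linarith [schattenNorm_smul_le hp.out A.mem c]

instance : NormedStarGroup (RestrictedAlgebra K p) where
  norm_star_le A := by
    rw [norm_def, norm_def]
    change ‖star A.toOp‖ + schattenNorm p (dComm K (star A.toOp)) ≤ _
    rw [dComm_star, norm_star]
    have h : schattenNorm p (star (dComm K A.toOp)) ≤ _ := schattenNorm_adjoint_le hp.out A.mem
    linarith

end RestrictedAlgebra

/-- The restricted unitary group `U_{res,p}(H) = U(H) ∩ L_{res,p}(H)`, with the topology of
`L_{res,p}(H)`. -/
abbrev RestrictedUnitary : Type u := unitary (RestrictedAlgebra K p)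

/-- The real Banach space (Lie algebra) `𝔲_{res,p} = 𝔲(H) ∩ L_{res,p}(H)` of skew-Hermitian elements
of `L_{res,p}(H)`. -/
abbrev RestrictedLieAlgebra : Type u := skewAdjoint.submodule ℝ (RestrictedAlgebra K p)

variable {K p}

/-- The operator on `H` underlying an element of `U_{res,p}(H)`. -/
def RestrictedUnitary.toOp (g : RestrictedUnitary K p) : H →L[ℂ] H :=
  RestrictedAlgebra.toOp (g : RestrictedAlgebra K p)

/-- The operator on `H` underlying an element of `𝔲_{res,p}`. -/
def RestrictedLieAlgebra.toOp (A : RestrictedLieAlgebra K p) : H →L[ℂ] H :=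
  RestrictedAlgebra.toOp (A : RestrictedAlgebra K p)

theorem block_add (L M : Submodule ℂ H) [CompleteSpace M] (A B : H →L[ℂ] H) :
    block L M (A + B) = block L M A + block L M B := by
  ext x; simp [block]

theorem block_smul (L M : Submodule ℂ H) [CompleteSpace M] (c : ℂ) (A : H →L[ℂ] H) :
    block L M (c • A) = c • block L M A := by
  ext x; simp [block]

theorem block_zero (L M : Submodule ℂ H) [CompleteSpace M] :
    block L M (0 : H →L[ℂ] H) = 0 := by
  ext x; simp [block]

variable (K) (q : ℝ≥0∞) [hq : Fact (1 ≤ q)]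

/-- The set `{ρ ∈ 𝔲(H) | [d, ρ] ∈ L_q(H), ρ₊₊ ∈ L_1(H₊), ρ₋₋ ∈ L_1(H₋)}`. -/
def predualSubmodule : Submodule ℝ (H →L[ℂ] H) where
  carrier := {ρ | star ρ = -ρ ∧ MemSchatten q (dComm K ρ) ∧ MemSchatten 1 (block K K ρ) ∧
    MemSchatten 1 (block Kᗮ Kᗮ ρ)}
  add_mem' {a b} ha hb := by
    refine ⟨?_, ?_, ?_, ?_⟩
    · rw [star_add, ha.1, hb.1, neg_add]
    · rw [dComm_add]; exact ha.2.1.add hq.out hb.2.1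
    · rw [block_add]; exact ha.2.2.1.add le_rfl hb.2.2.1
    · rw [block_add]; exact ha.2.2.2.add le_rfl hb.2.2.2
  zero_mem' := by
    refine ⟨by simp, ?_, ?_, ?_⟩
    · rw [show dComm K (0 : H →L[ℂ] H) = 0 by simp [dComm]]; exact MemSchatten.zero hq.out
    · rw [block_zero]; exact MemSchatten.zero le_rfl
    · rw [block_zero]; exact MemSchatten.zero le_rfl
  smul_mem' c a ha := by
    rw [← Complex.coe_smul]
    refine ⟨?_, ?_, ?_, ?_⟩
    · rw [star_smul, ha.1, smul_neg, Complex.star_def, Complex.conj_ofReal]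
    · rw [dComm_smul]; exact ha.2.1.smul hq.out _
    · rw [block_smul]; exact ha.2.2.1.smul le_rfl _
    · rw [block_smul]; exact ha.2.2.2.smul le_rfl _

/-- The real Banach space `𝔲_{1,q}`. It carries the norm
`‖ρ₊₊‖₁ + ‖ρ₋₋‖₁ + ‖ρ₊₋‖_q + ‖ρ₋₊‖_q` given below. -/
def Predual : Type u := predualSubmodule K q

namespace Predual

noncomputable instance : AddCommGroup (Predual K q) :=
  inferInstanceAs (AddCommGroup (predualSubmodule K q))

noncomputable instance : Module ℝ (Predual K q) :=
  inferInstanceAs (Module ℝ (predualSubmodule K q))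

variable {K q}

/-- The operator on `H` underlying an element of `𝔲_{1,q}`. -/
def toOp (ρ : Predual K q) : H →L[ℂ] H := ρ.1

theorem toOp_injective : Function.Injective (toOp : Predual K q → _) := Subtype.val_injective

theorem proj_polarization (x : H) : K.orthogonalProjectionOnto (polarization K x) =
    Complex.I • K.orthogonalProjectionOnto x := by
  have h1 : K.orthogonalProjectionOnto (K.starProjection x) = K.orthogonalProjectionOnto x :=
    Submodule.orthogonalProjectionOnto_mem_subspace_eq_self (K.orthogonalProjectionOnto x)
  have h2 : K.orthogonalProjectionOnto (Kᗮ.starProjection x) = 0 :=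
    Submodule.orthogonalProjectionOnto_apply_of_mem_orthogonal (Submodule.starProjection_apply_mem Kᗮ x)
  simp only [polarization, smul_apply, sub_apply, map_smul, map_sub, h1, h2, sub_zero]

theorem proj_orthogonal_polarization (x : H) :
    Kᗮ.orthogonalProjectionOnto (polarization K x) =
      -(Complex.I • Kᗮ.orthogonalProjectionOnto x) := by
  have h1 : Kᗮ.orthogonalProjectionOnto (Kᗮ.starProjection x) = Kᗮ.orthogonalProjectionOnto x :=
    Submodule.orthogonalProjectionOnto_mem_subspace_eq_self (Kᗮ.orthogonalProjectionOnto x)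
  have h2 : Kᗮ.orthogonalProjectionOnto (K.starProjection x) = 0 :=
    Submodule.orthogonalProjectionOnto_apply_of_mem_orthogonal (Submodule.le_orthogonal_orthogonal K (Submodule.starProjection_apply_mem K x))
  simp only [polarization, smul_apply, sub_apply, map_smul, map_sub, h1, h2, zero_sub, smul_neg]

theorem polarization_of_mem (x : K) : polarization K (x : H) = Complex.I • (x : H) := by
  have h1 : K.starProjection (x : H) = x := Submodule.starProjection_eq_self_iff.2 x.2
  have h2 : Kᗮ.starProjection (x : H) = 0 := (Submodule.starProjection_apply_eq_zero_iff Kᗮ).2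
    (Submodule.le_orthogonal_orthogonal K x.2)
  simp only [polarization, smul_apply, sub_apply, h1, h2, sub_zero]

theorem polarization_of_mem_orthogonal (x : Kᗮ) :
    polarization K (x : H) = -(Complex.I • (x : H)) := by
  have h1 : Kᗮ.starProjection (x : H) = x := Submodule.starProjection_eq_self_iff.2 x.2
  have h2 : K.starProjection (x : H) = 0 := (Submodule.starProjection_apply_eq_zero_iff K).2 x.2
  simp only [polarization, smul_apply, sub_apply, h1, h2, zero_sub, smul_neg]

theorem mem_block_plus (ρ : Predual K q) : MemSchatten 1 (block K K ρ.toOp) := ρ.2.2.2.1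

theorem mem_block_minus (ρ : Predual K q) : MemSchatten 1 (block Kᗮ Kᗮ ρ.toOp) := ρ.2.2.2.2

theorem mem_block_right (ρ : Predual K q) : MemSchatten q (block Kᗮ K ρ.toOp) := by
  have h := (ρ.2.2.1.comp hq.out K.orthogonalProjectionOnto Kᗮ.subtypeL).smul hq.out
    (2 * Complex.I)⁻¹
  convert h using 1
  rw [eq_inv_smul_iff₀ (by simp)]
  ext x : 1
  simp only [block, dComm, ContinuousLinearMap.comp_apply, smul_apply, sub_apply,
    mul_apply_eq_comp, Submodule.subtypeL_apply, map_sub, proj_polarization,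
    polarization_of_mem_orthogonal, map_neg, map_smul]
  change _ = Complex.I • K.orthogonalProjectionOnto (ρ.toOp x) -
    -(Complex.I • K.orthogonalProjectionOnto (ρ.toOp x))
  module

theorem mem_block_left (ρ : Predual K q) : MemSchatten q (block K Kᗮ ρ.toOp) := by
  have h := (ρ.2.2.1.comp hq.out Kᗮ.orthogonalProjectionOnto K.subtypeL).smul hq.out
    (-(2 * Complex.I))⁻¹
  convert h using 1
  rw [eq_inv_smul_iff₀ (by simp)]
  ext x : 1
  simp only [block, dComm, ContinuousLinearMap.comp_apply, smul_apply, sub_apply,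
    mul_apply_eq_comp, Submodule.subtypeL_apply, map_sub,
    proj_orthogonal_polarization, polarization_of_mem, map_smul]
  change _ = -(Complex.I • Kᗮ.orthogonalProjectionOnto (ρ.toOp x)) -
    Complex.I • Kᗮ.orthogonalProjectionOnto (ρ.toOp x)
  module

theorem eq_zero_of_blocks (A : H →L[ℂ] H) (h1 : block K K A = 0) (h2 : block Kᗮ Kᗮ A = 0)
    (h3 : block Kᗮ K A = 0) (h4 : block K Kᗮ A = 0) : A = 0 := by
  have hd : ∀ y : H, (K.orthogonalProjectionOnto y : H) + Kᗮ.orthogonalProjectionOnto y = y :=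
    fun y => Submodule.starProjection_add_starProjection_orthogonal y
  have hK : ∀ x : K, A x = 0 := fun x => by
    have e1 : K.orthogonalProjectionOnto (A x) = 0 := DFunLike.congr_fun h1 x
    have e2 : Kᗮ.orthogonalProjectionOnto (A x) = 0 := DFunLike.congr_fun h4 x
    rw [← hd (A x), e1, e2]; simp
  have hK' : ∀ x : Kᗮ, A x = 0 := fun x => by
    have e1 : K.orthogonalProjectionOnto (A x) = 0 := DFunLike.congr_fun h3 x
    have e2 : Kᗮ.orthogonalProjectionOnto (A x) = 0 := DFunLike.congr_fun h2 x
    rw [← hd (A x), e1, e2]; simp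
  ext x
  rw [← hd x, map_add, hK, hK', add_zero]
  rfl

variable (K q)

/-- The norm `‖ρ‖_{1,q} = ‖ρ₊₊‖₁ + ‖ρ₋₋‖₁ + ‖ρ₊₋‖_q + ‖ρ₋₊‖_q`. -/
noncomputable def addGroupNorm : AddGroupNorm (Predual K q) where
  toFun ρ := schattenNorm 1 (block K K ρ.toOp) + schattenNorm 1 (block Kᗮ Kᗮ ρ.toOp) +
    schattenNorm q (block Kᗮ K ρ.toOp) + schattenNorm q (block K Kᗮ ρ.toOp)
  map_zero' := by
    change schattenNorm 1 (block K K (0 : H →L[ℂ] H)) + schattenNorm 1 (block Kᗮ Kᗮ 0) +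
      schattenNorm q (block Kᗮ K 0) + schattenNorm q (block K Kᗮ 0) = 0
    simp only [block_zero, schattenNorm_zero hq.out, schattenNorm_zero le_rfl, add_zero]
  add_le' A B := by
    change schattenNorm 1 (block K K (A.toOp + B.toOp)) +
      schattenNorm 1 (block Kᗮ Kᗮ (A.toOp + B.toOp)) +
      schattenNorm q (block Kᗮ K (A.toOp + B.toOp)) +
      schattenNorm q (block K Kᗮ (A.toOp + B.toOp)) ≤ _
    simp only [block_add]
    linarith [schattenNorm_add_le le_rfl A.mem_block_plus B.mem_block_plus,
      schattenNorm_add_le le_rfl A.mem_block_minus B.mem_block_minus,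
      schattenNorm_add_le hq.out A.mem_block_right B.mem_block_right,
      schattenNorm_add_le hq.out A.mem_block_left B.mem_block_left]
  neg' A := by
    have hneg : ∀ {L M : Type u} [NormedAddCommGroup L] [InnerProductSpace ℂ L] [CompleteSpace L]
        [NormedAddCommGroup M] [InnerProductSpace ℂ M] [CompleteSpace M] {r : ℝ≥0∞}
        (_ : 1 ≤ r) {T : L →L[ℂ] M} (_ : MemSchatten r T),
        schattenNorm r ((-1 : ℂ) • T) = schattenNorm r T := by
      intro L M _ _ _ _ _ _ r hr T hT
      refine le_antisymm (by simpa using schattenNorm_smul_le hr hT (-1)) ?_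
      simpa using schattenNorm_smul_le hr (hT.smul hr (-1)) (-1)
    have h1 : (-A).toOp = (-1 : ℂ) • A.toOp := by rw [neg_one_smul]; rfl
    simp only [h1, block_smul]
    rw [hneg le_rfl A.mem_block_plus, hneg le_rfl A.mem_block_minus, hneg hq.out A.mem_block_right,
      hneg hq.out A.mem_block_left]
  eq_zero_of_map_eq_zero' A h := by
    have h1 := schattenNorm_nonneg 1 (block K K A.toOp)
    have h2 := schattenNorm_nonneg 1 (block Kᗮ Kᗮ A.toOp)
    have h3 := schattenNorm_nonneg q (block Kᗮ K A.toOp)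
    have h4 := schattenNorm_nonneg q (block K Kᗮ A.toOp)
    refine toOp_injective (eq_zero_of_blocks (K := K) A.toOp ?_ ?_ ?_ ?_)
    · exact schattenNorm_eq_zero le_rfl A.mem_block_plus (by linarith)
    · exact schattenNorm_eq_zero le_rfl A.mem_block_minus (by linarith)
    · exact schattenNorm_eq_zero hq.out A.mem_block_right (by linarith)
    · exact schattenNorm_eq_zero hq.out A.mem_block_left (by linarith)

noncomputable instance : NormedAddCommGroup (Predual K q) :=
  (addGroupNorm K q).toNormedAddCommGroup

theorem norm_def (ρ : Predual K q) :
    ‖ρ‖ = schattenNorm 1 (block K K ρ.toOp) + schattenNorm 1 (block Kᗮ Kᗮ ρ.toOp) +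
      schattenNorm q (block Kᗮ K ρ.toOp) + schattenNorm q (block K Kᗮ ρ.toOp) := rfl

noncomputable instance : NormedSpace ℝ (Predual K q) where
  norm_smul_le c A := by
    rw [norm_def, norm_def]
    have h1 : (c • A).toOp = (c : ℂ) • A.toOp := (Complex.coe_smul c A.toOp).symm
    simp only [h1, block_smul, mul_add]
    have h2 : ‖c‖ = ‖(c : ℂ)‖ := (Complex.norm_real c).symm
    rw [h2]
    linarith [schattenNorm_smul_le le_rfl A.mem_block_plus c, schattenNorm_smul_le le_rfl A.mem_block_minus c,
      schattenNorm_smul_le hq.out A.mem_block_right c,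
      schattenNorm_smul_le hq.out A.mem_block_left c]

end Predual

/-- The restricted trace `Tr_res(ρ) = Tr(ρ₊₊) + Tr(ρ₋₋)`. -/
noncomputable def restrictedTrace (ρ : H →L[ℂ] H) : ℂ :=
  operatorTrace (block K K ρ) + operatorTrace (block Kᗮ Kᗮ ρ)

/-- The operator `u ⊕ v` on `H = K ⊕ Kᗮ`. -/
noncomputable def directSumOp (u : K →L[ℂ] K) (v : Kᗮ →L[ℂ] Kᗮ) : H →L[ℂ] H :=
  K.subtypeL ∘L u ∘L K.orthogonalProjectionOnto +
    Kᗮ.subtypeL ∘L v ∘L Kᗮ.orthogonalProjectionOnto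

variable {K}

theorem directSumOp_mul (u u' : K →L[ℂ] K) (v v' : Kᗮ →L[ℂ] Kᗮ) :
    directSumOp K (u * u') (v * v') = directSumOp K u v * directSumOp K u' v' := by
  ext x
  have h1 : ∀ y : K, K.orthogonalProjectionOnto (y : H) = y :=
    fun y => Submodule.orthogonalProjectionOnto_mem_subspace_eq_self y
  have h2 : ∀ y : Kᗮ, Kᗮ.orthogonalProjectionOnto (y : H) = y :=
    fun y => Submodule.orthogonalProjectionOnto_mem_subspace_eq_self y
  have h3 : ∀ y : Kᗮ, K.orthogonalProjectionOnto (y : H) = 0 := fun y =>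
    Submodule.orthogonalProjectionOnto_apply_of_mem_orthogonal y.2
  have h4 : ∀ y : K, Kᗮ.orthogonalProjectionOnto (y : H) = 0 := fun y =>
    Submodule.orthogonalProjectionOnto_apply_of_mem_orthogonal (Submodule.le_orthogonal_orthogonal K y.2)
  simp [directSumOp, h1, h2, h3, h4]

theorem directSumOp_one : directSumOp K 1 1 = 1 := by
  ext x
  exact Submodule.starProjection_add_starProjection_orthogonal x

theorem directSumOp_star (u : K →L[ℂ] K) (v : Kᗮ →L[ℂ] Kᗮ) :
    star (directSumOp K u v) = directSumOp K (star u) (star v) := by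
  simp only [directSumOp, star_add, ContinuousLinearMap.star_eq_adjoint,
    ContinuousLinearMap.adjoint_comp, Submodule.adjoint_subtypeL,
    Submodule.adjoint_orthogonalProjectionOnto]
  rfl

theorem dComm_directSumOp (u : K →L[ℂ] K) (v : Kᗮ →L[ℂ] Kᗮ) :
    dComm K (directSumOp K u v) = 0 := by
  ext x
  simp [dComm, directSumOp, Predual.polarization_of_mem, Predual.polarization_of_mem_orthogonal,
    Predual.proj_polarization, Predual.proj_orthogonal_polarization]

variable (K) (p)

/-- The homomorphism `U(K) × U(Kᗮ) → U_{res,p}(H)`, `(u, v) ↦ u ⊕ v`. -/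
noncomputable def blockDiagonal :
    unitary (K →L[ℂ] K) × unitary (Kᗮ →L[ℂ] Kᗮ) →* RestrictedUnitary K p where
  toFun x := ⟨⟨directSumOp K x.1 x.2, by
      change MemSchatten p _
      rw [dComm_directSumOp]
      exact MemSchatten.zero hp.out⟩, by
    constructor <;> refine Subtype.ext ?_
    · change star (directSumOp K x.1 x.2) * directSumOp K x.1 x.2 = 1
      rw [directSumOp_star, ← directSumOp_mul, Unitary.coe_star_mul_self,
        Unitary.coe_star_mul_self, directSumOp_one]
    · change directSumOp K x.1 x.2 * star (directSumOp K x.1 x.2) = 1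
      rw [directSumOp_star, ← directSumOp_mul, Unitary.mul_star_self_of_mem x.1.2,
        Unitary.mul_star_self_of_mem x.2.2, directSumOp_one]⟩
  map_one' := Subtype.ext (Subtype.ext directSumOp_one)
  map_mul' x y := Subtype.ext (Subtype.ext (directSumOp_mul _ _ _ _))

end Restricted

/-- A subgroup `S` of a real Banach Lie group `G` is a Banach Lie subgroup if, with the subspace
topology, it is itself a Banach Lie group (modelled on some real Banach space `F`) for which the
inclusion `S → G` is a smooth embedding, that is, a topological embedding that in suitable
charts looks like the inclusion of a complemented subspace. -/
def IsBanachLieSubgroup (E : Type u) [NormedAddCommGroup E] [NormedSpace ℝ E] {G : Type v}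
    [Group G] [TopologicalSpace G] [ChartedSpace E G] (S : Subgroup G) : Prop :=
  ∃ (F : Type u) (_ : NormedAddCommGroup F) (_ : NormedSpace ℝ F) (_ : CompleteSpace F)
    (_ : ChartedSpace F S),
    LieGroup (modelWithCornersSelf ℝ F) (⊤ : ℕ∞) S ∧
      Manifold.IsSmoothEmbedding (modelWithCornersSelf ℝ F) (modelWithCornersSelf ℝ E) (⊤ : ℕ∞)
        (Subtype.val : S → G)

end RestrictedGrassmannian

open RestrictedGrassmannian

/-!
Write `d` for the polarization, `[d, A]` for `dComm K A` and `d A + A d` for `aComm K A`.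

**Schatten classes.** Everything analytic rests on Hölder's inequality `‖A B‖₁ ≤ ‖A‖_p ‖B‖_q` for
`p ≤ 2` and on the cyclicity of the trace. Both follow from one double sum: `A B` is the sum of the
rank one operators `A e ⊗ (B* e)*` over an orthonormal basis `e`, and for an eigenbasis of `A* A`
the sum `∑ ‖A e‖ ‖B* e‖` is at most `‖A‖_p ‖B‖_q`. Here `∑ ‖A e‖^p = ‖A‖_p^p` because the basis
diagonalizes `A* A`, while `∑ ‖B* e‖^q ≤ ‖B*‖_q^q` holds in every basis because `q ≥ 2`
(`exists_basis_tsum_le`, `MemSchatten.holder`, `operatorTrace_comp_comm`).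

**The coadjoint action.** The anticommutator `d X + X d` sees the block diagonal part of `X` and
`[d, X]` the rest, so `X` satisfies the block conditions of `𝔲_{1,q}` if and only if
`d X + X d ∈ L_1` and `[d, X] ∈ L_q` (`IsPredualOp`). The product rules
`d A B + A B d = [d, A] B + A (d B + B d) = (d A + A d) B - A [d, B]` and Hölder's inequality make
`𝔲_{1,q}` a topological bimodule over `L_{res,p}`, up to skew-adjointness, so that conjugation by
`g` is bounded. For `X = g d g⁻¹ - d` both `d` and `d + X` square to `-1`, whence
`d X + X d = -X²`, which is of trace class because `X ∈ L_p ∩ L_q`; this is `σ(g) ∈ 𝔲_{1,q}`.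
That conjugation is the coadjoint action is the cyclicity of the trace, applied block by block; it
is determined by the pairing because the operators `y ↦ i ⟪x, y⟫ x` lie in `𝔲_{res,p}` and pair
with `ν` to `i ⟪x, ν x⟫` (`eq_coadjoint_iff`). The affine action is an action because `σ` is a
cocycle, and the isotropy group of `(0, γ)` is `{g | σ(g) = 0} = {g | [d, g] = 0}`, the group of
block diagonal unitaries.

**Lie group structures.** The Cayley transform `x ↦ (x - 1) (1 + x)⁻¹` is a diffeomorphism between
open subsets of the Banach algebra `L_{res,p}`. It maps unitaries to skew-adjoint elements and
elements commuting with `d` to elements commuting with `d`, and so does its inverse. Composed with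
translations by group elements it gives charts of the algebra, of `U_{res,p}` and of the isotropy
group at once, in which the two inclusions are the inclusions of complemented closed subspaces
`{x | x* = -x, d x = x d} ≤ {x | x* = -x} ≤ L_{res,p}` (`IsCayleyGroup`). The smoothness of the
group operations is inherited from the algebra through the embedding. This uses that `L_{res,p}`
is complete, which follows from the lower semicontinuity of Schatten norms
(`MemSchatten.of_tendsto`).
-/

namespace RestrictedGrassmannian

universe u v w

section SchattenHolder

open ContinuousLinearMap (adjoint)

variable {E : Type u} [NormedAddCommGroup E] [InnerProductSpace ℂ E] [CompleteSpace E]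
  {F : Type v} [NormedAddCommGroup F] [InnerProductSpace ℂ F] [CompleteSpace F]
  {G : Type w} [NormedAddCommGroup G] [InnerProductSpace ℂ G] [CompleteSpace G]

/-! ### Hölder's inequality for Schatten classes -/

/-- An eigenbasis of `A* A` computes all Schatten traces of a compact operator `A`. -/
theorem exists_basis_schattenTrace_eq (A : E →L[ℂ] F) (hA : IsCompactOperator A) :
    ∃ (ι : Type u) (f : HilbertBasis ι ℂ E),
      ∀ p : ℝ, 0 < p → schattenTrace p A = ∑' i, ‖A (f i)‖ₑ ^ p := by
  obtain ⟨ι, f, s, hs⟩ := exists_eigenbasis A hA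
  refine ⟨ι, f, fun p hp => ?_⟩
  -- the trace of `(A* A)^(p/2)` is the squared Hilbert-Schmidt norm of `(A* A)^(p/4)`, which does
  -- not depend on the basis
  have hc : Continuous fun x : ℝ => x ^ (p / 4) := Real.continuous_rpow_const (by positivity)
  have h1 : schattenTrace p A = ∑' i, ‖fc A (fun x => x ^ (p / 4)) (f i)‖ₑ ^ 2 := by
    rw [schattenTrace_eq hp]
    have hS := fc_adj A (fun x => x ^ (p / 4))
    refine le_antisymm ?_ ?_
    · simpa using hs_contraction f (basis E) _ hS (ContinuousLinearMap.id ℂ E)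
        ContinuousLinearMap.norm_id_le
    · simpa using hs_contraction (basis E) f _ hS (ContinuousLinearMap.id ℂ E)
        ContinuousLinearMap.norm_id_le
  rw [h1]
  refine tsum_congr fun i => ?_
  have hfi : ‖f i‖ = 1 := f.orthonormal.1 i
  have h2 : ⟪f i, sqAbs A (f i)⟫_ℂ = (s i : ℂ) := by
    rw [hs, inner_smul_right, inner_self_eq_norm_sq_to_K, hfi]
    simp
  have hs1 : s i = ‖A (f i)‖ ^ 2 := by
    rw [ContinuousLinearMap.comp_apply, ContinuousLinearMap.adjoint_inner_right,
      inner_self_eq_norm_sq_to_K] at h2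
    have h3 := congrArg Complex.re h2
    norm_cast at h3
    exact h3.symm
  rw [fc_eigen A hc (hs i), hs1, enorm_smul, ← ofReal_norm (f i), hfi, ENNReal.ofReal_one, mul_one,
    ← ofReal_norm, ← ofReal_norm, Complex.norm_real, Real.norm_eq_abs,
    abs_of_nonneg (by positivity), ENNReal.ofReal_rpow_of_nonneg (norm_nonneg _) hp.le,
    ← ENNReal.ofReal_pow (by positivity)]
  congr 1
  rw [← Real.rpow_natCast, ← Real.rpow_natCast, ← Real.rpow_mul (norm_nonneg _),
    ← Real.rpow_mul (norm_nonneg _)]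
  congr 1
  push_cast
  ring

theorem schattenTrace_sqAbs (A : E →L[ℂ] F) {p : ℝ} (hp : 0 < p) :
    schattenTrace (p / 2) (sqAbs A) = schattenTrace p A := by
  have h0 := sqAbs_nonneg A
  have h1 : adjoint (sqAbs A) ∘L sqAbs A = sqAbs A ^ (2 : ℝ) := by
    have h2 : adjoint (sqAbs A) = sqAbs A := sqAbs_sa A
    rw [h2]
    have h3 := CFC.rpow_natCast (sqAbs A) 2 h0
    rw [Nat.cast_ofNat, pow_two] at h3
    exact h3.symm
  rw [schattenTrace, schattenTrace, h1,
    CFC.rpow_rpow_of_exponent_nonneg _ _ _ (by norm_num) (by positivity) h0]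
  congr 2
  ring

/-- For `q ≥ 2` the `q`-th powers of the norms of the images of any orthonormal basis sum up to at
most the Schatten trace; for `q < 2` this inequality is reversed. -/
theorem tsum_enorm_rpow_le (A : E →L[ℂ] F) {q : ℝ} (hq : 2 ≤ q) {ι : Type*}
    (e : HilbertBasis ι ℂ E) : ∑' i, ‖A (e i)‖ₑ ^ q ≤ schattenTrace q A := by
  have hid : ‖ContinuousLinearMap.id ℂ E‖ ≤ 1 := ContinuousLinearMap.norm_id_le
  have h := sum_inner_le (sqAbs A) (p := q / 2) (by linarith) e _ _ hid hid
  rw [schattenTrace_sqAbs A (by linarith)] at h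
  refine le_trans (le_of_eq (tsum_congr fun i => ?_)) h
  have h1 : ‖⟪e i, sqAbs A (e i)⟫_ℂ‖ₑ = ‖A (e i)‖ₑ ^ (2 : ℝ) := by
    rw [ContinuousLinearMap.comp_apply, ContinuousLinearMap.adjoint_inner_right,
      inner_self_eq_norm_sq_to_K, ← ofReal_norm, ← ofReal_norm, ENNReal.rpow_two,
      ← ENNReal.ofReal_pow (norm_nonneg _)]
    simp
  change _ = ‖⟪e i, sqAbs A (e i)⟫_ℂ‖ₑ ^ (q / 2)
  rw [h1, ← ENNReal.rpow_mul]
  congr 1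
  ring

theorem tsum_mul_le_Lp_mul_Lq {ι : Type*} (f g : ι → ℝ≥0∞) {p q : ℝ} (hpq : p.HolderConjugate q) :
    ∑' i, f i * g i ≤ (∑' i, f i ^ p) ^ (1 / p) * (∑' i, g i ^ q) ^ (1 / q) := by
  rw [ENNReal.tsum_eq_iSup_sum]
  refine iSup_le fun s => (ENNReal.inner_le_Lp_mul_Lq s f g hpq).trans ?_
  have hp := hpq.pos
  have hq := hpq.symm.pos
  gcongr <;> exact ENNReal.sum_le_tsum s

/-- The double sum behind both Hölder's inequality and the cyclicity of the trace: a product `A B`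
is the sum of the rank one operators `A e ⊗ (B* e)*` along an orthonormal basis `e`. -/
theorem tsum_tsum_inner_mul_inner_le (A : F →L[ℂ] G) (B : E →L[ℂ] F) {ι κ : Type*}
    (e : HilbertBasis ι ℂ F) (f : HilbertBasis κ ℂ E) (Y : E →L[ℂ] G) (hY : ‖Y‖ ≤ 1) :
    ∑' i, ∑' j, ‖⟪Y (f j), A (e i)⟫_ℂ * ⟪e i, B (f j)⟫_ℂ‖ₑ ≤
      ∑' i, ‖A (e i)‖ₑ * ‖adjoint B (e i)‖ₑ := by
  refine ENNReal.tsum_le_tsum fun i => ?_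
  have h1 : ∀ j, ‖⟪Y (f j), A (e i)⟫_ℂ * ⟪e i, B (f j)⟫_ℂ‖ₑ =
      ‖⟪f j, adjoint Y (A (e i))⟫_ℂ‖ₑ * ‖⟪f j, adjoint B (e i)⟫_ℂ‖ₑ := by
    intro j
    rw [enorm_mul, ContinuousLinearMap.adjoint_inner_right, ContinuousLinearMap.adjoint_inner_right,
      ← inner_conj_symm (e i), ← ofReal_norm (starRingEnd ℂ _), RCLike.norm_conj, ofReal_norm]
  simp_rw [h1]
  have h2 := tsum_mul_le_Lp_mul_Lq (fun j => ‖⟪f j, adjoint Y (A (e i))⟫_ℂ‖ₑ)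
    (fun j => ‖⟪f j, adjoint B (e i)⟫_ℂ‖ₑ) (Real.HolderConjugate.two_two)
  simp only [ENNReal.rpow_two] at h2
  rw [← enorm_sq_eq_tsum, ← enorm_sq_eq_tsum, one_div, ← ENNReal.rpow_two, ← ENNReal.rpow_two,
    ENNReal.rpow_rpow_inv two_ne_zero, ENNReal.rpow_rpow_inv two_ne_zero] at h2
  refine h2.trans ?_
  gcongr
  rw [← ofReal_norm, ← ofReal_norm]
  refine ENNReal.ofReal_le_ofReal (((adjoint Y).le_opNorm _).trans ?_)
  exact mul_le_of_le_one_left (norm_nonneg _) (norm_adj_le_one hY)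

theorem hasSum_inner_mul_inner_comp (A : F →L[ℂ] G) (B : E →L[ℂ] F) {ι : Type*}
    (e : HilbertBasis ι ℂ F) (x : G) (y : E) :
    HasSum (fun i => ⟪x, A (e i)⟫_ℂ * ⟪e i, B y⟫_ℂ) ⟪x, A (B y)⟫_ℂ := by
  have h := e.hasSum_inner_mul_inner (adjoint A x) (B y)
  simpa only [ContinuousLinearMap.adjoint_inner_left] using h

theorem schattenTrace_one_comp_le (A : F →L[ℂ] G) (B : E →L[ℂ] F) (hAB : IsCompactOperator (A ∘L B))
    {ι : Type*} (e : HilbertBasis ι ℂ F) :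
    schattenTrace 1 (A ∘L B) ≤ ∑' i, ‖A (e i)‖ₑ * ‖adjoint B (e i)‖ₑ := by
  obtain ⟨κ, f, Y, hY, h⟩ := exists_trace_eq (A ∘L B) hAB one_pos
  simp only [ENNReal.rpow_one] at h
  rw [h]
  refine le_trans ?_ (tsum_tsum_inner_mul_inner_le A B e f Y hY)
  rw [ENNReal.tsum_comm]
  refine ENNReal.tsum_le_tsum fun j => ?_
  have h1 := hasSum_inner_mul_inner_comp A B e (Y (f j)) (f j)
  rw [ContinuousLinearMap.comp_apply, ← h1.tsum_eq]
  exact enorm_tsum_le_tsum_enorm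

/-- The trace of `A B`, along any basis, is the trace of `B A` along `e`. -/
theorem hasSum_inner_comp_comm (A : F →L[ℂ] E) (B : E →L[ℂ] F) {ι κ : Type*}
    (e : HilbertBasis ι ℂ F) (f : HilbertBasis κ ℂ E)
    (h : ∑' i, ‖A (e i)‖ₑ * ‖adjoint B (e i)‖ₑ ≠ ∞) :
    HasSum (fun j => ⟪f j, A (B (f j))⟫_ℂ) (∑' i, ⟪e i, B (A (e i))⟫_ℂ) := by
  have hb := tsum_tsum_inner_mul_inner_le A B e f (ContinuousLinearMap.id ℂ E)
    ContinuousLinearMap.norm_id_le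
  have hs : Summable fun x : ι × κ => ⟪f x.2, A (e x.1)⟫_ℂ * ⟪e x.1, B (f x.2)⟫_ℂ := by
    refine Summable.of_enorm ?_
    rw [ENNReal.tsum_prod (f := fun i j => ‖⟪f j, A (e i)⟫_ℂ * ⟪e i, B (f j)⟫_ℂ‖ₑ)]
    exact ne_top_of_le_ne_top h hb
  have h1 : ∀ i, HasSum (fun j => ⟪f j, A (e i)⟫_ℂ * ⟪e i, B (f j)⟫_ℂ) ⟪e i, B (A (e i))⟫_ℂ := by
    intro i
    have h2 : HasSum (fun j => ⟪e i, B (f j)⟫_ℂ * ⟪f j, A (e i)⟫_ℂ) ⟪e i, B (A (e i))⟫_ℂ :=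
      hasSum_inner_mul_inner_comp B (ContinuousLinearMap.id ℂ E) f (e i) (A (e i))
    simpa only [mul_comm] using h2
  rw [← (hs.hasSum.prod_fiberwise h1).tsum_eq.symm]
  have h3 := ((Equiv.prodComm κ ι).hasSum_iff.2 hs.hasSum).prod_fiberwise
    (fun j => hasSum_inner_mul_inner_comp A B e (f j) (f j))
  exact h3

/-- The trace of a trace class operator does not depend on the orthonormal basis. -/
theorem hasSum_operatorTrace {T : E →L[ℂ] E} (hT : MemSchatten 1 T) {κ : Type*}
    (f : HilbertBasis κ ℂ E) : HasSum (fun j => ⟪f j, T (f j)⟫_ℂ) (operatorTrace T) := by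
  obtain ⟨ι, e, he⟩ := exists_basis_schattenTrace_eq T (hT.compact le_rfl)
  have h1 : schattenTrace 1 T < ∞ := by simpa [MemSchatten] using hT
  have h2 : ∑' i, ‖T (e i)‖ₑ * ‖adjoint (ContinuousLinearMap.id ℂ E) (e i)‖ₑ ≠ ∞ := by
    refine ne_top_of_le_ne_top h1.ne (le_of_eq ?_)
    rw [he 1 one_pos]
    refine tsum_congr fun i => ?_
    have h3 : adjoint (ContinuousLinearMap.id ℂ E) = ContinuousLinearMap.id ℂ E :=
      ContinuousLinearMap.adjoint_id
    rw [h3, ContinuousLinearMap.id_apply, ← ofReal_norm (e i), e.orthonormal.1 i,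
      ENNReal.ofReal_one, mul_one, ENNReal.rpow_one]
  have h3 := (hasSum_inner_comp_comm T (ContinuousLinearMap.id ℂ E) e (basis E) h2).tsum_eq
  have h4 := hasSum_inner_comp_comm T (ContinuousLinearMap.id ℂ E) e f h2
  rw [← h3] at h4
  exact h4

theorem operatorTrace_add {S T : E →L[ℂ] E} (hS : MemSchatten 1 S) (hT : MemSchatten 1 T) :
    operatorTrace (S + T) = operatorTrace S + operatorTrace T := by
  have h := (hasSum_operatorTrace hS (basis E)).add (hasSum_operatorTrace hT (basis E))
  rw [← h.tsum_eq]
  exact tsum_congr fun i => by rw [add_apply, inner_add_right]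

theorem ofReal_schattenNorm {p : ℝ≥0∞} (hp : p ≠ ∞) {A : E →L[ℂ] F}
    (h : MemSchatten p A) :
    ENNReal.ofReal (schattenNorm p A) = schattenTrace p.toReal A ^ (1 / p.toReal) := by
  rw [MemSchatten, if_neg hp] at h
  rw [schattenNorm, if_neg hp, ENNReal.toReal_rpow, ENNReal.ofReal_toReal]
  exact (ENNReal.rpow_lt_top_of_nonneg (by positivity) h.ne).ne

theorem two_le_of_inv_add_inv_eq_one {p q : ℝ≥0∞} (hp : p ≤ 2) (hpq : p⁻¹ + q⁻¹ = 1) : 2 ≤ q := by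
  rw [← ENNReal.inv_le_inv]
  have h1 : (2 : ℝ≥0∞)⁻¹ ≤ p⁻¹ := ENNReal.inv_le_inv.2 hp
  have h2 : (2 : ℝ≥0∞)⁻¹ + q⁻¹ ≤ 2⁻¹ + 2⁻¹ := by
    rw [ENNReal.inv_two_add_inv_two, ← hpq]
    gcongr
  exact (ENNReal.add_le_add_iff_left (by simp)).1 h2

/-- An eigenbasis of `A* A` realizes Hölder's inequality for `A B`. In the limiting case `q = ∞`
the second factor only has to be bounded. -/
theorem exists_basis_tsum_le {p q : ℝ≥0∞} (hp1 : 1 ≤ p) (hp : p ≤ 2) (hpq : p⁻¹ + q⁻¹ = 1)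
    {A : F →L[ℂ] G} {B : E →L[ℂ] F} (hA : MemSchatten p A) (hB : q ≠ ∞ → MemSchatten q B) :
    ∃ (ι : Type v) (e : HilbertBasis ι ℂ F), ∑' i, ‖A (e i)‖ₑ * ‖adjoint B (e i)‖ₑ ≤
      ENNReal.ofReal (schattenNorm p A * schattenNorm q B) := by
  have hpt : p ≠ ∞ := ne_top_of_le_ne_top (by norm_num) hp
  obtain ⟨ι, e, he⟩ := exists_basis_schattenTrace_eq A (hA.compact hp1)
  refine ⟨ι, e, ?_⟩
  have hp0 : 0 < p.toReal := by linarith [one_le_toReal hp1 hpt]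
  rw [ENNReal.ofReal_mul (schattenNorm_nonneg _ _), ofReal_schattenNorm hpt hA]
  by_cases hq : q = ∞
  · have h1 : p = 1 := by
      rw [hq, ENNReal.inv_top, add_zero, ENNReal.inv_eq_one] at hpq
      exact hpq
    subst h1
    have h2 : ENNReal.ofReal (schattenNorm q B) = ‖adjoint B‖ₑ := by
      rw [schattenNorm, if_pos hq, ← LinearIsometryEquiv.norm_map adjoint B, ofReal_norm]
    rw [h2, ENNReal.toReal_one, he 1 one_pos, div_one, ENNReal.rpow_one, ← ENNReal.tsum_mul_right]
    refine ENNReal.tsum_le_tsum fun i => ?_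
    rw [ENNReal.rpow_one]
    gcongr
    have h3 := (adjoint B).le_opNorm (e i)
    rw [e.orthonormal.1 i, mul_one] at h3
    rw [← ofReal_norm, ← ofReal_norm]
    exact ENNReal.ofReal_le_ofReal h3
  · have hq2 : 2 ≤ q := two_le_of_inv_add_inv_eq_one hp hpq
    have hq1 : 1 ≤ q := le_trans (by norm_num) hq2
    have hq2' : 2 ≤ q.toReal := by simpa using ENNReal.toReal_mono hq hq2
    have hconj : p.toReal.HolderConjugate q.toReal := by
      rw [Real.holderConjugate_iff]
      have h1 : (p⁻¹ + q⁻¹).toReal = 1 := by rw [hpq, ENNReal.toReal_one]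
      rw [ENNReal.toReal_add (ENNReal.inv_ne_top.2 (zero_lt_one.trans_le hp1).ne')
        (ENNReal.inv_ne_top.2 (zero_lt_one.trans_le hq1).ne'), ENNReal.toReal_inv,
        ENNReal.toReal_inv] at h1
      refine ⟨?_, h1⟩
      have h2 : 0 < q.toReal⁻¹ := by positivity
      rw [← inv_lt_one₀ hp0]
      linarith
    refine (tsum_mul_le_Lp_mul_Lq _ _ hconj).trans ?_
    have hB' := (hB hq).memAdjoint hq1
    rw [← he _ hp0]
    gcongr
    calc _ ≤ schattenTrace q.toReal (adjoint B) ^ (1 / q.toReal) := by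
          gcongr
          exact tsum_enorm_rpow_le _ hq2' e
      _ = ENNReal.ofReal (schattenNorm q (adjoint B)) := (ofReal_schattenNorm hq hB').symm
      _ ≤ _ := ENNReal.ofReal_le_ofReal (schattenNorm_adjoint_le hq1 (hB hq))

/-- Hölder's inequality `‖A B‖₁ ≤ ‖A‖_p ‖B‖_q`. For `q = ∞` the class `L_∞` consists of compact
operators, but `B` may be any bounded operator. -/
theorem MemSchatten.holder {p q : ℝ≥0∞} (hp1 : 1 ≤ p) (hp : p ≤ 2) (hpq : p⁻¹ + q⁻¹ = 1)
    {A : F →L[ℂ] G} {B : E →L[ℂ] F} (hA : MemSchatten p A) (hB : q ≠ ∞ → MemSchatten q B) :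
    MemSchatten 1 (A ∘L B) ∧ schattenNorm 1 (A ∘L B) ≤ schattenNorm p A * schattenNorm q B := by
  obtain ⟨ι, e, he⟩ := exists_basis_tsum_le hp1 hp hpq hA hB
  have h1 := (schattenTrace_one_comp_le A B ((hA.compact hp1).comp_clm B) e).trans he
  have h2 : MemSchatten 1 (A ∘L B) := by
    rw [MemSchatten, if_neg ENNReal.one_ne_top, ENNReal.toReal_one]
    exact h1.trans_lt ENNReal.ofReal_lt_top
  refine ⟨h2, ?_⟩
  rw [← ENNReal.ofReal_le_ofReal_iff
      (mul_nonneg (schattenNorm_nonneg _ _) (schattenNorm_nonneg _ _)),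
    ofReal_schattenNorm ENNReal.one_ne_top h2]
  simpa using h1

theorem schattenNorm_adjoint {p : ℝ≥0∞} (hp : 1 ≤ p) {A : E →L[ℂ] F} (h : MemSchatten p A) :
    schattenNorm p (adjoint A) = schattenNorm p A := by
  refine le_antisymm (schattenNorm_adjoint_le hp h) ?_
  simpa using schattenNorm_adjoint_le hp (h.memAdjoint hp)

/-- Hölder's inequality with the factors in the other order, from that for the adjoints. -/
theorem MemSchatten.holder' {p q : ℝ≥0∞} (hp1 : 1 ≤ p) (hp : p ≤ 2) (hpq : p⁻¹ + q⁻¹ = 1)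
    {A : F →L[ℂ] G} {B : E →L[ℂ] F} (hA : q ≠ ∞ → MemSchatten q A) (hB : MemSchatten p B) :
    MemSchatten 1 (A ∘L B) ∧ schattenNorm 1 (A ∘L B) ≤ schattenNorm q A * schattenNorm p B := by
  have hq1 : 1 ≤ q := by
    rw [← ENNReal.inv_le_one, ← hpq]
    exact le_add_self
  have h := MemSchatten.holder hp1 hp hpq (hB.memAdjoint hp1)
    (fun hq => (hA hq).memAdjoint hq1)
  rw [← ContinuousLinearMap.adjoint_comp] at h
  have h1 := h.1.memAdjoint le_rfl
  rw [ContinuousLinearMap.adjoint_adjoint] at h1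
  refine ⟨h1, ?_⟩
  rw [← schattenNorm_adjoint le_rfl h1, mul_comm]
  refine h.2.trans ?_
  rw [schattenNorm_adjoint hp1 hB]
  gcongr
  · exact schattenNorm_nonneg _ _
  · by_cases hq : q = ∞
    · simp [schattenNorm, hq]
    · exact schattenNorm_adjoint_le hq1 (hA hq)

/-- Cyclicity of the trace. -/
theorem operatorTrace_comp_comm {p q : ℝ≥0∞} (hp1 : 1 ≤ p) (hp : p ≤ 2) (hpq : p⁻¹ + q⁻¹ = 1)
    {A : F →L[ℂ] E} {B : E →L[ℂ] F} (hA : MemSchatten p A) (hB : q ≠ ∞ → MemSchatten q B) :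
    operatorTrace (A ∘L B) = operatorTrace (B ∘L A) := by
  obtain ⟨ι, e, he⟩ := exists_basis_tsum_le hp1 hp hpq hA hB
  have h1 := hasSum_inner_comp_comm A B e (basis E) (he.trans_lt ENNReal.ofReal_lt_top).ne
  have h2 := hasSum_operatorTrace (MemSchatten.holder' hp1 hp hpq hB hA).1 e
  exact h1.tsum_eq.trans h2.tsum_eq

/-! ### Inclusions, completeness and operators of rank one -/

theorem tsum_rpow_le_rpow_tsum {ι : Type*} (f : ι → ℝ≥0∞) {p q : ℝ} (hp : 0 < p) (hpq : p ≤ q) :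
    ∑' i, f i ^ q ≤ (∑' i, f i ^ p) ^ (q / p) := by
  by_cases ht : ∑' i, f i ^ p = ∞
  · rw [ht, ENNReal.top_rpow_of_pos (div_pos (hp.trans_le hpq) hp)]
    exact le_top
  have h1 : q / p = (q - p) / p + 1 := by field_simp; ring
  have h2 : 0 ≤ (q - p) / p := div_nonneg (by linarith) hp.le
  have h3 : ∀ i, f i ^ q = (f i ^ p) ^ ((q - p) / p) * f i ^ p := by
    intro i
    rw [← ENNReal.rpow_mul, ← ENNReal.rpow_add_of_nonneg _ _ (mul_nonneg hp.le h2) hp.le]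
    congr 1
    field_simp
    ring
  rw [h1, ENNReal.rpow_add_of_nonneg _ _ h2 zero_le_one, ENNReal.rpow_one, ← ENNReal.tsum_mul_left]
  refine ENNReal.tsum_le_tsum fun i => ?_
  rw [h3]
  gcongr
  exact ENNReal.le_tsum i

/-- The bound `‖A x‖² = |⟪A x, A x⟫| ≤ ‖A‖_p ‖x‖ ‖A x‖` is an instance of the trace inequality
`sum_inner_le'`, for the operators `ℂ → E` and `ℂ → F` that map `1` to `x` and `A x`. -/
theorem opNorm_le_schattenNorm {p : ℝ≥0∞} (hp : 1 ≤ p) {A : E →L[ℂ] F} (h : MemSchatten p A) :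
    ‖A‖ ≤ schattenNorm p A := by
  by_cases hpt : p = ∞
  · simp [schattenNorm, hpt]
  have hp1 := one_le_toReal hp hpt
  have hp0 : 0 < p.toReal := by linarith
  -- a unit vector of `ℂ` that belongs to an orthonormal basis
  obtain ⟨i⟩ : Nonempty (basisSet ℂ) := by
    by_contra hne
    rw [not_nonempty_iff] at hne
    have h1 := enorm_sq_eq_tsum (basis ℂ) (1 : ℂ)
    simp at h1
  have hi : ‖basis ℂ i‖ = 1 := (basis ℂ).orthonormal.1 i
  refine A.opNorm_le_bound (schattenNorm_nonneg _ _) fun x => ?_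
  have h1 := (ENNReal.le_tsum i).trans (sum_inner_le' A hp1 (basis ℂ)
    (ContinuousLinearMap.toSpanSingleton ℂ x) (ContinuousLinearMap.toSpanSingleton ℂ (A x)))
  have h2 : ‖⟪basis ℂ i • A x, A (basis ℂ i • x)⟫_ℂ‖ₑ = (‖A x‖ₑ) * ‖A x‖ₑ := by
    rw [map_smul, inner_smul_left, inner_smul_right, inner_self_eq_norm_sq_to_K, enorm_mul,
      enorm_mul, ← ofReal_norm (starRingEnd ℂ _), RCLike.norm_conj, hi,
      ← ofReal_norm (basis ℂ i), hi, ENNReal.ofReal_one, one_mul, one_mul, ← ofReal_norm,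
      ← ofReal_norm, ← ENNReal.ofReal_mul (norm_nonneg _)]
    congr 1
    simp [pow_two]
  simp only [ContinuousLinearMap.toSpanSingleton_apply] at h1
  rw [h2] at h1
  have h3 : ‖ContinuousLinearMap.toSpanSingleton ℂ x‖ₑ = ‖x‖ₑ := by
    rw [← ofReal_norm, ContinuousLinearMap.norm_toSpanSingleton, ofReal_norm]
  have h4 : ‖ContinuousLinearMap.toSpanSingleton ℂ (A x)‖ₑ = ‖A x‖ₑ := by
    rw [← ofReal_norm, ContinuousLinearMap.norm_toSpanSingleton, ofReal_norm]
  have h5 : schattenTrace p.toReal A = ENNReal.ofReal (schattenNorm p A) ^ p.toReal := by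
    rw [ofReal_schattenNorm hpt h, one_div, ENNReal.rpow_inv_rpow hp0.ne']
  rw [h3, h4, h5, ← ENNReal.mul_rpow_of_nonneg _ _ hp0.le, ENNReal.rpow_le_rpow_iff hp0,
    ← ofReal_norm, ← ofReal_norm, ← ENNReal.ofReal_mul (norm_nonneg _),
    ← ENNReal.ofReal_mul (norm_nonneg _), ← ENNReal.ofReal_mul (by positivity),
    ENNReal.ofReal_le_ofReal_iff
      (mul_nonneg (by positivity) (schattenNorm_nonneg _ _))] at h1
  rcases (norm_nonneg (A x)).eq_or_lt with h0 | h0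
  · rw [← h0]
    exact mul_nonneg (schattenNorm_nonneg _ _) (norm_nonneg _)
  · refine le_of_mul_le_mul_left ?_ h0
    linarith

/-- The Schatten classes increase and their norms decrease with the exponent. -/
theorem MemSchatten.mono {p q : ℝ≥0∞} (hp : 1 ≤ p) (hpq : p ≤ q) {A : E →L[ℂ] F}
    (h : MemSchatten p A) : MemSchatten q A ∧ schattenNorm q A ≤ schattenNorm p A := by
  by_cases hq : q = ∞
  · subst hq
    refine ⟨by simpa [MemSchatten] using h.compact hp, ?_⟩
    simpa [schattenNorm] using opNorm_le_schattenNorm hp h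
  have hpt : p ≠ ∞ := ne_top_of_le_ne_top hq hpq
  have hp0 : 0 < p.toReal := by linarith [one_le_toReal hp hpt]
  have hpq' : p.toReal ≤ q.toReal := ENNReal.toReal_mono hq hpq
  obtain ⟨ι, e, he⟩ := exists_basis_schattenTrace_eq A (h.compact hp)
  have h1 := tsum_rpow_le_rpow_tsum (fun i => ‖A (e i)‖ₑ) hp0 hpq'
  rw [← he _ hp0, ← he _ (hp0.trans_le hpq')] at h1
  have hfin : schattenTrace p.toReal A < ∞ := by rwa [MemSchatten, if_neg hpt] at h
  have h2 : MemSchatten q A := by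
    rw [MemSchatten, if_neg hq]
    exact h1.trans_lt (ENNReal.rpow_lt_top_of_nonneg (by positivity) hfin.ne)
  refine ⟨h2, ?_⟩
  rw [← ENNReal.ofReal_le_ofReal_iff (schattenNorm_nonneg _ _), ofReal_schattenNorm hpt h,
    ofReal_schattenNorm hq h2]
  calc _ ≤ (schattenTrace p.toReal A ^ (q.toReal / p.toReal)) ^ (1 / q.toReal) := by gcongr
    _ = _ := by
      rw [← ENNReal.rpow_mul]
      congr 1
      field_simp [(hp0.trans_le hpq').ne']

theorem memSchatten_id_complex {p : ℝ≥0∞} (hp : 1 ≤ p) :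
    MemSchatten p (ContinuousLinearMap.id ℂ ℂ) := by
  refine (MemSchatten.mono le_rfl hp ?_).1
  rw [MemSchatten, if_neg ENNReal.one_ne_top, ENNReal.toReal_one]
  have hc : IsCompactOperator (ContinuousLinearMap.id ℂ ℂ) :=
    isCompactOperator_of_locallyCompactSpace_dom _
  obtain ⟨ι, e, he⟩ := exists_basis_schattenTrace_eq _ hc
  rw [he 1 one_pos]
  have : Finite ι := e.orthonormal.linearIndependent.finite
  have := Fintype.ofFinite ι
  rw [tsum_fintype]
  refine ENNReal.sum_lt_top.2 fun i _ => ?_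
  rw [ENNReal.rpow_one]
  exact enorm_lt_top

theorem memSchatten_toSpanSingleton_comp {p : ℝ≥0∞} (hp : 1 ≤ p) (v : F) (φ : E →L[ℂ] ℂ) :
    MemSchatten p (ContinuousLinearMap.toSpanSingleton ℂ v ∘L φ) :=
  (memSchatten_id_complex hp).comp hp (ContinuousLinearMap.toSpanSingleton ℂ v) φ

/-- The trace of the rank one operator `y ↦ ⟪x, y⟫ v`. -/
theorem operatorTrace_toSpanSingleton_comp (x v : E) :
    operatorTrace (ContinuousLinearMap.toSpanSingleton ℂ v ∘L innerSL ℂ x) = ⟪x, v⟫_ℂ := by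
  have h := (basis E).hasSum_inner_mul_inner x v
  rw [operatorTrace, ← h.tsum_eq]
  refine tsum_congr fun i => ?_
  rw [ContinuousLinearMap.comp_apply, ContinuousLinearMap.toSpanSingleton_apply, inner_smul_right]
  rfl

/-- Schatten norms are lower semicontinuous for the operator norm. -/
theorem MemSchatten.of_tendsto {p : ℝ≥0∞} (hp : 1 ≤ p) {A : ℕ → E →L[ℂ] F} {B : E →L[ℂ] F}
    {c : ℝ} (hA : ∀ᶠ n in Filter.atTop, MemSchatten p (A n) ∧ schattenNorm p (A n) ≤ c)
    (hB : Filter.Tendsto A Filter.atTop (nhds B)) : MemSchatten p B ∧ schattenNorm p B ≤ c := by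
  have hc0 : 0 ≤ c := by
    obtain ⟨n, hn⟩ := hA.exists
    exact (schattenNorm_nonneg _ _).trans hn.2
  have hcpt : IsCompactOperator B := by
    have hcl := isClosed_setOfPred_isCompactOperator (σ₁₂ := RingHom.id ℂ) (M₁ := E) (M₂ := F)
    exact hcl.mem_of_tendsto hB (hA.mono fun n hn => hn.1.compact hp)
  by_cases hpt : p = ∞
  · subst hpt
    refine ⟨by simpa [MemSchatten] using hcpt, ?_⟩
    simp only [schattenNorm, if_true] at hA ⊢
    exact le_of_tendsto hB.norm (hA.mono fun n hn => hn.2)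
  have hp1 := one_le_toReal hp hpt
  have hp0 : 0 < p.toReal := by linarith
  -- a sum of norms of matrix coefficients computes the trace for `B` and bounds it from below for
  -- every `A n`
  obtain ⟨ι, f, Y, hY, he⟩ := exists_trace_eq B hcpt hp0
  have h1 : schattenTrace p.toReal B ≤ ENNReal.ofReal c ^ p.toReal := by
    rw [he, ENNReal.tsum_eq_iSup_sum]
    refine iSup_le fun s => ?_
    have h2 : Filter.Tendsto (fun n => ∑ i ∈ s, ‖⟪Y (f i), A n (f i)⟫_ℂ‖ₑ ^ p.toReal) Filter.atTop
        (nhds (∑ i ∈ s, ‖⟪Y (f i), B (f i)⟫_ℂ‖ₑ ^ p.toReal)) := by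
      refine tendsto_finsetSum s fun i _ => ?_
      refine (ENNReal.continuous_rpow_const.tendsto _).comp ?_
      refine (continuous_enorm.tendsto _).comp ?_
      have h3 : Continuous fun T : E →L[ℂ] F => ⟪Y (f i), T (f i)⟫_ℂ := by fun_prop
      exact (h3.tendsto B).comp hB
    refine le_of_tendsto h2 (hA.mono fun n hn => ?_)
    calc _ ≤ ∑' i, ‖⟪Y (f i), A n (f i)⟫_ℂ‖ₑ ^ p.toReal := ENNReal.sum_le_tsum s
      _ ≤ schattenTrace p.toReal (A n) := sum_inner_le (A n) hp1 f (ContinuousLinearMap.id ℂ E) Y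
          ContinuousLinearMap.norm_id_le hY
      _ = ENNReal.ofReal (schattenNorm p (A n)) ^ p.toReal := by
          rw [ofReal_schattenNorm hpt hn.1, one_div, ENNReal.rpow_inv_rpow hp0.ne']
      _ ≤ _ := by
          gcongr
          exact hn.2
  have h2 : MemSchatten p B := by
    rw [MemSchatten, if_neg hpt]
    exact h1.trans_lt (ENNReal.rpow_lt_top_of_nonneg hp0.le ENNReal.ofReal_ne_top)
  refine ⟨h2, ?_⟩
  rw [← ENNReal.ofReal_le_ofReal_iff hc0, ofReal_schattenNorm hpt h2, one_div]
  exact (ENNReal.rpow_inv_le_iff hp0).2 h1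

end SchattenHolder

section Cayley

open scoped Manifold ContDiff Topology
open Topology Manifold

variable {𝔸 : Type u} [NormedRing 𝔸] [NormedAlgebra ℝ 𝔸]

/-! ### The Cayley transform of a Banach algebra -/

/-- The Cayley transform `x ↦ (x - 1) (1 + x)⁻¹`, meaningful where `1 + x` is invertible. -/
noncomputable def cayley (x : 𝔸) : 𝔸 := (x - 1) * Ring.inverse (1 + x)

/-- The inverse Cayley transform `y ↦ (1 + y) (1 - y)⁻¹`, meaningful where `1 - y` is invertible. -/
noncomputable def cayleyInv (y : 𝔸) : 𝔸 := (1 + y) * Ring.inverse (1 - y)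

variable (𝔸) in
theorem isUnit_two_of_real : IsUnit (2 : 𝔸) := by
  have h := (isUnit_iff_ne_zero.2 (two_ne_zero : (2 : ℝ) ≠ 0)).map (algebraMap ℝ 𝔸)
  rwa [map_ofNat] at h

theorem one_sub_cayley {x : 𝔸} (hx : IsUnit (1 + x)) :
    1 - cayley x = 2 * Ring.inverse (1 + x) := by
  have h := Ring.mul_inverse_cancel _ hx
  calc 1 - cayley x = (1 + x) * Ring.inverse (1 + x) - (x - 1) * Ring.inverse (1 + x) := by
        rw [h, cayley]
    _ = _ := by rw [← sub_mul]; congr 1; rw [← one_add_one_eq_two]; abel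

theorem one_add_cayleyInv {y : 𝔸} (hy : IsUnit (1 - y)) :
    1 + cayleyInv y = 2 * Ring.inverse (1 - y) := by
  have h := Ring.mul_inverse_cancel _ hy
  calc 1 + cayleyInv y = (1 - y) * Ring.inverse (1 - y) + (1 + y) * Ring.inverse (1 - y) := by
        rw [h, cayleyInv]
    _ = _ := by rw [← add_mul]; congr 1; rw [← one_add_one_eq_two]; abel

theorem isUnit_one_sub_cayley {x : 𝔸} (hx : IsUnit (1 + x)) : IsUnit (1 - cayley x) := by
  rw [one_sub_cayley hx]
  exact (isUnit_two_of_real 𝔸).mul hx.ringInverse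

theorem isUnit_one_add_cayleyInv {y : 𝔸} (hy : IsUnit (1 - y)) : IsUnit (1 + cayleyInv y) := by
  rw [one_add_cayleyInv hy]
  exact (isUnit_two_of_real 𝔸).mul hy.ringInverse

theorem cayleyInv_cayley {x : 𝔸} (hx : IsUnit (1 + x)) : cayleyInv (cayley x) = x := by
  have h1 : 1 + cayley x = x * (1 - cayley x) := by
    rw [one_sub_cayley hx]
    calc 1 + cayley x = (1 + x) * Ring.inverse (1 + x) + (x - 1) * Ring.inverse (1 + x) := by
          rw [Ring.mul_inverse_cancel _ hx, cayley]
      _ = _ := by noncomm_ring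
  rw [cayleyInv, h1, mul_assoc, Ring.mul_inverse_cancel _ (isUnit_one_sub_cayley hx), mul_one]

theorem cayley_cayleyInv {y : 𝔸} (hy : IsUnit (1 - y)) : cayley (cayleyInv y) = y := by
  have h1 : cayleyInv y - 1 = y * (1 + cayleyInv y) := by
    rw [one_add_cayleyInv hy]
    calc cayleyInv y - 1 = (1 + y) * Ring.inverse (1 - y) - (1 - y) * Ring.inverse (1 - y) := by
          rw [Ring.mul_inverse_cancel _ hy, cayleyInv]
      _ = _ := by noncomm_ring
  rw [cayley, h1, mul_assoc, Ring.mul_inverse_cancel _ (isUnit_one_add_cayleyInv hy), mul_one]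

variable [CompleteSpace 𝔸]

theorem contDiffAt_ringInverse_of_isUnit {n : ℕ∞ω} {x : 𝔸} (hx : IsUnit x) :
    ContDiffAt ℝ n Ring.inverse x := by
  obtain ⟨u, rfl⟩ := hx
  exact contDiffAt_ringInverse ℝ u

theorem contDiffAt_cayley {E : Type*} [NormedAddCommGroup E] [NormedSpace ℝ E] {n : ℕ∞ω}
    {f : E → 𝔸} {x : E} (hf : ContDiffAt ℝ n f x) (hx : IsUnit (1 + f x)) :
    ContDiffAt ℝ n (fun y => cayley (f y)) x :=
  (hf.sub contDiffAt_const).mul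
    (ContDiffAt.comp x (g := Ring.inverse) (contDiffAt_ringInverse_of_isUnit hx)
      (contDiffAt_const.add hf))

theorem contDiffAt_cayleyInv {E : Type*} [NormedAddCommGroup E] [NormedSpace ℝ E] {n : ℕ∞ω}
    {f : E → 𝔸} {x : E} (hf : ContDiffAt ℝ n f x) (hx : IsUnit (1 - f x)) :
    ContDiffAt ℝ n (fun y => cayleyInv (f y)) x :=
  (contDiffAt_const.add hf).mul
    (ContDiffAt.comp x (g := Ring.inverse) (contDiffAt_ringInverse_of_isUnit hx)
      (contDiffAt_const.sub hf))

theorem continuousAt_cayley {x : 𝔸} (hx : IsUnit (1 + x)) : ContinuousAt cayley x :=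
  (contDiffAt_cayley (n := 0) contDiffAt_id hx).continuousAt

/-- The chart `x ↦ cayley (u⁻¹ x)` of a Banach algebra around a unit `u`. -/
noncomputable def cayleyChartAlgebra (u : 𝔸ˣ) : OpenPartialHomeomorph 𝔸 𝔸 where
  toFun x := cayley (↑u⁻¹ * x)
  invFun y := u * cayleyInv y
  source := {x | IsUnit (1 + ↑u⁻¹ * x)}
  target := {y | IsUnit (1 - y)}
  map_source' _ hx := isUnit_one_sub_cayley hx
  map_target' y hy := by
    change IsUnit (1 + ↑u⁻¹ * (↑u * cayleyInv y))
    rw [Units.inv_mul_cancel_left]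
    exact isUnit_one_add_cayleyInv hy
  left_inv' x hx := by rw [cayleyInv_cayley hx, Units.mul_inv_cancel_left]
  right_inv' y hy := by rw [Units.inv_mul_cancel_left, cayley_cayleyInv hy]
  open_source := Units.isOpen.preimage (by fun_prop)
  open_target := Units.isOpen.preimage (by fun_prop)
  continuousOn_toFun x hx :=
    (contDiffAt_cayley (n := 0) (contDiffAt_const.mul contDiffAt_id)
      hx).continuousAt.continuousWithinAt
  continuousOn_invFun y hy :=
    (contDiffAt_const.mul
      (contDiffAt_cayleyInv (n := 0) contDiffAt_id hy)).continuousAt.continuousWithinAt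

theorem cayleyChartAlgebra_mem_maximalAtlas (n : ℕ∞ω) (u : 𝔸ˣ) :
    cayleyChartAlgebra u ∈ IsManifold.maximalAtlas 𝓘(ℝ, 𝔸) n 𝔸 := by
  refine (contDiffGroupoid n 𝓘(ℝ, 𝔸)).mem_maximalAtlas_of_mem_groupoid ?_
  rw [contDiffGroupoid, mem_groupoid_of_pregroupoid]
  constructor
  · change ContDiffOn ℝ n (fun x : 𝔸 => cayley (↑u⁻¹ * x : 𝔸))
      ({x : 𝔸 | IsUnit (1 + ↑u⁻¹ * x : 𝔸)} ∩ _)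
    exact fun x hx => (contDiffAt_cayley (contDiffAt_const.mul contDiffAt_id)
      hx.1).contDiffWithinAt
  · change ContDiffOn ℝ n (fun y : 𝔸 => (↑u * cayleyInv y : 𝔸)) ({y : 𝔸 | IsUnit (1 - y)} ∩ _)
    exact fun y hy => (contDiffAt_const.mul
      (contDiffAt_cayleyInv contDiffAt_id hy.1)).contDiffWithinAt

/-! ### Cayley groups are Banach Lie groups -/

variable {G : Type*} [Group G] [TopologicalSpace G] [IsTopologicalGroup G]
  {G' : Type*} [Group G'] [TopologicalSpace G'] [IsTopologicalGroup G']

/-- A topological group `G` embedded by `ι` in the units of a Banach algebra `𝔸` is a Cayley group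
with Lie algebra `V`, a complemented subspace of `𝔸`, if the Cayley transform exchanges `G` and `V`
as far as it is defined. -/
structure IsCayleyGroup (ι : G →* 𝔸) (V : Submodule ℝ 𝔸) : Prop where
  isEmbedding : IsEmbedding ι
  closedComplemented : V.ClosedComplemented
  cayley_mem : ∀ g, IsUnit (1 + ι g) → cayley (ι g) ∈ V
  exists_eq_cayleyInv : ∀ y ∈ V, IsUnit (1 - y) → ∃ g, ι g = cayleyInv y

namespace IsCayleyGroup

variable {ι : G →* 𝔸} {V : Submodule ℝ 𝔸} (h : IsCayleyGroup ι V)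
  {κ : G' →* 𝔸} {W : Submodule ℝ 𝔸} (h' : IsCayleyGroup κ W)

/-- A continuous projection of `𝔸` onto the Lie algebra. -/
noncomputable def proj : 𝔸 →L[ℝ] V := h.closedComplemented.choose

include h in
theorem proj_coe (x : V) : h.proj x = x := h.closedComplemented.choose_spec x

theorem coe_proj {x : 𝔸} (hx : x ∈ V) : (h.proj x : 𝔸) = x :=
  congrArg Subtype.val (h.proj_coe ⟨x, hx⟩)

open Classical in
/-- The inverse Cayley transform as a map from the Lie algebra to the group; its value is `1` where
the transform is not defined. -/
noncomputable def toGroup (y : V) : G :=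
  if hy : IsUnit (1 - (y : 𝔸)) then (h.exists_eq_cayleyInv y y.2 hy).choose else 1

theorem map_toGroup {y : V} (hy : IsUnit (1 - (y : 𝔸))) : ι (h.toGroup y) = cayleyInv (y : 𝔸) := by
  rw [toGroup, dif_pos hy]
  exact (h.exists_eq_cayleyInv y y.2 hy).choose_spec

/-- The chart `g ↦ cayley (a⁻¹ g)` of a Cayley group around `a`. -/
noncomputable def chart (a : G) : OpenPartialHomeomorph G V where
  toFun g := h.proj (cayley (ι (a⁻¹ * g)))
  invFun y := a * h.toGroup y
  source := {g | IsUnit (1 + ι (a⁻¹ * g))}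
  target := {y | IsUnit (1 - (y : 𝔸))}
  map_source' g hg := by
    change IsUnit (1 - (h.proj (cayley (ι (a⁻¹ * g))) : 𝔸))
    rw [h.coe_proj (h.cayley_mem _ hg)]
    exact isUnit_one_sub_cayley hg
  map_target' y hy := by
    change IsUnit (1 + ι (a⁻¹ * (a * h.toGroup y)))
    rw [inv_mul_cancel_left, h.map_toGroup hy]
    exact isUnit_one_add_cayleyInv hy
  left_inv' g hg := by
    have h1 : IsUnit (1 - (h.proj (cayley (ι (a⁻¹ * g))) : 𝔸)) := by
      rw [h.coe_proj (h.cayley_mem _ hg)]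
      exact isUnit_one_sub_cayley hg
    have h2 : h.toGroup (h.proj (cayley (ι (a⁻¹ * g)))) = a⁻¹ * g := by
      apply h.isEmbedding.injective
      rw [h.map_toGroup h1, h.coe_proj (h.cayley_mem _ hg), cayleyInv_cayley hg]
    rw [h2, mul_inv_cancel_left]
  right_inv' y hy := by
    rw [inv_mul_cancel_left, h.map_toGroup hy, cayley_cayleyInv hy, h.proj_coe]
  open_source := Units.isOpen.preimage
    (continuous_const.add (h.isEmbedding.continuous.comp (continuous_const_mul _)))
  open_target := Units.isOpen.preimage (by fun_prop)
  continuousOn_toFun g hg :=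
    ((h.proj.continuous.continuousAt.comp (continuousAt_cayley hg)).comp
      (f := fun g => ι (a⁻¹ * g))
      (h.isEmbedding.continuous.comp (continuous_const_mul _)).continuousAt).continuousWithinAt
  continuousOn_invFun := by
    rw [h.isEmbedding.continuousOn_iff]
    have h1 : ContinuousOn (fun y : V => ι a * cayleyInv (y : 𝔸)) {y | IsUnit (1 - (y : 𝔸))} :=
      fun y hy => (contDiffAt_const.mul (contDiffAt_cayleyInv (n := 0)
        V.subtypeL.contDiff.contDiffAt hy)).continuousAt.continuousWithinAt
    refine h1.congr fun y hy => ?_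
    rw [Function.comp_apply, map_mul, h.map_toGroup hy]

omit [IsTopologicalGroup G'] in
theorem coe_chart {a g : G} (hg : g ∈ (h.chart a).source) :
    (h.chart a g : 𝔸) = cayley (ι (a⁻¹ * g)) :=
  h.coe_proj (h.cayley_mem _ hg)

theorem mem_chart_source (a : G) : a ∈ (h.chart a).source := by
  change IsUnit (1 + ι (a⁻¹ * a))
  rw [inv_mul_cancel, map_one, one_add_one_eq_two]
  exact isUnit_two_of_real 𝔸

/-- The manifold structure of a Cayley group, with the translated Cayley transforms as charts. -/
noncomputable abbrev chartedSpace : ChartedSpace V G where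
  atlas := Set.range h.chart
  chartAt := h.chart
  mem_chart_source := h.mem_chart_source
  chart_mem_atlas a := ⟨a, rfl⟩

theorem isManifold (n : ℕ∞ω) :
    letI := h.chartedSpace
    IsManifold 𝓘(ℝ, V) n G := by
  let := h.chartedSpace
  refine isManifold_of_contDiffOn _ _ _ ?_
  rintro _ _ ⟨a, rfl⟩ ⟨b, rfl⟩ y hy
  have hya : IsUnit (1 - (y : 𝔸)) := hy.1.1
  have hyb : IsUnit (1 + ι (b⁻¹ * (a * h.toGroup y))) := hy.1.2
  have hval : ContDiffAt ℝ n (fun y : V => (y : 𝔸)) y := V.subtypeL.contDiff.contDiffAt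
  rw [map_mul, map_mul, h.map_toGroup hya] at hyb
  have h1 : ContDiffAt ℝ n (fun y : V => h.proj (cayley (ι b⁻¹ * (ι a * cayleyInv (y : 𝔸))))) y :=
    h.proj.contDiff.contDiffAt.comp y (contDiffAt_cayley
      (contDiffAt_const.mul (contDiffAt_const.mul (contDiffAt_cayleyInv hval hya))) hyb)
  refine h1.contDiffWithinAt.congr (fun z hz => ?_) ?_
  · change h.proj (cayley (ι (b⁻¹ * (a * h.toGroup z)))) = _
    have hza : IsUnit (1 - (z : 𝔸)) := hz.1.1
    rw [map_mul, map_mul, h.map_toGroup hza]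
  · change h.proj (cayley (ι (b⁻¹ * (a * h.toGroup y)))) = _
    rw [map_mul, map_mul, h.map_toGroup hya]

/-- In Cayley charts `ι` is the inclusion of the complemented subspace `V` in `𝔸`. -/
theorem isSmoothEmbedding (n : ℕ∞ω) :
    letI := h.chartedSpace
    IsSmoothEmbedding 𝓘(ℝ, V) 𝓘(ℝ, 𝔸) n ι := by
  let := h.chartedSpace
  have := h.isManifold n
  refine ⟨⟨h.proj.ker, inferInstance, inferInstance, fun a => ?_⟩, h.isEmbedding⟩
  let u : 𝔸ˣ := Units.map ι (toUnits a)
  have hu : ∀ g, (↑u⁻¹ * ι g : 𝔸) = ι (a⁻¹ * g) := fun g => by rw [map_mul]; rfl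
  refine Manifold.IsImmersionAtOfComplement.mk_of_charts
    (ContinuousLinearEquiv.equivOfRightInverse h.proj V.subtypeL h.proj_coe).symm
    (h.chart a) (cayleyChartAlgebra u) (h.mem_chart_source a) ?_
    (IsManifold.subset_maximalAtlas ⟨a, rfl⟩) (cayleyChartAlgebra_mem_maximalAtlas n u) ?_ ?_
  · change IsUnit (1 + ↑u⁻¹ * ι a)
    rw [hu]
    exact h.mem_chart_source a
  · intro g hg
    change IsUnit (1 + ↑u⁻¹ * ι g)
    rw [hu]
    exact hg
  · intro y hy
    have hy1 : y ∈ (h.chart a).target := by simpa using hy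
    change cayley (↑u⁻¹ * ι ((h.chart a).symm y)) = (y : 𝔸) + ((0 : h.proj.ker) : 𝔸)
    rw [hu, ← h.coe_chart ((h.chart a).map_target hy1), (h.chart a).right_inv hy1]
    simp

/-- Multiplication and inversion are smooth because they are so in `𝔸`, and a continuous map into
`G` is smooth if its composition with the immersion `ι` is. -/
theorem lieGroup (n : ℕ∞ω) :
    letI := h.chartedSpace
    LieGroup 𝓘(ℝ, V) n G := by
  let := h.chartedSpace
  have := h.isManifold n
  have hι := h.isSmoothEmbedding n
  refine { contMDiff_mul := ?_, contMDiff_inv := ?_ }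
  · refine (ContMDiff.iff_comp_isImmersion hι.isImmersion).2 ⟨continuous_mul, ?_⟩
    have h1 : ContMDiff (𝓘(ℝ, V).prod 𝓘(ℝ, V)) 𝓘(ℝ, 𝔸) n fun x : G × G => ι x.1 * ι x.2 :=
      contDiff_mul.contMDiff.comp
        ((hι.contMDiff.comp contMDiff_fst).prodMk_space (hι.contMDiff.comp contMDiff_snd))
    refine h1.congr fun x => ?_
    rw [Function.comp_apply, map_mul]
  · refine (ContMDiff.iff_comp_isImmersion hι.isImmersion).2 ⟨continuous_inv, fun a => ?_⟩
    have h1 : ContMDiffAt 𝓘(ℝ, V) 𝓘(ℝ, 𝔸) n (fun g => Ring.inverse (ι g)) a :=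
      (contDiffAt_ringInverse_of_isUnit ((Group.isUnit a).map ι)).contMDiffAt.comp a
        (hι.contMDiff a)
    refine h1.congr_of_eventuallyEq (Filter.Eventually.of_forall fun g => ?_)
    have h2 : ι g = (Units.map ι (toUnits g) : 𝔸ˣ) := rfl
    change ι g⁻¹ = Ring.inverse (ι g)
    rw [h2, Ring.inverse_unit]
    rfl

/-- A group homomorphism between Cayley groups in the same algebra that is compatible with the
embeddings is the inclusion of one Lie algebra in the other, in Cayley charts. -/
theorem isSmoothEmbedding_hom (n : ℕ∞ω) (f : G →* G') (hf : ∀ g, κ (f g) = ι g) (hVW : V ≤ W) :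
    letI := h.chartedSpace
    letI := h'.chartedSpace
    IsSmoothEmbedding 𝓘(ℝ, V) 𝓘(ℝ, W) n f := by
  let := h.chartedSpace
  let := h'.chartedSpace
  have := h.isManifold n
  have := h'.isManifold n
  have hκ : κ ∘ f = ι := funext hf
  have hemb : IsEmbedding f := by
    rw [h'.isEmbedding.of_comp_iff.symm, hκ]
    exact h.isEmbedding
  -- the projection onto `V`, restricted to `W`, splits the inclusion `V ≤ W`
  let i : V →L[ℝ] W := V.subtypeL.codRestrict W fun y => hVW y.2
  let r : W →L[ℝ] V := h.proj ∘L W.subtypeL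
  have hri : Function.RightInverse i r := h.proj_coe
  refine ⟨⟨r.ker, inferInstance, inferInstance, fun a => ?_⟩, hemb⟩
  have hu : ∀ g, κ ((f a)⁻¹ * f g) = ι (a⁻¹ * g) := fun g => by rw [← map_inv, ← map_mul, hf]
  have hsource : ∀ g ∈ (h.chart a).source, f g ∈ (h'.chart (f a)).source := fun g hg => by
    change IsUnit (1 + κ ((f a)⁻¹ * f g))
    rw [hu]
    exact hg
  refine Manifold.IsImmersionAtOfComplement.mk_of_charts
    (ContinuousLinearEquiv.equivOfRightInverse r i hri).symm
    (h.chart a) (h'.chart (f a)) (h.mem_chart_source a) (h'.mem_chart_source (f a))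
    (IsManifold.subset_maximalAtlas ⟨a, rfl⟩) (IsManifold.subset_maximalAtlas ⟨f a, rfl⟩)
    hsource ?_
  intro y hy
  have hy1 : y ∈ (h.chart a).target := by simpa using hy
  have hy2 := (h.chart a).map_target hy1
  apply Subtype.ext
  change (h'.chart (f a) (f ((h.chart a).symm y)) : 𝔸) = (y : 𝔸) + (((0 : r.ker) : W) : 𝔸)
  rw [h'.coe_chart (hsource _ hy2), hu, ← h.coe_chart hy2, (h.chart a).right_inv hy1]
  simp

end IsCayleyGroup

/-! ### Unitary groups and commutants -/

variable [StarRing 𝔸] [NormedStarGroup 𝔸] [StarModule ℝ 𝔸]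

/-- The Cayley transform of a unitary element is skew-adjoint. -/
theorem cayley_mem_skewAdjoint {g : 𝔸} (hg : g ∈ unitary 𝔸) (h : IsUnit (1 + g)) :
    star (cayley g) = -cayley g := by
  have h1 : IsUnit (1 + star g) := by simpa using h.star
  have h2 : (star g - 1) * (1 + g) = -((1 + star g) * (g - 1)) := by
    have h3 := Unitary.star_mul_self_of_mem hg
    simp only [sub_mul, mul_add, add_mul, mul_sub, h3]
    noncomm_ring
  have h4 : star (cayley g) = Ring.inverse (1 + star g) * (star g - 1) := by
    rw [cayley, star_mul, ← Ring.inverse_star]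
    simp
  rw [h4, cayley, ← Ring.mul_inverse_cancel_right (1 + g) (star g - 1) h, h2, neg_mul, mul_neg,
    mul_assoc (1 + star g), Ring.inverse_mul_cancel_left _ _ h1]

theorem cayleyInv_mem_unitary {y : 𝔸} (hy : star y = -y) (h : IsUnit (1 - y)) :
    cayleyInv y ∈ unitary 𝔸 := by
  have h1 : IsUnit (1 + y) := by simpa [hy] using h.star
  have h2 : star (cayleyInv y) = Ring.inverse (1 + y) * (1 - y) := by
    rw [cayleyInv, star_mul, ← Ring.inverse_star]
    simp [hy, sub_eq_add_neg]
  have h3 : Commute (1 - y) (1 + y) := by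
    rw [commute_iff_eq]
    noncomm_ring
  rw [Unitary.mem_iff, h2, cayleyInv]
  constructor
  · rw [mul_assoc, ← mul_assoc (1 - y), h3.eq, mul_assoc, Ring.mul_inverse_cancel _ h, mul_one,
      Ring.inverse_mul_cancel _ h1]
  · rw [mul_assoc, ← mul_assoc (Ring.inverse (1 - y)), h3.ringInverse_ringInverse.eq, mul_assoc,
      Ring.inverse_mul_cancel _ h, mul_one, Ring.mul_inverse_cancel _ h1]

/-- The real subspace of skew-adjoint elements that commute with `d`. -/
def skewCommutant (d : 𝔸) : Submodule ℝ 𝔸 where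
  carrier := {x | star x = -x ∧ d * x = x * d}
  add_mem' := fun {x y} hx hy =>
    ⟨by rw [star_add, hx.1, hy.1, neg_add], by rw [mul_add, add_mul, hx.2, hy.2]⟩
  zero_mem' := ⟨by simp, by simp⟩
  smul_mem' c x hx := ⟨by rw [star_smul, hx.1, smul_neg, star_trivial],
    by rw [mul_smul_comm, smul_mul_assoc, hx.2]⟩

theorem skewCommutant_le (d : 𝔸) : skewCommutant d ≤ skewAdjoint.submodule ℝ 𝔸 :=
  fun _ hx => skewAdjoint.mem_iff.2 hx.1

theorem isClosed_skewCommutant (d : 𝔸) : IsClosed (skewCommutant d : Set 𝔸) :=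
  (isClosed_eq continuous_star continuous_neg).inter
    (isClosed_eq (continuous_const_mul d) (continuous_mul_const d))

/-- The skew-adjoint part `(x - x*) / 2`. -/
noncomputable def skewPartL : 𝔸 →L[ℝ] 𝔸 :=
  (1 / 2 : ℝ) • (ContinuousLinearMap.id ℝ 𝔸 - (starL' ℝ : 𝔸 ≃L[ℝ] 𝔸))

theorem skewPartL_apply (x : 𝔸) : skewPartL x = (1 / 2 : ℝ) • (x - star x) := rfl

theorem star_skewPartL (x : 𝔸) : star (skewPartL x) = -skewPartL x := by
  rw [skewPartL_apply, star_smul, star_sub, star_star, star_trivial, ← smul_neg, neg_sub]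

theorem skewPartL_of_skew {x : 𝔸} (hx : star x = -x) : skewPartL x = x := by
  rw [skewPartL_apply, hx, sub_neg_eq_add, ← two_smul ℝ x, smul_smul]
  norm_num

theorem closedComplemented_skewAdjoint : (skewAdjoint.submodule ℝ 𝔸).ClosedComplemented :=
  ⟨skewPartL.codRestrict _ fun x => skewAdjoint.mem_iff.2 (star_skewPartL x),
    fun x => Subtype.ext (skewPartL_of_skew (skewAdjoint.mem_iff.1 x.2))⟩

/-- A skew-adjoint complex structure `d` splits off the part `(x - d x d) / 2` of `x` that commutes
with `d`. -/
theorem closedComplemented_skewCommutant {d : 𝔸} (hd : d * d = -1) (hd' : star d = -d) :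
    (skewCommutant d).ClosedComplemented := by
  let D : 𝔸 →L[ℝ] 𝔸 := (1 / 2 : ℝ) • (ContinuousLinearMap.id ℝ 𝔸 -
    (ContinuousLinearMap.mul ℝ 𝔸 d) ∘L (ContinuousLinearMap.mul ℝ 𝔸).flip d)
  have hD : ∀ x, D x = (1 / 2 : ℝ) • (x - d * (x * d)) := fun x => rfl
  have hcomm : ∀ x, d * D x = D x * d := fun x => by
    rw [hD, mul_smul_comm, smul_mul_assoc, mul_sub, sub_mul, ← mul_assoc d d, hd, mul_assoc,
      mul_assoc x, hd]
    congr 1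
    noncomm_ring
  have hskew : ∀ x, d * skewPartL (D x) = skewPartL (D x) * d := fun x => by
    have h1 : d * star (D x) = star (D x) * d := by
      have h2 := congrArg star (hcomm x)
      rw [star_mul, star_mul, hd', mul_neg, neg_mul, neg_inj] at h2
      exact h2.symm
    rw [skewPartL_apply, mul_smul_comm, smul_mul_assoc, mul_sub, sub_mul, hcomm, h1]
  refine ⟨(skewPartL ∘L D).codRestrict _ fun x => ⟨star_skewPartL _, hskew x⟩, fun x => ?_⟩
  apply Subtype.ext
  have h3 : D x = x := by
    rw [hD, ← x.2.2, ← mul_assoc, hd, neg_one_mul, sub_neg_eq_add, ← two_smul ℝ (x : 𝔸), smul_smul]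
    norm_num
  change skewPartL (D x) = x
  rw [h3, skewPartL_of_skew x.2.1]

theorem isCayleyGroup_unitary :
    IsCayleyGroup (unitary 𝔸).subtype (skewAdjoint.submodule ℝ 𝔸) where
  isEmbedding := IsEmbedding.subtypeVal
  closedComplemented := closedComplemented_skewAdjoint
  cayley_mem g hg := skewAdjoint.mem_iff.2 (cayley_mem_skewAdjoint g.2 hg)
  exists_eq_cayleyInv y hy h :=
    ⟨⟨cayleyInv y, cayleyInv_mem_unitary (skewAdjoint.mem_iff.1 hy) h⟩, rfl⟩

/-- The unitaries that commute with a skew-adjoint complex structure `d` form a Cayley group. -/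
theorem isCayleyGroup_unitary_commutant {d : 𝔸} (hd : d * d = -1) (hd' : star d = -d)
    {S : Subgroup (unitary 𝔸)} (hS : ∀ g, g ∈ S ↔ d * (g : 𝔸) = g * d) :
    IsCayleyGroup ((unitary 𝔸).subtype.comp S.subtype) (skewCommutant d) where
  isEmbedding := IsEmbedding.subtypeVal.comp IsEmbedding.subtypeVal
  closedComplemented := closedComplemented_skewCommutant hd hd'
  cayley_mem g hg := by
    refine ⟨cayley_mem_skewAdjoint g.1.2 hg, ?_⟩
    have h1 : Commute d (g.1 : 𝔸) := (hS g.1).1 g.2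
    obtain ⟨u, hu⟩ := hg
    have hu' : (u : 𝔸) = 1 + (g.1 : 𝔸) := hu
    have h2 : Commute d (Ring.inverse (1 + (g.1 : 𝔸))) := by
      rw [← hu', Ring.inverse_unit]
      refine Commute.units_inv_right ?_
      rw [hu']
      exact (Commute.one_right d).add_right h1
    exact ((h1.sub_right (Commute.one_right d)).mul_right h2).eq
  exists_eq_cayleyInv y hy h := by
    have h1 : Commute d y := hy.2
    have h2 : Commute d (Ring.inverse (1 - y)) := by
      obtain ⟨u, hu⟩ := h
      rw [← hu, Ring.inverse_unit]
      refine Commute.units_inv_right ?_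
      rw [hu]
      exact (Commute.one_right d).sub_right h1
    have h3 : (⟨cayleyInv y, cayleyInv_mem_unitary hy.1 h⟩ : unitary 𝔸) ∈ S :=
      (hS _).2 (((Commute.one_right d).add_right h1).mul_right h2).eq
    exact ⟨⟨_, h3⟩, rfl⟩

end Cayley

section RestrictedOperators

variable {H : Type u} [NormedAddCommGroup H] [InnerProductSpace ℂ H] [CompleteSpace H]
  (K : Submodule ℂ H) [CompleteSpace K]

/-! ### The polarization and its anticommutator -/

theorem decomp_apply (x : H) :
    (K.orthogonalProjectionOnto x : H) + Kᗮ.orthogonalProjectionOnto x = x :=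
  Submodule.starProjection_add_starProjection_orthogonal x

theorem polarization_mul_self : polarization K * polarization K = -1 := by
  ext x
  rw [← decomp_apply K x]
  simp only [mul_apply_eq_comp, map_add, map_neg, map_smul, Predual.polarization_of_mem,
    Predual.polarization_of_mem_orthogonal, smul_neg, neg_neg, smul_smul, Complex.I_mul_I]
  simp [add_comm]

theorem norm_polarization_le : ‖polarization K‖ ≤ 1 := by
  have h1 : ‖polarization K‖ * ‖polarization K‖ = ‖(1 : H →L[ℂ] H)‖ := by
    rw [← CStarRing.norm_star_mul_self, polarization_star, neg_mul, polarization_mul_self, neg_neg]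
  have h2 : ‖(1 : H →L[ℂ] H)‖ ≤ 1 := ContinuousLinearMap.norm_id_le
  nlinarith [norm_nonneg (polarization K)]

theorem dComm_polarization : dComm K (polarization K) = 0 := sub_self _

/-- The anticommutator `d A + A d`, which is `2 d` times the block diagonal part of `A`. -/
noncomputable def aComm (A : H →L[ℂ] H) : H →L[ℂ] H :=
  polarization K * A + A * polarization K

theorem aComm_mul (A B : H →L[ℂ] H) :
    aComm K (A * B) = dComm K A * B + A * aComm K B := by
  simp only [aComm, dComm]; noncomm_ring

theorem aComm_mul' (A B : H →L[ℂ] H) :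
    aComm K (A * B) = aComm K A * B - A * dComm K B := by
  simp only [aComm, dComm]; noncomm_ring

/-- `A` is recovered from its commutator and its anticommutator with `d`, as their sum is
`2 d A`. -/
theorem eq_smul_aComm_add_dComm (A : H →L[ℂ] H) :
    A = (-(1 / 2) : ℂ) • (polarization K * (aComm K A + dComm K A)) := by
  have h1 : polarization K * (aComm K A + dComm K A) = (-2 : ℂ) • A := by
    have h2 : aComm K A + dComm K A = (2 : ℂ) • (polarization K * A) := by
      simp only [aComm, dComm, two_smul]; noncomm_ring
    rw [h2, mul_smul_comm, ← mul_assoc, polarization_mul_self, neg_one_mul, smul_neg, neg_smul]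
  rw [h1, smul_smul]
  norm_num

theorem block_aComm_plus (A : H →L[ℂ] H) :
    block K K (aComm K A) = (2 * Complex.I) • block K K A := by
  ext x : 1
  simp only [block, aComm, ContinuousLinearMap.comp_apply, smul_apply, add_apply,
    mul_apply_eq_comp, Submodule.subtypeL_apply, map_add, Predual.proj_polarization,
    Predual.polarization_of_mem, map_smul]
  module

theorem block_aComm_minus (A : H →L[ℂ] H) :
    block Kᗮ Kᗮ (aComm K A) = (-(2 * Complex.I)) • block Kᗮ Kᗮ A := by
  ext x : 1
  simp only [block, aComm, ContinuousLinearMap.comp_apply, smul_apply, add_apply,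
    mul_apply_eq_comp, Submodule.subtypeL_apply, map_add, Predual.proj_orthogonal_polarization,
    Predual.polarization_of_mem_orthogonal, map_smul, map_neg]
  module

theorem block_dComm_right (A : H →L[ℂ] H) :
    block Kᗮ K (dComm K A) = (2 * Complex.I) • block Kᗮ K A := by
  ext x : 1
  simp only [block, dComm, ContinuousLinearMap.comp_apply, smul_apply, sub_apply,
    mul_apply_eq_comp, Submodule.subtypeL_apply, map_sub, Predual.proj_polarization,
    Predual.polarization_of_mem_orthogonal, map_smul, map_neg]
  module

theorem block_dComm_left (A : H →L[ℂ] H) :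
    block K Kᗮ (dComm K A) = (-(2 * Complex.I)) • block K Kᗮ A := by
  ext x : 1
  simp only [block, dComm, ContinuousLinearMap.comp_apply, smul_apply, sub_apply,
    mul_apply_eq_comp, Submodule.subtypeL_apply, map_sub, Predual.proj_orthogonal_polarization,
    Predual.polarization_of_mem, map_smul]
  module

theorem polarization_eq_smul : polarization K = Complex.I • ((2 : ℂ) • K.starProjection - 1) := by
  rw [polarization, Submodule.starProjection_orthogonal', two_smul]
  congr 1
  abel

/-- The operator on `H` that has `T` as its block `L → M` and is zero elsewhere. -/
noncomputable def extendBlock (L M : Submodule ℂ H) [CompleteSpace L] (T : L →L[ℂ] M) :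
    H →L[ℂ] H :=
  M.subtypeL ∘L T ∘L L.orthogonalProjectionOnto

theorem aComm_eq_extendBlock (A : H →L[ℂ] H) :
    aComm K A = (2 * Complex.I) • (extendBlock K K (block K K A) -
      extendBlock Kᗮ Kᗮ (block Kᗮ Kᗮ A)) := by
  have h1 : Kᗮ.starProjection = 1 - K.starProjection := Submodule.starProjection_orthogonal' K
  have h2 : extendBlock K K (block K K A) = K.starProjection * A * K.starProjection := rfl
  have h3 : extendBlock Kᗮ Kᗮ (block Kᗮ Kᗮ A) = Kᗮ.starProjection * A * Kᗮ.starProjection := rfl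
  have h4 : ((2 : ℂ) • K.starProjection - 1) * A + A * ((2 : ℂ) • K.starProjection - 1) =
      (2 : ℂ) • (K.starProjection * A * K.starProjection -
        (1 - K.starProjection) * A * (1 - K.starProjection)) := by
    simp only [two_smul]
    noncomm_ring
  rw [h2, h3, h1, aComm, polarization_eq_smul, smul_mul_assoc, mul_smul_comm, ← smul_add, h4,
    smul_smul, mul_comm]

theorem dComm_eq_extendBlock (A : H →L[ℂ] H) :
    dComm K A = (2 * Complex.I) • (extendBlock Kᗮ K (block Kᗮ K A) -
      extendBlock K Kᗮ (block K Kᗮ A)) := by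
  have h1 : Kᗮ.starProjection = 1 - K.starProjection := Submodule.starProjection_orthogonal' K
  have h2 : extendBlock Kᗮ K (block Kᗮ K A) = K.starProjection * A * Kᗮ.starProjection := rfl
  have h3 : extendBlock K Kᗮ (block K Kᗮ A) = Kᗮ.starProjection * A * K.starProjection := rfl
  have h4 : ((2 : ℂ) • K.starProjection - 1) * A - A * ((2 : ℂ) • K.starProjection - 1) =
      (2 : ℂ) • (K.starProjection * A * (1 - K.starProjection) -
        (1 - K.starProjection) * A * K.starProjection) := by
    simp only [two_smul]
    noncomm_ring
  rw [h2, h3, h1, dComm, polarization_eq_smul, smul_mul_assoc, mul_smul_comm, ← smul_sub, h4,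
    smul_smul, mul_comm]

variable {K}

theorem norm_two_mul_I : ‖(2 * Complex.I : ℂ)‖ = 2 := by simp

theorem MemSchatten.block {r : ℝ≥0∞} (hr : 1 ≤ r) {A : H →L[ℂ] H} (h : MemSchatten r A)
    (L M : Submodule ℂ H) [CompleteSpace L] [CompleteSpace M] :
    MemSchatten r (block L M A) ∧ schattenNorm r (block L M A) ≤ schattenNorm r A := by
  refine ⟨h.comp hr _ _, (schattenNorm_comp_le hr h _ _).trans ?_⟩
  have h1 : ‖M.orthogonalProjectionOnto‖ ≤ 1 := Submodule.orthogonalProjectionOnto_norm_le M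
  have h2 : ‖L.subtypeL‖ ≤ 1 := Submodule.norm_subtypeL_le L
  have h3 := schattenNorm_nonneg r A
  calc _ ≤ 1 * schattenNorm r A * 1 := by gcongr
    _ = _ := by ring

theorem MemSchatten.extendBlock {r : ℝ≥0∞} (hr : 1 ≤ r) {L M : Submodule ℂ H} [CompleteSpace L]
    [CompleteSpace M] {T : L →L[ℂ] M} (h : MemSchatten r T) :
    MemSchatten r (extendBlock L M T) ∧ schattenNorm r (extendBlock L M T) ≤ schattenNorm r T := by
  refine ⟨h.comp hr _ _, (schattenNorm_comp_le hr h _ _).trans ?_⟩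
  have h1 : ‖L.orthogonalProjectionOnto‖ ≤ 1 := Submodule.orthogonalProjectionOnto_norm_le L
  have h2 : ‖M.subtypeL‖ ≤ 1 := Submodule.norm_subtypeL_le M
  have h3 := schattenNorm_nonneg r T
  calc _ ≤ 1 * schattenNorm r T * 1 := by gcongr
    _ = _ := by ring

theorem MemSchatten.of_smul {r : ℝ≥0∞} (hr : 1 ≤ r) {E F : Type*} [NormedAddCommGroup E]
    [InnerProductSpace ℂ E] [CompleteSpace E] [NormedAddCommGroup F] [InnerProductSpace ℂ F]
    [CompleteSpace F] {A : E →L[ℂ] F} {c : ℂ} (hc : c ≠ 0) (h : MemSchatten r (c • A)) :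
    MemSchatten r A ∧ schattenNorm r A ≤ ‖c‖⁻¹ * schattenNorm r (c • A) := by
  have h1 := h.smul hr c⁻¹
  have h2 := schattenNorm_smul_le hr h c⁻¹
  rw [inv_smul_smul₀ hc] at h1 h2
  rw [norm_inv] at h2
  exact ⟨h1, h2⟩

theorem MemSchatten.sub {r : ℝ≥0∞} (hr : 1 ≤ r) {E F : Type*} [NormedAddCommGroup E]
    [InnerProductSpace ℂ E] [CompleteSpace E] [NormedAddCommGroup F] [InnerProductSpace ℂ F]
    [CompleteSpace F] {A B : E →L[ℂ] F} (hA : MemSchatten r A) (hB : MemSchatten r B) :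
    MemSchatten r (A - B) ∧ schattenNorm r (A - B) ≤ schattenNorm r A + schattenNorm r B := by
  have h1 : A - B = A + (-1 : ℂ) • B := by rw [neg_one_smul, sub_eq_add_neg]
  have h2 := schattenNorm_smul_le hr hB (-1)
  rw [norm_neg, norm_one, one_mul] at h2
  rw [h1]
  exact ⟨hA.add hr (hB.smul hr _), (schattenNorm_add_le hr hA (hB.smul hr _)).trans (by gcongr)⟩

/-! ### Operators with trace class diagonal and `q`-summable off-diagonal blocks -/

variable (K) in
/-- `X` has block diagonal part in `L_1` and off-diagonal part in `L_q`. The two conditions are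
phrased with `d X + X d` and `d X - X d`, which obey product rules. -/
structure IsPredualOp (q : ℝ≥0∞) (X : H →L[ℂ] H) : Prop where
  aComm_mem : MemSchatten 1 (aComm K X)
  dComm_mem : MemSchatten q (dComm K X)

variable (K) in
/-- The norm `‖d X + X d‖₁ + ‖d X - X d‖_q`, equivalent to the norm `‖X‖_{1,q}`. -/
noncomputable def predualOpNorm (q : ℝ≥0∞) (X : H →L[ℂ] H) : ℝ :=
  schattenNorm 1 (aComm K X) + schattenNorm q (dComm K X)

theorem predualOpNorm_nonneg (q : ℝ≥0∞) (X : H →L[ℂ] H) : 0 ≤ predualOpNorm K q X :=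
  add_nonneg (schattenNorm_nonneg _ _) (schattenNorm_nonneg _ _)

namespace IsPredualOp

variable {q : ℝ≥0∞} [hq : Fact (1 ≤ q)] {X : H →L[ℂ] H} (h : IsPredualOp K q X)
include h

/-- An element of `𝔲_{1,q}` lies in `L_q`, as its trace class part does. -/
theorem memSchatten : MemSchatten q X ∧ schattenNorm q X ≤ predualOpNorm K q X := by
  obtain ⟨h1, h2⟩ := h.aComm_mem.mono le_rfl hq.out
  have h3 := h1.add hq.out h.dComm_mem
  have h4 := h3.mul_left hq.out (polarization K)
  have h5 := (schattenNorm_mul_left hq.out h3 (polarization K)).trans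
    (mul_le_of_le_one_left (schattenNorm_nonneg _ _) (norm_polarization_le K))
  have h6 := schattenNorm_add_le hq.out h1 h.dComm_mem
  have h7 := schattenNorm_smul_le hq.out h4 (-(1 / 2) : ℂ)
  have h8 := h4.smul hq.out (-(1 / 2) : ℂ)
  rw [← eq_smul_aComm_add_dComm K X] at h7 h8
  refine ⟨h8, ?_⟩
  have h9 : ‖(-(1 / 2) : ℂ)‖ = 1 / 2 := by simp
  rw [h9] at h7
  rw [predualOpNorm]
  linarith [schattenNorm_nonneg 1 (aComm K X),
    schattenNorm_nonneg q (dComm K X)]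

theorem block_plus : MemSchatten 1 (block K K X) ∧
    schattenNorm 1 (block K K X) ≤ 2⁻¹ * schattenNorm 1 (aComm K X) := by
  have h1 := h.aComm_mem.block le_rfl K K
  rw [block_aComm_plus] at h1
  have h2 := h1.1.of_smul le_rfl (by simp)
  rw [norm_two_mul_I] at h2
  exact ⟨h2.1, h2.2.trans (by gcongr; exact h1.2)⟩

theorem block_minus : MemSchatten 1 (block Kᗮ Kᗮ X) ∧
    schattenNorm 1 (block Kᗮ Kᗮ X) ≤ 2⁻¹ * schattenNorm 1 (aComm K X) := by
  have h1 := h.aComm_mem.block le_rfl Kᗮ Kᗮ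
  rw [block_aComm_minus] at h1
  have h2 := h1.1.of_smul le_rfl (by simp)
  rw [norm_neg, norm_two_mul_I] at h2
  exact ⟨h2.1, h2.2.trans (by gcongr; exact h1.2)⟩

end IsPredualOp

theorem memSchatten_block_right {r : ℝ≥0∞} (hr : 1 ≤ r) {X : H →L[ℂ] H}
    (h : MemSchatten r (dComm K X)) : MemSchatten r (block Kᗮ K X) ∧
    schattenNorm r (block Kᗮ K X) ≤ 2⁻¹ * schattenNorm r (dComm K X) := by
  have h1 := h.block hr Kᗮ K
  rw [block_dComm_right] at h1
  have h2 := h1.1.of_smul hr (by simp)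
  rw [norm_two_mul_I] at h2
  exact ⟨h2.1, h2.2.trans (by gcongr; exact h1.2)⟩

theorem memSchatten_block_left {r : ℝ≥0∞} (hr : 1 ≤ r) {X : H →L[ℂ] H}
    (h : MemSchatten r (dComm K X)) : MemSchatten r (block K Kᗮ X) ∧
    schattenNorm r (block K Kᗮ X) ≤ 2⁻¹ * schattenNorm r (dComm K X) := by
  have h1 := h.block hr K Kᗮ
  rw [block_dComm_left] at h1
  have h2 := h1.1.of_smul hr (by simp)
  rw [norm_neg, norm_two_mul_I] at h2
  exact ⟨h2.1, h2.2.trans (by gcongr; exact h1.2)⟩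

namespace Predual

variable {q : ℝ≥0∞} [hq : Fact (1 ≤ q)]

theorem isPredualOp (ρ : Predual K q) :
    IsPredualOp K q ρ.toOp ∧ predualOpNorm K q ρ.toOp ≤ 2 * ‖ρ‖ := by
  have e1 := ρ.mem_block_plus.extendBlock le_rfl
  have e2 := ρ.mem_block_minus.extendBlock le_rfl
  have e3 := ρ.mem_block_right.extendBlock hq.out
  have e4 := ρ.mem_block_left.extendBlock hq.out
  have h1 := e1.1.sub le_rfl e2.1
  have h2 := e3.1.sub hq.out e4.1
  have h3 := schattenNorm_smul_le le_rfl h1.1 (2 * Complex.I)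
  have h4 := schattenNorm_smul_le hq.out h2.1 (2 * Complex.I)
  have h5 := h1.1.smul le_rfl (2 * Complex.I)
  have h6 := h2.1.smul hq.out (2 * Complex.I)
  rw [← aComm_eq_extendBlock] at h3 h5
  rw [← dComm_eq_extendBlock] at h4 h6
  rw [norm_two_mul_I] at h3 h4
  refine ⟨⟨h5, h6⟩, ?_⟩
  rw [predualOpNorm, norm_def]
  linarith [h1.2, h2.2, e1.2, e2.2, e3.2, e4.2]

/-- The element of `𝔲_{1,q}` given by a skew-adjoint operator. -/
def mk (X : H →L[ℂ] H) (hX : star X = -X) (h : IsPredualOp K q X) : Predual K q :=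
  ⟨X, hX, h.dComm_mem, h.block_plus.1, h.block_minus.1⟩

theorem norm_le (ρ : Predual K q) : ‖ρ‖ ≤ predualOpNorm K q ρ.toOp := by
  have h := ρ.isPredualOp.1
  rw [norm_def, predualOpNorm]
  linarith [h.block_plus.2, h.block_minus.2, (memSchatten_block_right hq.out h.dComm_mem).2,
    (memSchatten_block_left hq.out h.dComm_mem).2]

theorem star_toOp (ρ : Predual K q) : star ρ.toOp = -ρ.toOp := ρ.2.1

end Predual

section Holder

variable {p q : ℝ≥0∞} [hp1 : Fact (1 ≤ p)] [hq : Fact (1 ≤ q)]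

/-- In `d B X + B X d = [d, B] X + B (d X + X d)` the first term is of trace class by Hölder's
inequality, in spite of `[d, B]` being in `L_p` only. -/
theorem IsPredualOp.mul_left (hp : p ≤ 2) (hpq : p⁻¹ + q⁻¹ = 1) {X : H →L[ℂ] H}
    (h : IsPredualOp K q X) (B : RestrictedAlgebra K p) :
    IsPredualOp K q (B.toOp * X) ∧
      predualOpNorm K q (B.toOp * X) ≤ 2 * ‖B‖ * predualOpNorm K q X := by
  have h1 : MemSchatten 1 (dComm K B.toOp * X) ∧ schattenNorm 1 (dComm K B.toOp * X) ≤
      schattenNorm p (dComm K B.toOp) * schattenNorm q X :=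
    MemSchatten.holder hp1.out hp hpq B.mem (fun _ => h.memSchatten.1)
  have h2 := h.aComm_mem.mul_left le_rfl B.toOp
  have h3 := h.dComm_mem.mul_left hq.out B.toOp
  have h4 := h.memSchatten.1.mul_left hq.out (dComm K B.toOp)
  refine ⟨⟨?_, ?_⟩, ?_⟩
  · rw [aComm_mul]
    exact h1.1.add le_rfl h2
  · rw [dComm_mul]
    exact h4.add hq.out h3
  · have n1 := schattenNorm_add_le le_rfl h1.1 h2
    have n2 := schattenNorm_add_le hq.out h4 h3
    have n3 := schattenNorm_mul_left le_rfl h.aComm_mem B.toOp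
    have n4 := schattenNorm_mul_left hq.out h.dComm_mem B.toOp
    have n5 := schattenNorm_mul_left hq.out h.memSchatten.1 (dComm K B.toOp)
    have n6 := opNorm_le_schattenNorm hp1.out B.mem
    have n7 := h.memSchatten.2
    have n8 := mul_le_mul_of_nonneg_right n6 (schattenNorm_nonneg q X)
    have n9 := mul_le_mul_of_nonneg_left n7 (schattenNorm_nonneg p (dComm K B.toOp))
    have n10 := mul_nonneg (norm_nonneg B.toOp) (predualOpNorm_nonneg (K := K) q X)
    have n11 : ‖B.toOp‖ * predualOpNorm K q X = ‖B.toOp‖ * schattenNorm 1 (aComm K X) +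
      ‖B.toOp‖ * schattenNorm q (dComm K X) := mul_add _ _ _
    have n12 : 2 * ‖B‖ * predualOpNorm K q X = 2 * (‖B.toOp‖ * predualOpNorm K q X) +
        2 * (schattenNorm p (dComm K B.toOp) * predualOpNorm K q X) := by
      rw [RestrictedAlgebra.norm_def]; ring
    rw [n12, predualOpNorm, aComm_mul, dComm_mul]
    linarith [h1.2]

theorem IsPredualOp.mul_right (hp : p ≤ 2) (hpq : p⁻¹ + q⁻¹ = 1) {X : H →L[ℂ] H}
    (h : IsPredualOp K q X) (B : RestrictedAlgebra K p) :
    IsPredualOp K q (X * B.toOp) ∧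
      predualOpNorm K q (X * B.toOp) ≤ 2 * ‖B‖ * predualOpNorm K q X := by
  have h1 : MemSchatten 1 (X * dComm K B.toOp) ∧ schattenNorm 1 (X * dComm K B.toOp) ≤
      schattenNorm q X * schattenNorm p (dComm K B.toOp) :=
    MemSchatten.holder' hp1.out hp hpq (fun _ => h.memSchatten.1) B.mem
  have h2 := h.aComm_mem.mul_right le_rfl B.toOp
  have h3 := h.dComm_mem.mul_right hq.out B.toOp
  have h4 := h.memSchatten.1.mul_right hq.out (dComm K B.toOp)
  refine ⟨⟨?_, ?_⟩, ?_⟩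
  · rw [aComm_mul']
    exact (h2.sub le_rfl h1.1).1
  · rw [dComm_mul]
    exact h3.add hq.out h4
  · have n1 := (h2.sub le_rfl h1.1).2
    have n2 := schattenNorm_add_le hq.out h3 h4
    have n3 := schattenNorm_mul_right le_rfl h.aComm_mem B.toOp
    have n4 := schattenNorm_mul_right hq.out h.dComm_mem B.toOp
    have n5 := schattenNorm_mul_right hq.out h.memSchatten.1 (dComm K B.toOp)
    have n6 := opNorm_le_schattenNorm hp1.out B.mem
    have n7 := h.memSchatten.2
    have n8 := mul_le_mul_of_nonneg_left n6 (schattenNorm_nonneg q X)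
    have n9 := mul_le_mul_of_nonneg_right n7 (schattenNorm_nonneg p (dComm K B.toOp))
    have n10 := mul_nonneg (norm_nonneg B.toOp) (predualOpNorm_nonneg (K := K) q X)
    have n11 : ‖B.toOp‖ * predualOpNorm K q X = schattenNorm 1 (aComm K X) * ‖B.toOp‖ +
      schattenNorm q (dComm K X) * ‖B.toOp‖ := by rw [predualOpNorm]; ring
    have n12 : 2 * ‖B‖ * predualOpNorm K q X = 2 * (‖B.toOp‖ * predualOpNorm K q X) +
        2 * (predualOpNorm K q X * schattenNorm p (dComm K B.toOp)) := by
      rw [RestrictedAlgebra.norm_def]; ring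
    rw [n12, predualOpNorm, aComm_mul', dComm_mul]
    linarith [h1.2]

/-! ### The restricted trace -/

theorem block_mul (L M : Submodule ℂ H) [CompleteSpace M] (A B : H →L[ℂ] H) :
    block L M (A * B) = block K M A ∘L block L K B + block Kᗮ M A ∘L block L Kᗮ B := by
  ext x : 1
  have h := congrArg (fun y => M.orthogonalProjectionOnto (A y)) (decomp_apply K (B x))
  simp only [map_add] at h
  exact h.symm

/-- Cyclicity of the restricted trace, from that of the trace in each pair of blocks. -/
theorem restrictedTrace_mul_comm (hp : p ≤ 2) (hpq : p⁻¹ + q⁻¹ = 1) {X : H →L[ℂ] H}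
    (h : IsPredualOp K q X) (B : RestrictedAlgebra K p) :
    restrictedTrace K (X * B.toOp) = restrictedTrace K (B.toOp * X) := by
  have x1 := h.block_plus.1
  have x2 := h.block_minus.1
  have x3 := (memSchatten_block_right hq.out h.dComm_mem).1
  have x4 := (memSchatten_block_left hq.out h.dComm_mem).1
  have b3 := (memSchatten_block_right hp1.out B.mem).1
  have b4 := (memSchatten_block_left hp1.out B.mem).1
  -- diagonal blocks: the duality of `L_1` and bounded operators; off-diagonal blocks: that of
  -- `L_p` and `L_q`
  have c1 : (1 : ℝ≥0∞)⁻¹ + ∞⁻¹ = 1 := by simp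
  have l12 : (1 : ℝ≥0∞) ≤ 2 := by norm_num
  simp only [restrictedTrace, block_mul (K := K)]
  rw [operatorTrace_add (MemSchatten.holder le_rfl l12 c1 x1 (fun h => absurd rfl h)).1
      (MemSchatten.holder' hp1.out hp hpq (fun _ => x3) b4).1,
    operatorTrace_add (MemSchatten.holder' hp1.out hp hpq (fun _ => x4) b3).1
      (MemSchatten.holder le_rfl l12 c1 x2 (fun h => absurd rfl h)).1,
    operatorTrace_add (MemSchatten.holder' le_rfl l12 c1 (fun h => absurd rfl h) x1).1
      (MemSchatten.holder hp1.out hp hpq b3 (fun _ => x4)).1,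
    operatorTrace_add (MemSchatten.holder hp1.out hp hpq b4 (fun _ => x3)).1
      (MemSchatten.holder' le_rfl l12 c1 (fun h => absurd rfl h) x2).1,
    operatorTrace_comp_comm le_rfl l12 c1 x1 (B := block K K B.toOp) (fun h => absurd rfl h),
    operatorTrace_comp_comm le_rfl l12 c1 x2 (B := block Kᗮ Kᗮ B.toOp) (fun h => absurd rfl h),
    operatorTrace_comp_comm hp1.out hp hpq b3 (fun _ => x4),
    operatorTrace_comp_comm hp1.out hp hpq b4 (fun _ => x3)]
  ring

/-- The restricted trace of the rank one operator `y ↦ ⟪x, y⟫ v`. -/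
theorem restrictedTrace_toSpanSingleton_comp (x v : H) :
    restrictedTrace K (ContinuousLinearMap.toSpanSingleton ℂ v ∘L innerSL ℂ x) = ⟪x, v⟫_ℂ := by
  have h : ∀ (L : Submodule ℂ H) [CompleteSpace L],
      operatorTrace (block L L (ContinuousLinearMap.toSpanSingleton ℂ v ∘L innerSL ℂ x)) =
        ⟪x, L.starProjection v⟫_ℂ := by
    intro L _
    have h1 : block L L (ContinuousLinearMap.toSpanSingleton ℂ v ∘L innerSL ℂ x) =
        ContinuousLinearMap.toSpanSingleton ℂ (L.orthogonalProjectionOnto v) ∘L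
          innerSL ℂ (L.orthogonalProjectionOnto x) := by
      ext y : 1
      simp [block]
    rw [h1, operatorTrace_toSpanSingleton_comp, ← Submodule.inner_starProjection_left_eq_right]
    exact Submodule.inner_orthogonalProjectionOnto_eq_of_mem_left _ v
  rw [restrictedTrace, h, h, ← inner_add_right]
  rw [Submodule.starProjection_add_starProjection_orthogonal]

variable (K p) in
/-- The skew-adjoint operator `y ↦ i ⟪x, y⟫ x`, as an element of `𝔲_{res,p}`. -/
noncomputable def rankOneSkew (x : H) : RestrictedLieAlgebra K p :=
  let T : H →L[ℂ] H := ContinuousLinearMap.toSpanSingleton ℂ (Complex.I • x) ∘L innerSL ℂ x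
  have hT : MemSchatten p T := memSchatten_toSpanSingleton_comp hp1.out _ _
  ⟨(⟨T, ((hT.mul_left hp1.out _).sub hp1.out (hT.mul_right hp1.out _)).1⟩ :
    restrictedSubalgebra K p), skewAdjoint.mem_iff.2 (Subtype.ext (by
      change star T = -T
      rw [ContinuousLinearMap.star_eq_adjoint]
      refine ((ContinuousLinearMap.eq_adjoint_iff _ _).2 fun y z => ?_).symm
      simp only [T, neg_apply, ContinuousLinearMap.comp_apply, innerSL_apply_apply,
        ContinuousLinearMap.toSpanSingleton_apply, inner_neg_left, inner_smul_left,
        inner_smul_right, inner_conj_symm, Complex.conj_I]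
      ring))⟩

theorem mul_rankOneSkew (ν : H →L[ℂ] H) (x : H) :
    restrictedTrace K (ν * (rankOneSkew K p x).toOp) = Complex.I * ⟪x, ν x⟫_ℂ := by
  have h : ν * (rankOneSkew K p x).toOp =
      ContinuousLinearMap.toSpanSingleton ℂ (Complex.I • ν x) ∘L innerSL ℂ x := by
    ext y : 1
    change ν (⟪x, y⟫_ℂ • Complex.I • x) = ⟪x, y⟫_ℂ • Complex.I • ν x
    simp only [map_smul]
  rw [h, restrictedTrace_toSpanSingleton_comp, inner_smul_right]

end Holder

/-! ### Completeness of the restricted algebra -/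

variable (K) (p : ℝ≥0∞) [hp : Fact (1 ≤ p)]

theorem continuous_dComm : Continuous (dComm K) :=
  (continuous_const_mul (polarization K)).sub (continuous_mul_const (polarization K))

instance : CompleteSpace (RestrictedAlgebra K p) := by
  refine Metric.complete_of_cauchySeq_tendsto fun A hA => ?_
  have hnorm : ∀ B : RestrictedAlgebra K p,
      ‖B.toOp‖ ≤ ‖B‖ ∧ schattenNorm p (dComm K B.toOp) ≤ ‖B‖ := fun B => by
      rw [RestrictedAlgebra.norm_def]
      constructor <;> linarith [norm_nonneg B.toOp, schattenNorm_nonneg p (dComm K B.toOp)]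
  have hop : CauchySeq fun n => (A n).toOp := by
    rw [Metric.cauchySeq_iff] at hA ⊢
    intro ε hε
    obtain ⟨N, hN⟩ := hA ε hε
    refine ⟨N, fun m hm n hn => lt_of_le_of_lt ?_ (hN m hm n hn)⟩
    rw [dist_eq_norm, dist_eq_norm]
    exact (hnorm (A m - A n)).1
  obtain ⟨B, hB⟩ := cauchySeq_tendsto_of_complete hop
  have key : ∀ ε > 0, ∃ N, ∀ m ≥ N, MemSchatten p (dComm K (B - (A m).toOp)) ∧
      schattenNorm p (dComm K (B - (A m).toOp)) ≤ ε ∧ ‖B - (A m).toOp‖ ≤ ε := by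
    intro ε hε
    obtain ⟨N, hN⟩ := Metric.cauchySeq_iff.1 hA ε hε
    refine ⟨N, fun m hm => ?_⟩
    have hlim : Filter.Tendsto (fun n => (A n).toOp - (A m).toOp) Filter.atTop
        (nhds (B - (A m).toOp)) := hB.sub_const _
    have hev : ∀ᶠ n in Filter.atTop, ‖A n - A m‖ ≤ ε := by
      filter_upwards [Filter.eventually_ge_atTop N] with n hn
      rw [← dist_eq_norm]
      exact (hN n hn m hm).le
    have h1 := MemSchatten.of_tendsto hp.out (c := ε)
      (hev.mono fun n hn => ⟨(A n - A m).mem, (hnorm (A n - A m)).2.trans hn⟩)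
      (((continuous_dComm K).tendsto _).comp hlim)
    refine ⟨h1.1, h1.2, le_of_tendsto hlim.norm (hev.mono fun n hn => ?_)⟩
    exact (hnorm (A n - A m)).1.trans hn
  obtain ⟨N, hN⟩ := key 1 one_pos
  have hBmem : MemSchatten p (dComm K B) := by
    have h1 := (hN N le_rfl).1.add hp.out (A N).mem
    rwa [← dComm_add, sub_add_cancel] at h1
  let B' : RestrictedAlgebra K p := (⟨B, hBmem⟩ : restrictedSubalgebra K p)
  refine ⟨B', ?_⟩
  rw [Metric.tendsto_atTop]
  intro ε hε
  obtain ⟨N, hN⟩ := key (ε / 3) (by positivity)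
  refine ⟨N, fun m hm => ?_⟩
  have h1 : ‖B' - A m‖ = ‖B - (A m).toOp‖ + schattenNorm p (dComm K (B - (A m).toOp)) := rfl
  rw [dist_comm, dist_eq_norm, h1]
  linarith [(hN m hm).2.1, (hN m hm).2.2]

instance : CompleteSpace (RestrictedLieAlgebra K p) := by
  have h : IsClosed {x : RestrictedAlgebra K p | star x = -x} :=
    isClosed_eq continuous_star continuous_neg
  exact h.completeSpace_coe

end RestrictedOperators

section CoadjointAction

variable {H : Type u} [NormedAddCommGroup H] [InnerProductSpace ℂ H] [CompleteSpace H]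
  {K : Submodule ℂ H} [CompleteSpace K] {p q : ℝ≥0∞} [hp1 : Fact (1 ≤ p)] [hq : Fact (1 ≤ q)]

/-! ### The coadjoint action and the cocycle `σ` -/

namespace RestrictedUnitary

theorem toOp_mul (g h : RestrictedUnitary K p) : (g * h).toOp = g.toOp * h.toOp := rfl

theorem toOp_one : (1 : RestrictedUnitary K p).toOp = 1 := rfl

theorem star_toOp (g : RestrictedUnitary K p) : star g.toOp = g⁻¹.toOp := rfl

theorem toOp_mul_toOp_inv (g : RestrictedUnitary K p) : g.toOp * g⁻¹.toOp = 1 := by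
  rw [← toOp_mul, mul_inv_cancel, toOp_one]

theorem toOp_inv_mul_toOp (g : RestrictedUnitary K p) : g⁻¹.toOp * g.toOp = 1 := by
  rw [← toOp_mul, inv_mul_cancel, toOp_one]

theorem toOp_injective : Function.Injective (toOp : RestrictedUnitary K p → H →L[ℂ] H) :=
  RestrictedAlgebra.toOp_injective.comp Subtype.val_injective

theorem conj_polarization_sub (g : RestrictedUnitary K p) :
    g.toOp * polarization K * g⁻¹.toOp - polarization K = -(dComm K g.toOp * g⁻¹.toOp) := by
  rw [dComm, sub_mul, mul_assoc (polarization K), toOp_mul_toOp_inv, mul_one, neg_sub]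

/-- The operator `X = g d g⁻¹ - d` lies in `L_p ≤ L_q`, and `d X + X d = -X²` is of trace class. -/
theorem isPredualOp_cocycle (hp : p ≤ 2) (hpq : p⁻¹ + q⁻¹ = 1) (g : RestrictedUnitary K p) :
    IsPredualOp K q (g.toOp * polarization K * g⁻¹.toOp - polarization K) := by
  set X := g.toOp * polarization K * g⁻¹.toOp - polarization K with hX
  have hpq' : p ≤ q := hp.trans (two_le_of_inv_add_inv_eq_one hp hpq)
  have h1 : MemSchatten p X := by
    rw [hX, conj_polarization_sub, ← neg_one_smul ℂ]
    exact ((RestrictedAlgebra.mem g.1).mul_right hp1.out _).smul hp1.out _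
  have h2 := (h1.mono hp1.out hpq').1
  -- both `d` and `d + X = g d g⁻¹` square to `-1`
  have h3 : aComm K X = (-1 : ℂ) • (X * X) := by
    have e1 : (polarization K + X) * (polarization K + X) = -1 := by
      have e2 : polarization K + X = g.toOp * polarization K * g⁻¹.toOp := by rw [hX]; abel
      calc _ = g.toOp * polarization K * (g⁻¹.toOp * g.toOp) * polarization K * g⁻¹.toOp := by
            rw [e2]; noncomm_ring
        _ = g.toOp * (polarization K * polarization K) * g⁻¹.toOp := by
            rw [toOp_inv_mul_toOp]; noncomm_ring
        _ = -1 := by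
            rw [polarization_mul_self, mul_neg_one, neg_mul, toOp_mul_toOp_inv]
    rw [mul_add, add_mul, add_mul, polarization_mul_self] at e1
    rw [aComm, neg_one_smul, eq_neg_iff_add_eq_zero]
    calc _ = (-1 + X * polarization K + (polarization K * X + X * X)) - -1 := by abel
      _ = 0 := by rw [e1, sub_self]
  refine ⟨?_, (h2.mul_left hq.out _).sub hq.out (h2.mul_right hq.out _) |>.1⟩
  rw [h3]
  have h4 : MemSchatten 1 (X * X) := (MemSchatten.holder hp1.out hp hpq h1 (fun _ => h2)).1
  exact h4.smul le_rfl _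

/-- The cocycle `σ(g) = g d g⁻¹ - d` with values in `𝔲_{1,q}`. -/
noncomputable def cocycle (hp : p ≤ 2) (hpq : p⁻¹ + q⁻¹ = 1) (g : RestrictedUnitary K p) :
    Predual K q :=
  Predual.mk (g.toOp * polarization K * g⁻¹.toOp - polarization K)
    (by rw [star_sub, star_mul, star_mul, polarization_star, star_toOp, star_toOp, inv_inv]
        noncomm_ring)
    (g.isPredualOp_cocycle hp hpq)

theorem isPredualOp_conj (hp : p ≤ 2) (hpq : p⁻¹ + q⁻¹ = 1) (g : RestrictedUnitary K p)
    (μ : Predual K q) : IsPredualOp K q (g.toOp * μ.toOp * g⁻¹.toOp) ∧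
      predualOpNorm K q (g.toOp * μ.toOp * g⁻¹.toOp) ≤
        8 * ‖(g⁻¹ : RestrictedUnitary K p).1‖ * ‖g.1‖ * ‖μ‖ := by
  have h1 := μ.isPredualOp
  have h2 := h1.1.mul_left hp hpq g.1
  have h3 := h2.1.mul_right hp hpq (g⁻¹ : RestrictedUnitary K p).1
  refine ⟨h3.1, h3.2.trans ?_⟩
  calc _ ≤ 2 * ‖(g⁻¹ : RestrictedUnitary K p).1‖ * (2 * ‖g.1‖ * (2 * ‖μ‖)) := by
        gcongr
        refine h2.2.trans ?_
        gcongr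
        exact h1.2
    _ = _ := by ring

/-- The conjugation `μ ↦ g μ g⁻¹` of `𝔲_{1,q}`. -/
noncomputable def conjL (hp : p ≤ 2) (hpq : p⁻¹ + q⁻¹ = 1) (g : RestrictedUnitary K p) :
    Predual K q →L[ℝ] Predual K q :=
  LinearMap.mkContinuous
    { toFun μ := Predual.mk (g.toOp * μ.toOp * g⁻¹.toOp)
        (by rw [star_mul, star_mul, μ.star_toOp, star_toOp, star_toOp, inv_inv]
            noncomm_ring)
        (g.isPredualOp_conj hp hpq μ).1
      map_add' μ ν := Predual.toOp_injective (by
        change g.toOp * (μ.toOp + ν.toOp) * g⁻¹.toOp =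
          g.toOp * μ.toOp * g⁻¹.toOp + g.toOp * ν.toOp * g⁻¹.toOp
        rw [mul_add, add_mul])
      map_smul' c μ := Predual.toOp_injective (by
        change g.toOp * (c • μ.toOp) * g⁻¹.toOp = c • (g.toOp * μ.toOp * g⁻¹.toOp)
        rw [mul_smul_comm, smul_mul_assoc]) }
    (8 * ‖(g⁻¹ : RestrictedUnitary K p).1‖ * ‖g.1‖)
    fun μ => (Predual.norm_le _).trans (g.isPredualOp_conj hp hpq μ).2

theorem toOp_conjL (hp : p ≤ 2) (hpq : p⁻¹ + q⁻¹ = 1) (g : RestrictedUnitary K p)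
    (μ : Predual K q) : (conjL hp hpq g μ).toOp = g.toOp * μ.toOp * g⁻¹.toOp := rfl

theorem conjL_mul (hp : p ≤ 2) (hpq : p⁻¹ + q⁻¹ = 1) (g h : RestrictedUnitary K p)
    (μ : Predual K q) : conjL hp hpq (g * h) μ = conjL hp hpq g (conjL hp hpq h μ) := by
  apply Predual.toOp_injective
  simp only [toOp_conjL, mul_inv_rev, toOp_mul, mul_assoc]

theorem conjL_one (hp : p ≤ 2) (hpq : p⁻¹ + q⁻¹ = 1) (μ : Predual K q) :
    conjL hp hpq (1 : RestrictedUnitary K p) μ = μ := by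
  apply Predual.toOp_injective
  rw [toOp_conjL, inv_one, toOp_one, one_mul, mul_one]

/-- The coadjoint representation of `U_{res,p}` on `𝔲_{1,q}`. -/
noncomputable def coadjoint (hp : p ≤ 2) (hpq : p⁻¹ + q⁻¹ = 1) :
    RestrictedUnitary K p →* (Predual K q ≃L[ℝ] Predual K q) where
  toFun g := ContinuousLinearEquiv.equivOfInverse (conjL hp hpq g) (conjL hp hpq g⁻¹)
    (fun μ => by rw [← conjL_mul, inv_mul_cancel, conjL_one])
    (fun μ => by rw [← conjL_mul, mul_inv_cancel, conjL_one])
  map_one' := ContinuousLinearEquiv.ext (funext (conjL_one hp hpq))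
  map_mul' g h := ContinuousLinearEquiv.ext (funext (conjL_mul hp hpq g h))

theorem toOp_coadjoint (hp : p ≤ 2) (hpq : p⁻¹ + q⁻¹ = 1) (g : RestrictedUnitary K p)
    (μ : Predual K q) : (coadjoint hp hpq g μ).toOp = g.toOp * μ.toOp * g⁻¹.toOp := rfl

/-- Conjugation by `g` is dual, for the trace pairing, to conjugation by `g⁻¹`. -/
theorem restrictedTrace_coadjoint (hp : p ≤ 2) (hpq : p⁻¹ + q⁻¹ = 1) (g : RestrictedUnitary K p)
    (μ : Predual K q) (A : RestrictedAlgebra K p) :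
    restrictedTrace K ((coadjoint hp hpq g μ).toOp * A.toOp) =
      restrictedTrace K (μ.toOp * (g⁻¹.toOp * A.toOp * g.toOp)) := by
  have h1 := (μ.isPredualOp.1.mul_right hp hpq ((g⁻¹ : RestrictedUnitary K p).1 * A)).1
  have h2 := restrictedTrace_mul_comm hp hpq h1 g.1
  have e1 : (coadjoint hp hpq g μ).toOp * A.toOp =
      g.toOp * (μ.toOp * (g⁻¹.toOp * A.toOp)) := by
    rw [toOp_coadjoint]; simp only [mul_assoc]
  have e2 : μ.toOp * (g⁻¹.toOp * A.toOp * g.toOp) =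
      μ.toOp * (g⁻¹.toOp * A.toOp) * g.toOp := by simp only [mul_assoc]
  rw [e1, e2]
  exact h2.symm

/-- The trace pairing with the operators of rank one in `𝔲_{res,p}` separates the points of
`𝔲_{1,q}`, by polarization of `x ↦ ⟪x, ν x⟫`. -/
theorem eq_coadjoint_iff (hp : p ≤ 2) (hpq : p⁻¹ + q⁻¹ = 1) (g : RestrictedUnitary K p)
    (μ ν : Predual K q) : ν = coadjoint hp hpq g μ ↔ ∀ A : RestrictedLieAlgebra K p,
      restrictedTrace K (ν.toOp * A.toOp) =
        restrictedTrace K (μ.toOp * (g⁻¹.toOp * A.toOp * g.toOp)) := by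
  constructor
  · rintro rfl A
    exact restrictedTrace_coadjoint hp hpq g μ A.1
  · intro h
    apply Predual.toOp_injective
    have h1 : ∀ x, ⟪x, ν.toOp x⟫_ℂ = ⟪x, (coadjoint hp hpq g μ).toOp x⟫_ℂ := by
      intro x
      have h2 := (h (rankOneSkew K p x)).trans
        (restrictedTrace_coadjoint hp hpq g μ (rankOneSkew K p x).1).symm
      rw [mul_rankOneSkew] at h2
      exact mul_left_cancel₀ Complex.I_ne_zero (h2.trans (mul_rankOneSkew _ x))
    have h3 : ν.toOp.toLinearMap = (coadjoint hp hpq g μ).toOp.toLinearMap :=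
      (ext_inner_map _ _).1 fun x => by
        rw [← inner_conj_symm, ← inner_conj_symm ((coadjoint hp hpq g μ).toOp.toLinearMap x)]
        exact congrArg _ (h1 x)
    exact ContinuousLinearMap.coe_injective h3

theorem cocycle_mul (hp : p ≤ 2) (hpq : p⁻¹ + q⁻¹ = 1) (g h : RestrictedUnitary K p) :
    cocycle hp hpq (g * h) =
      coadjoint (q := q) hp hpq g (cocycle hp hpq h) + cocycle hp hpq g := by
  apply Predual.toOp_injective
  change (g * h).toOp * polarization K * (g * h)⁻¹.toOp - polarization K =
    g.toOp * (h.toOp * polarization K * h⁻¹.toOp - polarization K) * g⁻¹.toOp +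
      (g.toOp * polarization K * g⁻¹.toOp - polarization K)
  rw [mul_inv_rev, toOp_mul, toOp_mul]
  noncomm_ring

theorem cocycle_one (hp : p ≤ 2) (hpq : p⁻¹ + q⁻¹ = 1) :
    cocycle (q := q) hp hpq (1 : RestrictedUnitary K p) = 0 := by
  have h := cocycle_mul (q := q) hp hpq (1 : RestrictedUnitary K p) 1
  rw [mul_one, map_one] at h
  exact left_eq_add.1 h

/-- The affine action `g · (μ, γ) = (g μ g⁻¹ - γ σ(g), γ)`. -/
noncomputable def affineAction (hp : p ≤ 2) (hpq : p⁻¹ + q⁻¹ = 1) :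
    RestrictedUnitary K p →* Equiv.Perm (Predual K q × ℝ) :=
  MonoidHom.toHomPerm (α := Predual K q × ℝ)
    { toFun := fun g x => (coadjoint hp hpq g x.1 - x.2 • cocycle hp hpq g, x.2)
      map_one' := by
        funext x
        change (coadjoint hp hpq 1 x.1 - x.2 • cocycle hp hpq 1, x.2) = x
        rw [cocycle_one, smul_zero, sub_zero, map_one]
        rfl
      map_mul' := fun g h => by
        funext x
        change (coadjoint hp hpq (g * h) x.1 - x.2 • cocycle hp hpq (g * h), x.2) =
          (coadjoint hp hpq g (coadjoint hp hpq h x.1 - x.2 • cocycle hp hpq h) -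
            x.2 • cocycle hp hpq g, x.2)
        rw [cocycle_mul, map_mul, map_sub, map_smul, smul_add, sub_add_eq_sub_sub]
        rfl }

theorem affineAction_apply (hp : p ≤ 2) (hpq : p⁻¹ + q⁻¹ = 1) (g : RestrictedUnitary K p)
    (μ : Predual K q) (γ : ℝ) :
    affineAction hp hpq g (μ, γ) = (coadjoint hp hpq g μ - γ • cocycle hp hpq g, γ) := rfl

/-! ### The isotropy group -/

theorem cocycle_eq_zero_iff (hp : p ≤ 2) (hpq : p⁻¹ + q⁻¹ = 1) (g : RestrictedUnitary K p) :
    cocycle (q := q) hp hpq g = 0 ↔ dComm K g.toOp = 0 := by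
  have h : (cocycle (q := q) hp hpq g).toOp = -(dComm K g.toOp * g⁻¹.toOp) :=
    conj_polarization_sub g
  constructor
  · intro h0
    rw [h0] at h
    have h1 : dComm K g.toOp * g⁻¹.toOp = 0 := neg_eq_zero.1 h.symm
    calc dComm K g.toOp = dComm K g.toOp * (g⁻¹.toOp * g.toOp) := by
          rw [toOp_inv_mul_toOp, mul_one]
      _ = 0 := by rw [← mul_assoc, h1, zero_mul]
  · intro h0
    apply Predual.toOp_injective
    rw [h, h0, zero_mul, neg_zero]
    rfl

end RestrictedUnitary

theorem directSumOp_coe (u : K →L[ℂ] K) (v : Kᗮ →L[ℂ] Kᗮ) (x : K) :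
    directSumOp K u v x = u x := by
  have h1 : K.orthogonalProjectionOnto (x : H) = x :=
    Submodule.orthogonalProjectionOnto_mem_subspace_eq_self x
  have h2 : Kᗮ.orthogonalProjectionOnto (x : H) = 0 :=
    Submodule.orthogonalProjectionOnto_apply_of_mem_orthogonal
      (Submodule.le_orthogonal_orthogonal K x.2)
  simp [directSumOp, h1, h2]

theorem directSumOp_coe_orthogonal (u : K →L[ℂ] K) (v : Kᗮ →L[ℂ] Kᗮ) (x : Kᗮ) :
    directSumOp K u v x = v x := by
  have h1 : Kᗮ.orthogonalProjectionOnto (x : H) = x :=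
    Submodule.orthogonalProjectionOnto_mem_subspace_eq_self x
  have h2 : K.orthogonalProjectionOnto (x : H) = 0 :=
    Submodule.orthogonalProjectionOnto_apply_of_mem_orthogonal x.2
  simp [directSumOp, h1, h2]

theorem directSumOp_injective {u u' : K →L[ℂ] K} {v v' : Kᗮ →L[ℂ] Kᗮ}
    (h : directSumOp K u v = directSumOp K u' v') : u = u' ∧ v = v' := by
  constructor
  · ext x
    rw [← directSumOp_coe u v, h, directSumOp_coe]
  · ext x
    rw [← directSumOp_coe_orthogonal u v, h, directSumOp_coe_orthogonal]

/-- The off-diagonal blocks of `[d, A]` are `± 2 i` times those of `A`. -/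
theorem eq_directSumOp_of_dComm_eq_zero {A : H →L[ℂ] H} (h : dComm K A = 0) :
    A = directSumOp K (block K K A) (block Kᗮ Kᗮ A) := by
  have h1 : block Kᗮ K A = 0 := by
    rw [← inv_smul_smul₀ (show 2 * Complex.I ≠ 0 by simp) (block Kᗮ K A), ← block_dComm_right, h,
      block_zero]
    ext
    simp
  have h2 : block K Kᗮ A = 0 := by
    rw [← inv_smul_smul₀ (show -(2 * Complex.I) ≠ 0 by simp) (block K Kᗮ A), ← block_dComm_left, h,
      block_zero]
    ext
    simp
  ext x
  rw [← decomp_apply K x, map_add, map_add, directSumOp_coe, directSumOp_coe_orthogonal]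
  congr 1
  · rw [← decomp_apply K (A _)]
    have h4 : Kᗮ.orthogonalProjectionOnto (A (K.orthogonalProjectionOnto x)) = 0 :=
      DFunLike.congr_fun h2 _
    rw [h4, ZeroMemClass.coe_zero, add_zero]
    rfl
  · rw [← decomp_apply K (A _)]
    have h4 : K.orthogonalProjectionOnto (A (Kᗮ.orthogonalProjectionOnto x)) = 0 :=
      DFunLike.congr_fun h1 _
    rw [h4, ZeroMemClass.coe_zero, zero_add]
    rfl

theorem blockDiagonal_injective : Function.Injective (blockDiagonal K p) := by
  intro x y h
  have h1 := directSumOp_injective (congrArg RestrictedUnitary.toOp h)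
  exact Prod.ext (Subtype.ext h1.1) (Subtype.ext h1.2)

theorem mem_range_blockDiagonal_iff (g : RestrictedUnitary K p) :
    g ∈ (blockDiagonal K p).range ↔ dComm K g.toOp = 0 := by
  constructor
  · rintro ⟨x, rfl⟩
    exact dComm_directSumOp _ _
  · intro h
    have e1 := eq_directSumOp_of_dComm_eq_zero h
    set u := block K K g.toOp
    set v := block Kᗮ Kᗮ g.toOp
    have e2 : star g.toOp = directSumOp K (star u) (star v) := by
      conv_lhs => rw [e1]
      exact directSumOp_star u v
    have e3 : directSumOp K (star u * u) (star v * v) = directSumOp K 1 1 := by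
      rw [directSumOp_mul, ← e1, ← e2, directSumOp_one]
      exact g.toOp_inv_mul_toOp
    have e4 : directSumOp K (u * star u) (v * star v) = directSumOp K 1 1 := by
      rw [directSumOp_mul, ← e1, ← e2, directSumOp_one]
      exact g.toOp_mul_toOp_inv
    have h3 := directSumOp_injective e3
    have h4 := directSumOp_injective e4
    exact ⟨(⟨u, Unitary.mem_iff.2 ⟨h3.1, h4.1⟩⟩, ⟨v, Unitary.mem_iff.2 ⟨h3.2, h4.2⟩⟩),
      RestrictedUnitary.toOp_injective e1.symm⟩

theorem comap_stabilizer_eq_range (hp : p ≤ 2) (hpq : p⁻¹ + q⁻¹ = 1) {γ : ℝ} (hγ : γ ≠ 0) :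
    (MulAction.stabilizer (Equiv.Perm (Predual K q × ℝ)) ((0 : Predual K q), γ)).comap
      (RestrictedUnitary.affineAction hp hpq) = (blockDiagonal K p).range := by
  ext g
  rw [Subgroup.mem_comap, MulAction.mem_stabilizer_iff, Equiv.Perm.smul_def,
    RestrictedUnitary.affineAction_apply, map_zero, zero_sub, Prod.mk.injEq, neg_eq_zero,
    smul_eq_zero, or_iff_right hγ, RestrictedUnitary.cocycle_eq_zero_iff,
    mem_range_blockDiagonal_iff]
  exact and_iff_left rfl

/-! ### Banach Lie group structures -/

variable (K p) in
/-- The element `d` of `L_{res,p}`. -/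
noncomputable def polarizationElement : RestrictedAlgebra K p :=
  (⟨polarization K, by
    change MemSchatten p (dComm K (polarization K))
    rw [dComm_polarization]
    exact MemSchatten.zero hp1.out⟩ : restrictedSubalgebra K p)

theorem isCayleyGroup_range_blockDiagonal :
    IsCayleyGroup ((unitary (RestrictedAlgebra K p)).subtype.comp (blockDiagonal K p).range.subtype)
      (skewCommutant (polarizationElement K p)) := by
  have h1 : polarizationElement K p * polarizationElement K p = -1 :=
    RestrictedAlgebra.toOp_injective (polarization_mul_self K)
  have h2 : star (polarizationElement K p) = -polarizationElement K p :=
    RestrictedAlgebra.toOp_injective (polarization_star K)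
  refine isCayleyGroup_unitary_commutant h1 h2 fun g => ?_
  rw [mem_range_blockDiagonal_iff, dComm, sub_eq_zero]
  exact RestrictedAlgebra.toOp_injective.eq_iff (a := polarizationElement K p * g.1)
    (b := g.1 * polarizationElement K p)

end CoadjointAction

end RestrictedGrassmannian

theorem mainTheorem12 {H : Type*} [NormedAddCommGroup H] [InnerProductSpace ℂ H]
    [CompleteSpace H] [TopologicalSpace.SeparableSpace H]
    (K : Submodule ℂ H) [CompleteSpace K]
    (hK : ¬ FiniteDimensional ℂ K) (hK_perp : ¬ FiniteDimensional ℂ Kᗮ)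
    (p q : ENNReal) [Fact (1 ≤ p)] [Fact (1 ≤ q)] (hp : p ≤ 2) (hpq : p⁻¹ + q⁻¹ = 1) :
    ∃ (σ : RestrictedUnitary K p → Predual K q)
      (Ad : RestrictedUnitary K p →* (Predual K q ≃L[ℝ] Predual K q))
      (ρ : RestrictedUnitary K p →* Equiv.Perm (Predual K q × ℝ)),
      -- `σ(g) = g d g⁻¹ - d`, and it belongs to `𝔲_{1,q}`
      (∀ g, (σ g).toOp = g.toOp * polarization K * g⁻¹.toOp - polarization K) ∧
      -- `Ad g` is the conjugation by `g`; it is the coadjoint action with respect to `Tr_res`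
      (∀ g μ, (Ad g μ).toOp = g.toOp * μ.toOp * g⁻¹.toOp) ∧
      (∀ g (μ ν : Predual K q),
        ν = Ad g μ ↔
          ∀ A : RestrictedLieAlgebra K p,
            restrictedTrace K (ν.toOp * A.toOp) =
              restrictedTrace K (μ.toOp * (g⁻¹.toOp * A.toOp * g.toOp))) ∧
      -- the action `ρ`; it preserves each slice `𝔲_{1,q} ⊕ {γ}` and is affine on it
      (∀ g μ γ, ρ g (μ, γ) = (Ad g μ - γ • σ g, γ)) ∧
      (∀ g γ, ∃ φ : Predual K q ≃ᴬ[ℝ] Predual K q, ∀ μ, ρ g (μ, γ) = (φ μ, γ)) ∧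
      -- the isotropy group of `(0, γ)` is `U(K) × U(Kᗮ)`, embedded block diagonally
      Function.Injective (blockDiagonal K p) ∧
      (∀ γ : ℝ, γ ≠ 0 →
        (MulAction.stabilizer (Equiv.Perm (Predual K q × ℝ)) ((0 : Predual K q), γ)).comap ρ =
          (blockDiagonal K p).range) ∧
      -- it is a Banach Lie subgroup, for the Banach Lie group structure on `U_{res,p}` that is
      -- modelled on `𝔲_{res,p}` and makes it a submanifold of `L_{res,p}`
      CompleteSpace (RestrictedLieAlgebra K p) ∧
      ∃ _ : ChartedSpace (RestrictedLieAlgebra K p) (RestrictedUnitary K p),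
        LieGroup (modelWithCornersSelf ℝ (RestrictedLieAlgebra K p)) (⊤ : ℕ∞)
          (RestrictedUnitary K p) ∧
        Manifold.IsSmoothEmbedding (modelWithCornersSelf ℝ (RestrictedLieAlgebra K p))
          (modelWithCornersSelf ℝ (RestrictedAlgebra K p)) (⊤ : ℕ∞)
          (Subtype.val : RestrictedUnitary K p → RestrictedAlgebra K p) ∧
        IsBanachLieSubgroup (RestrictedLieAlgebra K p) (blockDiagonal K p).range := by
  have hU := isCayleyGroup_unitary (𝔸 := RestrictedAlgebra K p)
  have hS := isCayleyGroup_range_blockDiagonal (K := K) (p := p)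
  refine ⟨RestrictedUnitary.cocycle hp hpq, RestrictedUnitary.coadjoint hp hpq,
    RestrictedUnitary.affineAction hp hpq, fun _ => rfl, fun _ _ => rfl,
    RestrictedUnitary.eq_coadjoint_iff hp hpq, fun _ _ _ => rfl, fun g γ => ?_,
    blockDiagonal_injective, fun γ hγ => comap_stabilizer_eq_range hp hpq hγ, inferInstance,
    hU.chartedSpace, hU.lieGroup _, hU.isSmoothEmbedding _, ?_⟩
  · refine ⟨(RestrictedUnitary.coadjoint hp hpq g).toContinuousAffineEquiv.trans
      (ContinuousAffineEquiv.constVAdd ℝ (Predual K q)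
        (-(γ • RestrictedUnitary.cocycle hp hpq g))), fun μ => ?_⟩
    rw [RestrictedUnitary.affineAction_apply, sub_eq_neg_add]
    rfl
  · have hc : CompleteSpace (skewCommutant (polarizationElement K p)) :=
      (isClosed_skewCommutant _).completeSpace_coe
    exact ⟨skewCommutant (polarizationElement K p), inferInstance, inferInstance, hc,
      hS.chartedSpace, hS.lieGroup _,
      hS.isSmoothEmbedding_hom hU _ (Subgroup.subtype _) (fun _ => rfl) (skewCommutant_le _)⟩
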